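/- \textbf{Setting.} Bi-moments are sequences $\mu=(\mu_j)_{j\in\mathbb Z}$ of complex numbers. On the space of bi-moments consider the vector fields $$T_k(\mu_j)=\mu_{j+k},\qquad V_k(\mu_j)=(j+k)\,\mu_{j+k},\qquad k\in\mathbb Z,$$ where $T_k$ are the vector fields of the (semi-infinite) Ablowitz–Ladik hierarchy. For a function $F$ of the bi-moments, $V_k(F)$ denotes the (Lie) derivative of $F$ in the direction of $V_k$. A bilinear form $\mathcal L$ on $\mathbb C[z,z^{-1}]$ is Toeplitz if $\mathcal L[z^m,z^n]=\mathcal L[z^{m-n},1]=:\mu_{m-n}$, and quasi-definite if $\det(\mu_{k-l})_{0\le k,l\le n-1}\ne0$ for all $n\ge1$. Let $\mathcal L$ be Toeplitz and quasi-definite. There is a unique pair of sequences $f=(f_n)_{n\ge0}$, $g=(g_n)_{n\ge0}$ of monic right bi-orthogonal Laurent polynomials: with $\mathbb L_{-1}=\{0\}$, $\mathbb L_{2m}=\langle z^{-m},\dots,z^{m}\rangle$, $\mathbb L_{2m+1}=\langle z^{-m},\dots,z^{m+1}\rangle$, one has $f_n,g_n\in\mathbb L_n\setminus\mathbb L_{n-1}$,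 the coefficients of $z^{-m}$ in $f_{2m},g_{2m}$ and of $z^{m+1}$ in $f_{2m+1},g_{2m+1}$ are $1$, and $\mathcal L[f_n,g_m]=h_n\delta_{n,m}$ with $h_n\neq0$. Each of $(f_n)$, $(g_n)$, $(h_n^{-1}g_n(z^{-1}))$, $(h_n^{-1}f_n(z^{-1}))$ is a basis of $\mathbb C[z,z^{-1}]$. The generalized CMV matrices are the semi-infinite matrices defined by $zf=A_1f$, $zg=A_2g$; they are pentadiagonal. With $h=\mathrm{diag}(h_n)$, the matrices $A_1^*=hA_2^Th^{-1}$ and $A_2^*=hA_1^Th^{-1}$ represent multiplication by $z^{-1}$ in the bases $f$ and $g$ and are two-sided inverses of $A_1$, $A_2$; this defines $A_i^k$ for all $k\in\mathbb Z$. The semi-infinite matrices $D_1,D_1^*,D_2,D_2^*$ are defined by: $D_1$ and $(D_1^*)^T$ represent $d/dz$ in the bases $(f_n)$ and $(h_n^{-1}g_n(z^{-1}))$, and $D_2$ and $(D_2^*)^T$ represent $d/dz$ in the bases $(g_n)$ and $(h_n^{-1}f_n(z^{-1}))$. For a matrix $A$, $A_{--}$ is its strictly lower triangular part. Let $t=(t_1,t_2,\dots)$,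 $s=(s_1,s_2,\dots)$, let $S_n(t)$ be the elementary Schur polynomials, $\exp(\sum_{k\ge1}t_kz^k)=\sum_{n}S_n(t)z^n$ ($S_n=0$ for $n<0$), and $S_{i_1,\dots,i_n}(t)=\det(S_{i_r+q-r}(t))_{1\le r,q\le n}$. For arbitrary bi-moments $\mu$, let $$\mu_j(t,s)=\sum_{m,n\ge0}S_m(t)S_n(s)\,\mu_{j+m-n},\qquad \tau_n(t,s)=\det\big(\mu_{k-l}(t,s)\big)_{0\le k,l\le n-1},\quad n\ge0,$$ be the formal power series solution of the hierarchy with initial value $\mu$ (so $\mu_j(0,0)=\mu_j$, $\partial\mu_j(t,s)/\partial t_k=\mu_{j+k}(t,s)$, $\partial\mu_j(t,s)/\partial s_k=\mu_{j-k}(t,s)$ for $k\ge 1$) and its tau-functions, and let $p_{i,j}=\det(\mu_{i_k-j_l})_{0\le k,l\le n-1}$ for $0\le i_0<\dots<i_{n-1}$, $0\le j_0<\dots<j_{n-1}$ be the Plücker coordinates. Put \begin{align*} L_k^{(n)}&=\sum_{j=1}^{k-1}\frac{\partial^2}{\partial t_j\partial t_{k-j}}+n\frac{\partial}{\partial t_k}+\sum_{j\ge1}jt_j\frac{\partial}{\partial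 t_{j+k}}-\sum_{j\ge k+1}js_j\frac{\partial}{\partial s_{j-k}}-\sum_{j=1}^{k-1}js_j\frac{\partial}{\partial t_{k-j}}-nks_k,\quad k\ge1,\\ L_0^{(n)}&=\sum_{j\ge1}jt_j\frac{\partial}{\partial t_j}-\sum_{j\ge1}js_j\frac{\partial}{\partial s_j},\\ L_{-k}^{(n)}&=-\sum_{j=1}^{k-1}\frac{\partial^2}{\partial s_j\partial s_{k-j}}-n\frac{\partial}{\partial s_k}-\sum_{j\ge1}js_j\frac{\partial}{\partial s_{j+k}}+\sum_{j\ge k+1}jt_j\frac{\partial}{\partial t_{j-k}}+\sum_{j=1}^{k-1}jt_j\frac{\partial}{\partial s_{k-j}}+nkt_k,\quad k\ge1. \end{align*} \textbf{Theorem.} The facts asserted in the setting hold, and the $V_k$, $k\in\mathbb Z$, form a centerless Virasoro algebra of master symmetries of the Ablowitz–Ladik hierarchy: for all $k,l\in\mathbb Z$, $$[T_k,T_l]=0,\quad [V_k,V_l]=(l-k)V_{k+l},\quad [V_k,T_l]=l\,T_{k+l},\quad [[V_k,T_l],T_l]=0.$$ 1) For every quasi-definite Toeplitz functional and all $k\in\mathbb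 Z$, entrywise on the CMV matrices, \begin{align*} V_k(A_1)&=\Big[A_1,\ (D_1A_1^{k+1})_{--}+(A_1^{k+1}D_1^*)_{--}+k(A_1^k)_{--}\Big],\\ V_k(A_2)&=\Big[(D_2A_2^{1-k})_{--}+(A_2^{1-k}D_2^*)_{--}-k(A_2^{-k})_{--},\ A_2\Big]. \end{align*} 2) For all bi-moments $\mu$, all $n\ge0$ and all $k,l\in\mathbb Z$: $[L_k^{(n)},L_l^{(n)}]=(k-l)L_{k+l}^{(n)}$ on formal power series in $(t,s)$; one has the expansion $$\tau_n(t,s)=\sum_{\substack{0\le i_0<\dots<i_{n-1}\\0\le j_0<\dots<j_{n-1}}}p_{i,j}\,S_{i_{n-1}-(n-1),\dots,i_0}(t)\,S_{j_{n-1}-(n-1),\dots,j_0}(s);$$ and $$V_k\tau_n(t,s)=L_k^{(n)}\tau_n(t,s),$$ where $V_k$ acts on the coefficients of the power series $\tau_n(t,s)$, as functions of the initial bi-moments $\mu$; equivalently, $$L_k^{(n)}\tau_n(t,s)=\sum_{\substack{0\le i_0<\dots<i_{n-1}\\0\le j_0<\dots<j_{n-1}}}V_k(p_{i,j})\,S_{i_{n-1}-(n-1),\dots,i_0}(t)\,S_{j_{n-1}-(n-1),\dots,j_0}(s).$$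 -/

import Mathlib

open scoped LaurentPolynomial

noncomputable section

namespace AblowitzLadik

/-! ### Vector fields on the space of bi-moments -/

/-- Toeplitz bi-moments `μ_{mn} = μ_{m-n}`, as a sequence indexed by `ℤ`. -/
abbrev Moments := ℤ → ℂ

/-- A vector field on the space of bi-moments. -/
abbrev VField := Moments → Moments

/-- `X(F)(μ) = F'`: the function `F` of the bi-moments has derivative `F'` along every curve
which passes through `μ` with velocity `X(μ)`. -/
def HasLieDerivAt (X : VField) (F : Moments → ℂ) (μ : Moments) (F' : ℂ) : Prop :=
  ∀ γ : ℝ → Moments, γ 0 = μ → (∀ j, HasDerivAt (fun u => γ u j) (X μ j) 0) →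
    HasDerivAt (fun u => F (γ u)) F' 0

/-- `[X, Y] = Z`, that is `Z(μ_j) = X(Y(μ_j)) - Y(X(μ_j))` for all `j`. -/
def IsLieBracket (X Y Z : VField) : Prop :=
  ∀ (μ : Moments) (j : ℤ), ∃ a b : ℂ,
    HasLieDerivAt X (fun ν => Y ν j) μ a ∧ HasLieDerivAt Y (fun ν => X ν j) μ b ∧
      Z μ j = a - b

/-- The Ablowitz–Ladik vector fields `T_k(μ_j) = μ_{j+k}`. -/
def alField (k : ℤ) : VField := fun μ j => μ (j + k)

/-- The master symmetries `V_k(μ_j) = (j+k) μ_{j+k}`. -/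
def masterField (k : ℤ) : VField := fun μ j => ((j + k : ℤ) : ℂ) * μ (j + k)

/-! ### Bi-moment functionals and bi-orthogonal Laurent polynomials -/

/-- Bilinear forms on the ring of Laurent polynomials. -/
abbrev BiMomentFunctional := ℂ[T;T⁻¹] →ₗ[ℂ] ℂ[T;T⁻¹] →ₗ[ℂ] ℂ

/-- The monomial `z ^ n`. -/
abbrev z (n : ℤ) : ℂ[T;T⁻¹] := LaurentPolynomial.T n

def IsToeplitz (𝓛 : BiMomentFunctional) : Prop :=
  ∀ m n : ℤ, 𝓛 (z m) (z n) = 𝓛 (z (m - n)) (z 0)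

def IsQuasiDefinite (𝓛 : BiMomentFunctional) : Prop :=
  ∀ n : ℕ, 1 ≤ n →
    (Matrix.of fun k l : Fin n => 𝓛 (z ((k : ℕ) : ℤ)) (z ((l : ℕ) : ℤ))).det ≠ 0

/-- The bi-moments `μ_j = 𝓛[z^j, 1]` of a Toeplitz functional. -/
def moments (𝓛 : BiMomentFunctional) : Moments := fun j => 𝓛 (z j) (z 0)

/-- The Toeplitz functional with given bi-moments. -/
def toeplitz (μ : Moments) : BiMomentFunctional :=
  (AddMonoidAlgebra.basis ℤ ℂ).constr ℂ fun m =>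
    (AddMonoidAlgebra.basis ℤ ℂ).constr ℂ fun n => μ (m - n)

theorem toeplitz_z (μ : Moments) (m n : ℤ) : toeplitz μ (z m) (z n) = μ (m - n) := by
  have h : ∀ k : ℤ, z k = AddMonoidAlgebra.basis ℤ ℂ k := fun k => by
    rw [AddMonoidAlgebra.basis_apply]; rfl
  rw [h, h, toeplitz, Module.Basis.constr_basis, Module.Basis.constr_basis]

/-- Toeplitz functionals correspond to their sequences of bi-moments. -/
theorem toeplitz_moments (𝓛 : BiMomentFunctional) (h : IsToeplitz 𝓛) :
    toeplitz (moments 𝓛) = 𝓛 := by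
  have hz : ∀ k : ℤ, AddMonoidAlgebra.basis ℤ ℂ k = z k := fun k => by
    rw [AddMonoidAlgebra.basis_apply]; rfl
  refine (AddMonoidAlgebra.basis ℤ ℂ).ext fun m => (AddMonoidAlgebra.basis ℤ ℂ).ext fun n => ?_
  rw [hz, hz, toeplitz_z, h m n]
  rfl

/-- The span of `z^m, z^{m+1}, …, z^n`. -/
def span (m n : ℤ) : Submodule ℂ ℂ[T;T⁻¹] := Submodule.span ℂ (z '' Set.Icc m n)

/-- The span of the first `n + 1` elements of `1, z, z⁻¹, z², z⁻², …`; it is zero for `n = -1`. -/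
def LPlus (n : ℤ) : Submodule ℂ ℂ[T;T⁻¹] := span (-(n / 2)) ((n + 1) / 2)

theorem LPlus_neg_one : LPlus (-1) = ⊥ := by
  simp [LPlus, span]

/-- `f, g` is a sequence of right bi-orthogonal Laurent polynomials for `𝓛`. -/
def IsRightBiorthogonal (𝓛 : BiMomentFunctional) (f g : ℕ → ℂ[T;T⁻¹]) : Prop :=
  (∀ n : ℕ, f n ∈ LPlus n ∧ f n ∉ LPlus ((n : ℤ) - 1) ∧
    g n ∈ LPlus n ∧ g n ∉ LPlus ((n : ℤ) - 1)) ∧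
  (∀ n m : ℕ, n ≠ m → 𝓛 (f n) (g m) = 0) ∧ ∀ n : ℕ, 𝓛 (f n) (g n) ≠ 0

/-- The exponent of the leading monomial: `-m` for `n = 2m` and `m + 1` for `n = 2m + 1`. -/
def leadExp (n : ℕ) : ℤ := if Even n then -((n / 2 : ℕ) : ℤ) else ((n / 2 : ℕ) : ℤ) + 1

def IsMonic (f : ℕ → ℂ[T;T⁻¹]) : Prop := ∀ n, (f n).coeff (leadExp n) = 1

/-- The Toeplitz determinant `det (μ_{k-l})_{0 ≤ k, l ≤ n-1}`. -/
def toeplitzDet (μ : Moments) (n : ℕ) : ℂ :=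
  (Matrix.of fun k l : Fin n => μ (((k : ℕ) : ℤ) - ((l : ℕ) : ℤ))).det

/-- The monic bi-orthogonal polynomial `p_n^{(1)}`. -/
def p1 (μ : Moments) (n : ℕ) : ℂ[T;T⁻¹] :=
  (toeplitzDet μ n)⁻¹ • (Matrix.of fun k l : Fin (n + 1) =>
    if (l : ℕ) < n then LaurentPolynomial.C (μ (((k : ℕ) : ℤ) - ((l : ℕ) : ℤ))) else z (k : ℕ)).det

/-- The monic bi-orthogonal polynomial `p_n^{(2)}`. -/
def p2 (μ : Moments) (n : ℕ) : ℂ[T;T⁻¹] :=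
  (toeplitzDet μ n)⁻¹ • (Matrix.of fun k l : Fin (n + 1) =>
    if (k : ℕ) < n then LaurentPolynomial.C (μ (((k : ℕ) : ℤ) - ((l : ℕ) : ℤ))) else z (l : ℕ)).det

/-- `P(z) ↦ P(z⁻¹)`. -/
def star (P : ℂ[T;T⁻¹]) : ℂ[T;T⁻¹] := LaurentPolynomial.invert P

/-- The monic right bi-orthogonal Laurent polynomials `f_n`:
`f_{2m}(z) = z^m p_{2m}^{(2)}(z⁻¹)` and `f_{2m+1}(z) = z^{-m} p_{2m+1}^{(1)}(z)`. -/
def f (μ : Moments) (n : ℕ) : ℂ[T;T⁻¹] :=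
  if Even n then z ((n / 2 : ℕ) : ℤ) * star (p2 μ n) else z (-((n / 2 : ℕ) : ℤ)) * p1 μ n

/-- The monic right bi-orthogonal Laurent polynomials `g_n`:
`g_{2m}(z) = z^m p_{2m}^{(1)}(z⁻¹)` and `g_{2m+1}(z) = z^{-m} p_{2m+1}^{(2)}(z)`. -/
def g (μ : Moments) (n : ℕ) : ℂ[T;T⁻¹] :=
  if Even n then z ((n / 2 : ℕ) : ℤ) * star (p1 μ n) else z (-((n / 2 : ℕ) : ℤ)) * p2 μ n

/-- `h_n = 𝓛[f_n, g_n]`. -/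
def h (μ : Moments) (n : ℕ) : ℂ := toeplitz μ (f μ n) (g μ n)

/-! ### Semi-infinite matrices -/

abbrev SMatrix := Matrix ℕ ℕ ℂ

/-- Product of semi-infinite matrices. The left factor has finite rows wherever it is used, so that
every entry is a finite sum. -/
def mul (A B : SMatrix) : SMatrix := Matrix.of fun i j => ∑ᶠ l, A i l * B l j

def npow (A : SMatrix) : ℕ → SMatrix
  | 0 => 1
  | n + 1 => mul (npow A n) A

/-- `A ^ k` for an integer `k`, where `A'` is the inverse of `A`. -/
def zpow (A A' : SMatrix) : ℤ → SMatrix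
  | Int.ofNat n => npow A n
  | Int.negSucc n => npow A' (n + 1)

def commutator (A B : SMatrix) : SMatrix := mul A B - mul B A

/-- The strictly lower triangular part. -/
def strictLower (A : SMatrix) : SMatrix := Matrix.of fun i j => if j < i then A i j else 0

/-- `M` represents the operator `Φ` in the family `b`: `Φ(b) = M b`, with finite rows. -/
def Represents (M : SMatrix) (Φ : ℂ[T;T⁻¹] → ℂ[T;T⁻¹]) (b : ℕ → ℂ[T;T⁻¹]) : Prop :=
  ∀ i, (Function.support (M i)).Finite ∧ Φ (b i) = ∑ᶠ j, M i j • b j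

/-- `b` is a basis of the space of Laurent polynomials. -/
def IsBasis (b : ℕ → ℂ[T;T⁻¹]) : Prop :=
  LinearIndependent ℂ b ∧ Submodule.span ℂ (Set.range b) = ⊤

/-- The derivation `d/dz` of Laurent polynomials. -/
def ddz (P : ℂ[T;T⁻¹]) : ℂ[T;T⁻¹] := P.coeff.sum fun n a => ((n : ℂ) * a) • z (n - 1)

/-- The CMV matrix `A₁`, with entries the coefficients of `z f_i` in the basis `f`. -/
def A1 (μ : Moments) : SMatrix :=
  Matrix.of fun i j => toeplitz μ (z 1 * f μ i) (g μ j) / h μ j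

/-- The CMV matrix `A₂`, with entries the coefficients of `z g_i` in the basis `g`. -/
def A2 (μ : Moments) : SMatrix :=
  Matrix.of fun i j => toeplitz μ (f μ j) (z 1 * g μ i) / h μ j

/-- `A₁* = h A₂ᵀ h⁻¹`. -/
def A1star (μ : Moments) : SMatrix := Matrix.of fun i j => h μ i * A2 μ j i * (h μ j)⁻¹

/-- `A₂* = h A₁ᵀ h⁻¹`. -/
def A2star (μ : Moments) : SMatrix := Matrix.of fun i j => h μ i * A1 μ j i * (h μ j)⁻¹

/-- Integer powers of `A₁`, with `A₁⁻¹ = A₁*`. -/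
def A1pow (μ : Moments) (k : ℤ) : SMatrix := zpow (A1 μ) (A1star μ) k

/-- Integer powers of `A₂`, with `A₂⁻¹ = A₂*`. -/
def A2pow (μ : Moments) (k : ℤ) : SMatrix := zpow (A2 μ) (A2star μ) k

/-- The sequence `h_n⁻¹ g_n(z⁻¹)`. -/
def gDual (μ : Moments) (n : ℕ) : ℂ[T;T⁻¹] := (h μ n)⁻¹ • star (g μ n)

/-- The sequence `h_n⁻¹ f_n(z⁻¹)`. -/
def fDual (μ : Moments) (n : ℕ) : ℂ[T;T⁻¹] := (h μ n)⁻¹ • star (f μ n)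

/-! ### Formal power series in `t₁, t₂, …, s₁, s₂, …` -/

/-- The space of formal power series in `(t, s)`. -/
abbrev Series := MvPowerSeries (ℕ+ ⊕ ℕ+) ℂ

def t (j : ℕ+) : Series := MvPowerSeries.X (Sum.inl j)

def s (j : ℕ+) : Series := MvPowerSeries.X (Sum.inr j)

/-- `∂/∂t_j`. -/
def dt (j : ℕ+) (F : Series) : Series := MvPowerSeries.pderiv ℂ (Sum.inl j) F

/-- `∂/∂s_j`. -/
def ds (j : ℕ+) (F : Series) : Series := MvPowerSeries.pderiv ℂ (Sum.inr j) F

/-- The coefficientwise sum of a family in which every monomial occurs finitely often. -/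
def formalSum {ι : Type} (G : ι → Series) : Series :=
  fun d => ∑ᶠ i, MvPowerSeries.coeff d (G i)

/-- `F` is the sum of the family `G`, in which every monomial occurs finitely often. -/
def HasFormalSum {ι : Type} (G : ι → Series) (F : Series) : Prop :=
  ∀ d, {i | MvPowerSeries.coeff d (G i) ≠ 0}.Finite ∧
    MvPowerSeries.coeff d F = ∑ᶠ i, MvPowerSeries.coeff d (G i)

/-- `∑_{k ≥ 1} x_k z^k`. -/
def timeSeries (x : ℕ+ → Series) : PowerSeries Series :=
  PowerSeries.mk fun k => if hk : 0 < k then x ⟨k, hk⟩ else 0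

theorem hasSubst_timeSeries (x : ℕ+ → Series) : PowerSeries.HasSubst (timeSeries x) :=
  PowerSeries.HasSubst.of_constantCoeff_zero' (by
    simp [timeSeries, ← PowerSeries.coeff_zero_eq_constantCoeff_apply])

/-- The elementary Schur polynomials `S_n(x)`, the coefficients of `exp (∑_{k ≥ 1} x_k z^k)`. -/
def elemSchur (x : ℕ+ → Series) : ℤ → Series
  | Int.ofNat n => PowerSeries.coeff n ((PowerSeries.exp ℂ).subst (timeSeries x) :
      PowerSeries Series)
  | Int.negSucc _ => 0

/-- The Schur polynomial `S_{i_{n-1}-(n-1), …, i_1-1, i_0}(x)`, the determinant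
`det (S_{λ_a + b - a}(x))_{a,b}` with `λ = (i_{n-1}-(n-1), …, i_1-1, i_0)`. -/
def schur {n : ℕ} (x : ℕ+ → Series) (i : Fin n ↪o ℕ) : Series :=
  (Matrix.of fun a b : Fin n =>
    elemSchur x (((i a.rev : ℕ) : ℤ) - ((a.rev : ℕ) : ℤ) + ((b : ℕ) : ℤ) - ((a : ℕ) : ℤ))).det

/-- The solution `μ_j(t, s) = ∑_{m, n ≥ 0} S_m(t) S_n(s) μ_{j+m-n}` of the hierarchy with initial
value `μ`. -/
def momentSeries (μ : Moments) (j : ℤ) : Series :=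
  formalSum fun p : ℕ × ℕ => μ (j + p.1 - p.2) • (elemSchur t p.1 * elemSchur s p.2)

/-- The tau-function `τ_n(t, s) = det (μ_{k-l}(t, s))_{0 ≤ k, l ≤ n-1}`. -/
def tau (n : ℕ) (μ : Moments) : Series :=
  (Matrix.of fun k l : Fin n => momentSeries μ (((k : ℕ) : ℤ) - ((l : ℕ) : ℤ))).det

/-- The Plücker coordinates `det (μ_{i_k - j_l})_{0 ≤ k, l ≤ n-1}`. -/
def plucker {n : ℕ} (i j : Fin n ↪o ℕ) (μ : Moments) : ℂ :=
  (Matrix.of fun k l : Fin n => μ (((i k : ℕ) : ℤ) - ((j l : ℕ) : ℤ))).det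

/-- `L_k^{(n)}` for `k ≥ 1`. -/
def Lpos (n : ℕ) (k : ℕ+) (F : Series) : Series :=
  ∑ j ∈ Finset.Ico 1 k, dt j (dt (k - j) F) + (n : ℂ) • dt k F
    + formalSum (fun j : ℕ+ => (j : ℂ) • (t j * dt (j + k) F))
    - formalSum (fun j : ℕ+ => if k < j then (j : ℂ) • (s j * ds (j - k) F) else 0)
    - ∑ j ∈ Finset.Ico 1 k, (j : ℂ) • (s j * dt (k - j) F)
    - ((n : ℂ) * (k : ℂ)) • (s k * F)

/-- `L_0^{(n)}`. -/
def Lzero (F : Series) : Series :=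
  formalSum (fun j : ℕ+ => (j : ℂ) • (t j * dt j F))
    - formalSum (fun j : ℕ+ => (j : ℂ) • (s j * ds j F))

/-- `L_{-k}^{(n)}` for `k ≥ 1`. -/
def Lneg (n : ℕ) (k : ℕ+) (F : Series) : Series :=
  -∑ j ∈ Finset.Ico 1 k, ds j (ds (k - j) F) - (n : ℂ) • ds k F
    - formalSum (fun j : ℕ+ => (j : ℂ) • (s j * ds (j + k) F))
    + formalSum (fun j : ℕ+ => if k < j then (j : ℂ) • (t j * dt (j - k) F) else 0)
    + ∑ j ∈ Finset.Ico 1 k, (j : ℂ) • (t j * ds (k - j) F)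
    + ((n : ℂ) * (k : ℂ)) • (t k * F)

/-- The operators `L_k^{(n)}`, `k ∈ ℤ`. -/
def L (n : ℕ) : ℤ → Series → Series
  | Int.ofNat 0 => Lzero
  | Int.ofNat (k + 1) => Lpos n k.succPNat
  | Int.negSucc k => Lneg n k.succPNat

end AblowitzLadik

end

open AblowitzLadik

open scoped LaurentPolynomial

noncomputable section

namespace AblowitzLadik


/-! ### Lie derivatives along vector fields -/

/-! The fields are linear in the bi-moments, so the brackets are computed coordinate by coordinate.
What remains is the Lax pair, the algebra of the operators `L`, and the tau-functions.

Lax pair. A Toeplitz form is `P, Q ↦ M(P(z) Q(1/z))` for one functional `M`, and `V_k` acts on `M`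
as the transpose of `z (d/dz) z^k` (`momentFunctional_masterField`). By the product rule, the matrix
`N` of the varied form, with column `j` divided by `h_j`, is `D₁A₁^{k+1} + A₁^{k+1}D₁* + kA₁^k`
(`masterField_pairing`). Along any curve of bi-moments, monicity forces the derivatives of `f_n` and
`g_n` into the span of their predecessors. Differentiating orthogonality then expresses these
derivatives through triangular parts of `N`, and the variation of `A₁` becomes `[A₁, N₋₋]`
(`hasDerivAt_A1`). The reflection `μ_j ↦ μ_{-j}` exchanges `f` with `g` and turns `V_k` into
`-V_{-k}`, which gives `A₂`.

Virasoro operators. With commuting modes `a_m` (`∂/∂t_m`, `∂/∂s_{-m}`, and the scalar `n` for `m =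
0`), every `L_k` is `∑_i i x_i a_{i+k}` plus the sum of `a_j a_{k-j}` over `0 < j ≤ k`, where `x_i`
is `t_i` or `s_{-i}` up to the sign convention of `exponent`. Reading the interval with orientation
makes one formula valid for all signs of `k` (`L_eq_vir`). The commutator then follows from `[a_m,
x-part of L_k] = m a_{m+k}` and additivity of oriented sums.

Tau-functions. `V_k` of an entry of the Toeplitz matrix splits into a time-weighted sum, which
assembles to the first order part of `L_k`, and the entry shifted by `k` times its shifted index
(`momentSeries_masterField`). The second piece must match the quadratic part. Both are combinations
of determinants with one row raised by `k`: the weights `row - column + k` become row weights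
because a Toeplitz matrix is symmetric about its antidiagonal (`sum_weighted_shift`), and in the
second derivatives the terms moving two different rows cancel in pairs by antisymmetry, up to one
term per pair (`sum_doubleDet`). The two lists of weights agree.

Plücker expansion. The moment matrix factors as (Schur in `t`) · (moments) · (Schur in `s`).
Cauchy–Binet for finite truncations, with homogeneity of the Schur polynomials, gives the expansion.
Its terms are locally finite uniformly in `μ`, so it can be differentiated termwise. -/

theorem HasLieDerivAt.coord (X : VField) (μ : Moments) (j : ℤ) :
    HasLieDerivAt X (fun ν => ν j) μ (X μ j) := fun _ _ hd => hd j

theorem HasLieDerivAt.const_mul {X : VField} {F : Moments → ℂ} {μ : Moments} {F' : ℂ}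
    (hF : HasLieDerivAt X F μ F') (c : ℂ) :
    HasLieDerivAt X (fun ν => c * F ν) μ (c * F') := fun γ h0 hd => (hF γ h0 hd).const_mul c

theorem hasDerivAt_line (μ ν : Moments) (j : ℤ) :
    HasDerivAt (fun u : ℝ => (fun i => μ i + (u : ℂ) * ν i : Moments) j) (ν j) 0 := by
  have h1 : HasDerivAt (fun u : ℝ => (u : ℂ)) 1 0 := Complex.ofRealCLM.hasDerivAt
  simpa using (h1.mul_const (ν j)).const_add (μ j)

/-- The straight line with velocity `X μ` is an admissible test curve, so the condition over all
curves is never vacuous. -/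
theorem HasLieDerivAt.unique {X : VField} {F : Moments → ℂ} {μ : Moments} {a b : ℂ}
    (ha : HasLieDerivAt X F μ a) (hb : HasLieDerivAt X F μ b) : a = b :=
  (ha (fun u i => μ i + (u : ℂ) * X μ i) (by ext; simp) (hasDerivAt_line μ (X μ))).unique
    (hb (fun u i => μ i + (u : ℂ) * X μ i) (by ext; simp) (hasDerivAt_line μ (X μ)))

theorem IsLieBracket.unique {X Y Z Z' : VField} (h : IsLieBracket X Y Z)
    (h' : IsLieBracket X Y Z') : Z = Z' := by
  ext μ j
  obtain ⟨a, b, ha, hb, hZ⟩ := h μ j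
  obtain ⟨a', b', ha', hb', hZ'⟩ := h' μ j
  rw [hZ, hZ', ha.unique ha', hb.unique hb']

theorem isLieBracket_alField (k l : ℤ) : IsLieBracket (alField k) (alField l) 0 := fun μ j =>
  ⟨_, _, HasLieDerivAt.coord _ μ (j + l), HasLieDerivAt.coord _ μ (j + k), by
    simp [alField, add_right_comm j l k]⟩

theorem isLieBracket_smul_alField (c : ℂ) (k l : ℤ) :
    IsLieBracket (c • alField k) (alField l) 0 := fun μ j =>
  ⟨_, _, HasLieDerivAt.coord _ μ (j + l), (HasLieDerivAt.coord _ μ (j + k)).const_mul c, by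
    simp [alField, add_right_comm j l k]⟩

theorem isLieBracket_masterField (k l : ℤ) : IsLieBracket (masterField k) (masterField l)
    (((l - k : ℤ) : ℂ) • masterField (k + l)) := fun μ j =>
  ⟨_, _, (HasLieDerivAt.coord _ μ (j + l)).const_mul _, (HasLieDerivAt.coord _ μ (j + k)).const_mul _, by
    simp only [masterField, Pi.smul_apply, smul_eq_mul]
    rw [add_right_comm j l k, add_assoc j k l]
    push_cast
    ring⟩

theorem isLieBracket_masterField_alField (k l : ℤ) : IsLieBracket (masterField k) (alField l)
    ((l : ℂ) • alField (k + l)) := fun μ j =>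
  ⟨_, _, HasLieDerivAt.coord _ μ (j + l), (HasLieDerivAt.coord _ μ (j + k)).const_mul _, by
    simp only [masterField, alField, Pi.smul_apply, smul_eq_mul]
    rw [add_right_comm j l k, add_assoc j k l]
    push_cast
    ring⟩

theorem isLieBracket_bracket_alField (k l : ℤ) (Z : VField)
    (hZ : IsLieBracket (masterField k) (alField l) Z) : IsLieBracket Z (alField l) 0 := by
  rw [hZ.unique (isLieBracket_masterField_alField k l)]
  exact isLieBracket_smul_alField _ _ _


/-! ### Laurent polynomials and the moment functional -/

theorem basis_eq_z (k : ℤ) : AddMonoidAlgebra.basis ℤ ℂ k = z k := by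
  rw [AddMonoidAlgebra.basis_apply]; rfl

theorem linearMap_ext_z {M : Type*} [AddCommMonoid M] [Module ℂ M] {φ ψ : ℂ[T;T⁻¹] →ₗ[ℂ] M}
    (h : ∀ n, φ (z n) = ψ (z n)) : φ = ψ :=
  (AddMonoidAlgebra.basis ℤ ℂ).ext fun n => by simpa only [basis_eq_z] using h n

theorem z_mul_z (m n : ℤ) : z m * z n = z (m + n) := (LaurentPolynomial.T_add m n).symm

theorem z_zero : z 0 = 1 := rfl

theorem z_mul_z_mul (m n : ℤ) (P : ℂ[T;T⁻¹]) : z m * (z n * P) = z (m + n) * P := by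
  rw [← mul_assoc, z_mul_z]

/-- Multiplication by `z ^ k`, as a linear map. -/
def mulZ (k : ℤ) : ℂ[T;T⁻¹] →ₗ[ℂ] ℂ[T;T⁻¹] := LinearMap.mulLeft ℂ (z k)

@[simp] theorem mulZ_apply (k : ℤ) (P : ℂ[T;T⁻¹]) : mulZ k P = z k * P := rfl

/-- `star` as a linear map. -/
def starₗ : ℂ[T;T⁻¹] →ₗ[ℂ] ℂ[T;T⁻¹] := (LaurentPolynomial.invert (R := ℂ)).toLinearMap

@[simp] theorem starₗ_apply (P : ℂ[T;T⁻¹]) : starₗ P = star P := rfl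

theorem star_z (n : ℤ) : star (z n) = z (-n) := LaurentPolynomial.invert_T n

theorem star_mul (P Q : ℂ[T;T⁻¹]) : star (P * Q) = star P * star Q := map_mul _ _ _

theorem star_star (P : ℂ[T;T⁻¹]) : star (star P) = P := LaurentPolynomial.involutive_invert P

theorem star_smul (c : ℂ) (P : ℂ[T;T⁻¹]) : star (c • P) = c • star P := map_smul starₗ c P

theorem coeff_star (P : ℂ[T;T⁻¹]) (n : ℤ) : (star P).coeff n = P.coeff (-n) :=
  LaurentPolynomial.invert_apply P n

/-- `d/dz` as a linear map. -/
def ddzₗ : ℂ[T;T⁻¹] →ₗ[ℂ] ℂ[T;T⁻¹] :=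
  (AddMonoidAlgebra.basis ℤ ℂ).constr ℂ fun n => (n : ℂ) • z (n - 1)

theorem ddzₗ_z (n : ℤ) : ddzₗ (z n) = (n : ℂ) • z (n - 1) := by
  rw [← basis_eq_z, ddzₗ, Module.Basis.constr_basis]

theorem ddz_eq (P : ℂ[T;T⁻¹]) : ddz P = ddzₗ P := by
  induction P using LaurentPolynomial.induction_on' with
  | add P Q hP hQ =>
    rw [map_add, ← hP, ← hQ]
    simp only [ddz]
    rw [AddMonoidAlgebra.coeff_add, Finsupp.sum_add_index']
    · simp
    · intro a b c; simp [mul_add, add_smul]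
  | C_mul_T n a =>
    rw [← LaurentPolynomial.smul_eq_C_mul, map_smul, ddzₗ_z, LaurentPolynomial.smul_eq_C_mul,
      ← LaurentPolynomial.single_eq_C_mul_T]
    simp only [ddz]
    rw [AddMonoidAlgebra.coeff_single, Finsupp.sum_single_index (by simp)]
    rw [smul_smul, mul_comm]

theorem ddzₗ_mul (P Q : ℂ[T;T⁻¹]) : ddzₗ (P * Q) = ddzₗ P * Q + P * ddzₗ Q := by
  have key : (LinearMap.mul ℂ ℂ[T;T⁻¹]).compr₂ ddzₗ =
      (LinearMap.mul ℂ ℂ[T;T⁻¹]) ∘ₗ ddzₗ + (LinearMap.mul ℂ ℂ[T;T⁻¹]).compl₂ ddzₗ := by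
    refine linearMap_ext_z fun m => linearMap_ext_z fun n => ?_
    simp only [LinearMap.compr₂_apply, LinearMap.mul_apply', LinearMap.add_apply,
      LinearMap.comp_apply, LinearMap.compl₂_apply, z_mul_z, ddzₗ_z, smul_mul_assoc,
      mul_smul_comm]
    rw [show m - 1 + n = m + n - 1 by ring, show m + (n - 1) = m + n - 1 by ring, ← add_smul]
    push_cast
    rfl
  simpa using congrArg (fun φ => φ P Q) key

/-- The first summand is the origin of the term `k A₁^k` in the Lax pair. -/
theorem ddzₗ_z_mul (k : ℤ) (P : ℂ[T;T⁻¹]) :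
    z 1 * ddzₗ (z k * P) = (k : ℂ) • (z k * P) + z (k + 1) * ddzₗ P := by
  rw [ddzₗ_mul, ddzₗ_z, smul_mul_assoc, mul_add, mul_smul_comm, z_mul_z_mul, z_mul_z_mul,
    add_sub_cancel, add_comm 1 k]

/-- The functional `z ^ j ↦ μ_j`. -/
def momentFunctional (μ : Moments) : ℂ[T;T⁻¹] →ₗ[ℂ] ℂ := (AddMonoidAlgebra.basis ℤ ℂ).constr ℂ μ

theorem momentFunctional_z (μ : Moments) (n : ℤ) : momentFunctional μ (z n) = μ n := by
  rw [← basis_eq_z, momentFunctional, Module.Basis.constr_basis]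

/-- Reduces the form to a single functional on products, so that multiplications and derivations can
be moved freely between the two arguments. -/
theorem toeplitz_eq (μ : Moments) (P Q : ℂ[T;T⁻¹]) :
    toeplitz μ P Q = momentFunctional μ (P * star Q) := by
  have key : toeplitz μ =
      ((LinearMap.mul ℂ ℂ[T;T⁻¹]).compl₂ starₗ).compr₂ (momentFunctional μ) := by
    refine linearMap_ext_z fun m => linearMap_ext_z fun n => ?_
    simp only [toeplitz_z, LinearMap.compr₂_apply, LinearMap.compl₂_apply, LinearMap.mul_apply',
      starₗ_apply, star_z, z_mul_z, momentFunctional_z, sub_eq_add_neg]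
  simpa using congrArg (fun φ => φ P Q) key

theorem toeplitz_z_mul_left (μ : Moments) (k : ℤ) (P Q : ℂ[T;T⁻¹]) :
    toeplitz μ (z k * P) Q = toeplitz μ P (z (-k) * Q) := by
  rw [toeplitz_eq, toeplitz_eq, star_mul, star_z, neg_neg]
  congr 1
  ring

/-- The transpose of `V_k` on polynomials is `z (d/dz) z^k`: on `z^n` it gives `(n+k) z^{n+k}`. -/
theorem momentFunctional_masterField (k : ℤ) (μ : Moments) (P : ℂ[T;T⁻¹]) :
    momentFunctional (masterField k μ) P = momentFunctional μ (z 1 * ddzₗ (z k * P)) := by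
  have key : momentFunctional (masterField k μ) =
      momentFunctional μ ∘ₗ mulZ 1 ∘ₗ ddzₗ ∘ₗ mulZ k := by
    refine linearMap_ext_z fun n => ?_
    simp only [LinearMap.comp_apply, mulZ_apply, momentFunctional_z, z_mul_z, ddzₗ_z, map_smul, masterField, smul_eq_mul]
    rw [add_sub_cancel, add_comm k n]
  rw [key]; rfl

/-! ### Reflection of the bi-moments, exchanging the roles of `f` and `g` -/

/-- The reflected bi-moments `μ_{-j}`. -/
def reflect (μ : Moments) : Moments := fun j => μ (-j)

theorem reflect_reflect (μ : Moments) : reflect (reflect μ) = μ := by ext; simp [reflect]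

theorem toeplitz_reflect (μ : Moments) (P Q : ℂ[T;T⁻¹]) :
    toeplitz (reflect μ) P Q = toeplitz μ Q P := by
  have key : toeplitz (reflect μ) = (toeplitz μ).flip := by
    refine linearMap_ext_z fun m => linearMap_ext_z fun n => ?_
    rw [LinearMap.flip_apply, toeplitz_z, toeplitz_z, reflect, neg_sub]
  rw [key, LinearMap.flip_apply]

theorem toeplitzDet_reflect (μ : Moments) (n : ℕ) :
    toeplitzDet (reflect μ) n = toeplitzDet μ n := by
  rw [toeplitzDet, toeplitzDet, ← Matrix.det_transpose]
  congr 1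
  ext k l
  simp [reflect]

theorem p1_reflect (μ : Moments) (n : ℕ) : p1 (reflect μ) n = p2 μ n := by
  rw [p1, p2, toeplitzDet_reflect, ← Matrix.det_transpose]
  congr 2
  ext1 k l
  simp [reflect]

theorem p2_reflect (μ : Moments) (n : ℕ) : p2 (reflect μ) n = p1 μ n := by
  rw [← p1_reflect, reflect_reflect]

theorem f_reflect (μ : Moments) : f (reflect μ) = g μ := by
  ext1 n
  rw [f, g, p1_reflect, p2_reflect]

theorem g_reflect (μ : Moments) : g (reflect μ) = f μ := by
  rw [← f_reflect, reflect_reflect]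

theorem h_reflect (μ : Moments) : h (reflect μ) = h μ := by
  ext1 n
  rw [h, h, f_reflect, g_reflect, toeplitz_reflect]

theorem A1_reflect (μ : Moments) : A1 (reflect μ) = A2 μ := by
  ext i j
  simp only [A1, A2, Matrix.of_apply, f_reflect, g_reflect, toeplitz_reflect, h_reflect]

theorem A2_reflect (μ : Moments) : A2 (reflect μ) = A1 μ := by
  rw [← A1_reflect, reflect_reflect]

theorem A1star_reflect (μ : Moments) : A1star (reflect μ) = A2star μ := by
  ext i j
  simp only [A1star, A2star, Matrix.of_apply, A2_reflect, h_reflect]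

theorem gDual_reflect (μ : Moments) : gDual (reflect μ) = fDual μ := by
  ext1 n
  rw [gDual, fDual, g_reflect, h_reflect]

/-! ### The spaces `LPlus n` -/

theorem mem_span_iff {a b : ℤ} {P : ℂ[T;T⁻¹]} :
    P ∈ span a b ↔ ∀ j, ¬(a ≤ j ∧ j ≤ b) → P.coeff j = 0 := by
  constructor
  · intro hP
    rw [span] at hP
    induction hP using Submodule.span_induction with
    | mem x hx =>
      obtain ⟨n, hn, rfl⟩ := hx
      intro j hj
      rw [LaurentPolynomial.T_apply, if_neg]
      rintro rfl
      exact hj hn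
    | zero => simp
    | add x y _ _ hx hy => intro j hj; simp [hx j hj, hy j hj]
    | smul c x _ hx => intro j hj; simp [hx j hj]
  · intro hP
    have hsum : P = P.coeff.sum fun n c => c • z n := by
      conv_lhs => rw [← P.sum_coeff_single]
      refine Finsupp.sum_congr fun n _ => ?_
      rw [LaurentPolynomial.smul_eq_C_mul, ← LaurentPolynomial.single_eq_C_mul_T]
    rw [hsum]
    refine Submodule.sum_mem _ fun n hn => Submodule.smul_mem _ _ (Submodule.subset_span ⟨n, ?_, rfl⟩)
    by_contra hc
    exact (Finsupp.mem_support_iff.1 hn) (hP n hc)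

theorem mem_LPlus_iff {n : ℤ} {P : ℂ[T;T⁻¹]} :
    P ∈ LPlus n ↔ ∀ j, ¬(-(n / 2) ≤ j ∧ j ≤ (n + 1) / 2) → P.coeff j = 0 := mem_span_iff

theorem LPlus_mono {m n : ℤ} (hmn : m ≤ n) {P : ℂ[T;T⁻¹]} (hP : P ∈ LPlus m) : P ∈ LPlus n := by
  rw [mem_LPlus_iff] at *
  exact fun j hj => hP j (by omega)

theorem exists_mem_LPlus (P : ℂ[T;T⁻¹]) : ∃ n : ℕ, P ∈ LPlus n := by
  refine ⟨2 * P.coeff.support.sup Int.natAbs, mem_LPlus_iff.2 fun j hj => ?_⟩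
  by_contra hc
  have := Finset.le_sup (f := Int.natAbs) (Finsupp.mem_support_iff.2 hc)
  push_cast at hj
  omega

theorem coeff_z_mul (k : ℤ) (P : ℂ[T;T⁻¹]) (j : ℤ) : (z k * P).coeff j = P.coeff (j - k) := by
  have key : (AddMonoidAlgebra.basis ℤ ℂ).coord j ∘ₗ mulZ k =
      (AddMonoidAlgebra.basis ℤ ℂ).coord (j - k) := by
    refine linearMap_ext_z fun n => ?_
    rw [LinearMap.comp_apply, mulZ_apply, z_mul_z, ← basis_eq_z, ← basis_eq_z,
      Module.Basis.coord_apply, Module.Basis.coord_apply, Module.Basis.repr_self,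
      Module.Basis.repr_self, Finsupp.single_apply, Finsupp.single_apply]
    congr 1
    exact propext (by omega)
  exact congrArg (fun φ => φ P) key

theorem z_mul_mem_LPlus {e : ℤ} (he : e = 1 ∨ e = -1) {n : ℤ} {P : ℂ[T;T⁻¹]} (hP : P ∈ LPlus n) :
    z e * P ∈ LPlus (n + 2) := by
  rw [mem_LPlus_iff] at *
  intro j hj
  rw [coeff_z_mul]
  exact hP _ (by omega)

/-- Passing from level `n - 1` to level `n` adds exactly one exponent, `leadExp n`. All
triangularity arguments rest on this. -/
theorem mem_LPlus_pred {n : ℕ} {P : ℂ[T;T⁻¹]} (hP : P ∈ LPlus n) (h0 : P.coeff (leadExp n) = 0) :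
    P ∈ LPlus ((n : ℤ) - 1) := by
  rw [mem_LPlus_iff] at *
  intro j hj
  by_cases hl : j = leadExp n
  · rwa [hl]
  · refine hP j ?_
    rw [leadExp] at hl
    split_ifs at hl with he
    · obtain ⟨m, rfl⟩ := he; push_cast at *; omega
    · obtain ⟨m, rfl⟩ := Nat.not_even_iff_odd.1 he; push_cast at *; omega

theorem coeff_leadExp_of_mem {n : ℕ} {P : ℂ[T;T⁻¹]} (hP : P ∈ LPlus ((n : ℤ) - 1)) :
    P.coeff (leadExp n) = 0 := by
  refine mem_LPlus_iff.1 hP _ ?_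
  rw [leadExp]
  split_ifs with he
  · obtain ⟨m, rfl⟩ := he; push_cast; omega
  · obtain ⟨m, rfl⟩ := Nat.not_even_iff_odd.1 he; push_cast; omega

/-! ### Determinant formulas -/

/-- The coefficients of `p_n^{(1)}`. -/
def p1Coeff (μ : Moments) (n : ℕ) (i : Fin (n + 1)) : ℂ :=
  (toeplitzDet μ n)⁻¹ * ((-1) ^ ((i : ℕ) + n) *
    (Matrix.of fun a b : Fin n => μ (((i.succAbove a : ℕ) : ℤ) - ((b : ℕ) : ℤ))).det)

/-- Laplace expansion along the last column, the only one containing powers of `z`. -/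
theorem p1_eq_sum (μ : Moments) (n : ℕ) : p1 μ n = ∑ i, p1Coeff μ n i • z (i : ℕ) := by
  rw [p1, Matrix.det_succ_column _ (Fin.last n), Finset.smul_sum]
  refine Finset.sum_congr rfl fun i _ => ?_
  rw [p1Coeff, mul_smul]
  congr 1
  have : (Matrix.of fun k l : Fin (n + 1) => if (l : ℕ) < n then
      LaurentPolynomial.C (μ (((k : ℕ) : ℤ) - ((l : ℕ) : ℤ))) else z (k : ℕ)).submatrix
        i.succAbove (Fin.last n).succAbove = LaurentPolynomial.C.mapMatrix
      (Matrix.of fun a b : Fin n => μ (((i.succAbove a : ℕ) : ℤ) - ((b : ℕ) : ℤ))) := by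
    ext1 a b
    simp
  rw [this, ← RingHom.map_det, LaurentPolynomial.smul_eq_C_mul]
  simp
  ring

theorem p1Coeff_last {μ : Moments} {n : ℕ} (hn : toeplitzDet μ n ≠ 0) :
    p1Coeff μ n (Fin.last n) = 1 := by
  rw [p1Coeff, Fin.val_last, ← two_mul, pow_mul]
  simp only [Fin.succAbove_last, Fin.val_castSucc]
  rw [neg_one_sq, one_pow, one_mul]
  exact inv_mul_cancel₀ hn

/-- Pairing with `z^l` replaces the column of monomials by a column of moments. Orthogonality then
becomes a repeated column. -/
theorem toeplitz_p1_z (μ : Moments) (n : ℕ) (l : ℤ) : toeplitz μ (p1 μ n) (z l) =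
    (toeplitzDet μ n)⁻¹ * (Matrix.of fun k c : Fin (n + 1) =>
      if (c : ℕ) < n then μ (((k : ℕ) : ℤ) - ((c : ℕ) : ℤ)) else μ (((k : ℕ) : ℤ) - l)).det := by
  rw [p1_eq_sum, map_sum, LinearMap.sum_apply, Matrix.det_succ_column _ (Fin.last n),
    Finset.mul_sum]
  refine Finset.sum_congr rfl fun i _ => ?_
  rw [map_smul, LinearMap.smul_apply, toeplitz_z, p1Coeff, smul_eq_mul, mul_assoc]
  congr 1
  have : (Matrix.of fun k c : Fin (n + 1) =>
      if (c : ℕ) < n then μ (((k : ℕ) : ℤ) - ((c : ℕ) : ℤ)) else μ (((k : ℕ) : ℤ) - l)).submatrix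
        i.succAbove (Fin.last n).succAbove =
      (Matrix.of fun a b : Fin n => μ (((i.succAbove a : ℕ) : ℤ) - ((b : ℕ) : ℤ))) := by
    ext1 a b
    simp
  rw [this]
  simp
  ring

theorem toeplitz_p1_z_of_lt (μ : Moments) {n : ℕ} {l : ℤ} (h0 : 0 ≤ l) (hl : l < n) :
    toeplitz μ (p1 μ n) (z l) = 0 := by
  rw [toeplitz_p1_z]
  lift l to ℕ using h0
  have hl' : l < n := by exact_mod_cast hl
  rw [Matrix.det_zero_of_column_eq (i := Fin.last n) (j := Fin.castSucc ⟨l, hl'⟩), mul_zero]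
  · exact (Fin.castSucc_lt_last _).ne'
  · intro k
    simp [hl']

theorem toeplitz_p1_z_self (μ : Moments) (n : ℕ) :
    toeplitz μ (p1 μ n) (z n) = (toeplitzDet μ n)⁻¹ * toeplitzDet μ (n + 1) := by
  rw [toeplitz_p1_z, toeplitzDet, toeplitzDet]
  congr 3
  ext k c
  split_ifs with hc
  · rfl
  · have : (c : ℕ) = n := by omega
    rw [this]

theorem p1_mem (μ : Moments) (n : ℕ) : p1 μ n ∈ span 0 n := by
  rw [p1_eq_sum]
  refine Submodule.sum_mem _ fun i _ => Submodule.smul_mem _ _ (Submodule.subset_span ⟨i, ?_, rfl⟩)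
  constructor <;> simp
  omega

theorem p1_coeff_self {μ : Moments} {n : ℕ} (hn : toeplitzDet μ n ≠ 0) : (p1 μ n).coeff n = 1 := by
  rw [p1_eq_sum, Fin.sum_univ_castSucc, p1Coeff_last hn, AddMonoidAlgebra.coeff_add,
    Finsupp.add_apply]
  have : ((∑ i : Fin n, p1Coeff μ n i.castSucc • z ((i.castSucc : Fin (n + 1)) : ℕ)) :
      ℂ[T;T⁻¹]) ∈ span 0 ((n : ℤ) - 1) := by
    refine Submodule.sum_mem _ fun i _ => Submodule.smul_mem _ _ (Submodule.subset_span ⟨_, ?_, rfl⟩)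
    constructor <;> simp
  rw [mem_span_iff.1 this n (by omega)]
  simp

/-- Writing `p2` as `p1` of the reflected moments leaves only `p1` to be studied. -/
theorem f_of_even (μ : Moments) (m : ℕ) : f μ (2 * m) = z m * star (p1 (reflect μ) (2 * m)) := by
  rw [f, if_pos (even_two_mul m), p1_reflect]
  simp

theorem f_of_odd (μ : Moments) (m : ℕ) : f μ (2 * m + 1) = z (-m) * p1 μ (2 * m + 1) := by
  rw [f, if_neg (by simp)]
  congr 3
  omega

theorem leadExp_even (m : ℕ) : leadExp (2 * m) = -m := by
  rw [leadExp, if_pos (even_two_mul m)]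
  congr 2
  omega

theorem leadExp_odd (m : ℕ) : leadExp (2 * m + 1) = m + 1 := by
  rw [leadExp, if_neg (by simp)]
  congr 2
  omega

theorem f_mem (μ : Moments) (n : ℕ) : f μ n ∈ LPlus n := by
  rw [mem_LPlus_iff]
  intro j hj
  obtain ⟨m, rfl | rfl⟩ := n.even_or_odd'
  · rw [f_of_even, coeff_z_mul, coeff_star]
    exact mem_span_iff.1 (p1_mem _ _) _ (by push_cast at *; omega)
  · rw [f_of_odd, coeff_z_mul]
    exact mem_span_iff.1 (p1_mem _ _) _ (by push_cast at *; omega)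

theorem f_coeff_leadExp {μ : Moments} {n : ℕ} (hn : toeplitzDet μ n ≠ 0) :
    (f μ n).coeff (leadExp n) = 1 := by
  obtain ⟨m, rfl | rfl⟩ := n.even_or_odd'
  · rw [f_of_even, coeff_z_mul, coeff_star, leadExp_even,
      show -(-(m : ℤ) - m) = ((2 * m : ℕ) : ℤ) by push_cast; ring]
    exact p1_coeff_self (by rwa [toeplitzDet_reflect])
  · rw [f_of_odd, coeff_z_mul, leadExp_odd,
      show (m : ℤ) + 1 - -m = ((2 * m + 1 : ℕ) : ℤ) by push_cast; ring]
    exact p1_coeff_self hn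

theorem toeplitz_f_z_even (μ : Moments) (m : ℕ) (j : ℤ) : toeplitz μ (f μ (2 * m)) (z j) =
    toeplitz (reflect μ) (p1 (reflect μ) (2 * m)) (z (m - j)) := by
  rw [f_of_even, toeplitz_reflect, toeplitz_eq, toeplitz_eq, star_z, mul_right_comm, z_mul_z,
    sub_eq_add_neg]

theorem toeplitz_f_z_odd (μ : Moments) (m : ℕ) (j : ℤ) : toeplitz μ (f μ (2 * m + 1)) (z j) =
    toeplitz μ (p1 μ (2 * m + 1)) (z (m + j)) := by
  rw [f_of_odd, toeplitz_z_mul_left, neg_neg, z_mul_z]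

/-- The shift by a power of `z`, with a reflection when `n` is even, carries the exponents of `LPlus
(n - 1)` into `0, …, n - 1`, where `p1` is orthogonal. -/
theorem toeplitz_f_of_mem (μ : Moments) {n : ℕ} {P : ℂ[T;T⁻¹]} (hP : P ∈ LPlus ((n : ℤ) - 1)) :
    toeplitz μ (f μ n) P = 0 := by
  rw [LPlus, span] at hP
  induction hP using Submodule.span_induction with
  | mem x hx =>
    obtain ⟨j, ⟨hj1, hj2⟩, rfl⟩ := hx
    obtain ⟨m, rfl | rfl⟩ := n.even_or_odd'
    · rw [toeplitz_f_z_even]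
      exact toeplitz_p1_z_of_lt _ (by push_cast at *; omega) (by push_cast at *; omega)
    · rw [toeplitz_f_z_odd]
      exact toeplitz_p1_z_of_lt _ (by push_cast at *; omega) (by push_cast at *; omega)
  | zero => simp
  | add x y _ _ hx hy => rw [map_add, hx, hy, add_zero]
  | smul c x _ hx => rw [map_smul, hx, smul_zero]

theorem toeplitz_f_leadExp (μ : Moments) (n : ℕ) : toeplitz μ (f μ n) (z (leadExp n)) =
    (toeplitzDet μ n)⁻¹ * toeplitzDet μ (n + 1) := by
  obtain ⟨m, rfl | rfl⟩ := n.even_or_odd'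
  · rw [toeplitz_f_z_even, leadExp_even,
      show (m : ℤ) - -m = ((2 * m : ℕ) : ℤ) by push_cast; ring, toeplitz_p1_z_self,
      toeplitzDet_reflect, toeplitzDet_reflect]
  · rw [toeplitz_f_z_odd, leadExp_odd,
      show (m : ℤ) + (m + 1) = ((2 * m + 1 : ℕ) : ℤ) by push_cast; ring, toeplitz_p1_z_self]

theorem g_mem (μ : Moments) (n : ℕ) : g μ n ∈ LPlus n := f_reflect μ ▸ f_mem (reflect μ) n

theorem g_coeff_leadExp {μ : Moments} {n : ℕ} (hn : toeplitzDet μ n ≠ 0) :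
    (g μ n).coeff (leadExp n) = 1 := by
  rw [← f_reflect]
  exact f_coeff_leadExp (by rwa [toeplitzDet_reflect])

theorem toeplitz_g_of_mem (μ : Moments) {n : ℕ} {P : ℂ[T;T⁻¹]} (hP : P ∈ LPlus ((n : ℤ) - 1)) :
    toeplitz μ P (g μ n) = 0 := by
  rw [← toeplitz_reflect, ← f_reflect]
  exact toeplitz_f_of_mem _ hP

theorem toeplitz_f_g_of_ne (μ : Moments) {i j : ℕ} (hij : i ≠ j) :
    toeplitz μ (f μ i) (g μ j) = 0 := by
  rcases lt_or_gt_of_ne hij with hlt | hlt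
  · exact toeplitz_g_of_mem _ (LPlus_mono (by omega) (f_mem μ i))
  · exact toeplitz_f_of_mem _ (LPlus_mono (by omega) (g_mem μ j))

/-- All the leading Toeplitz determinants are nonzero. -/
def Regular (μ : Moments) : Prop := ∀ n, toeplitzDet μ n ≠ 0

theorem Regular.reflect {μ : Moments} (hμ : Regular μ) : Regular (reflect μ) := fun n => by
  rw [toeplitzDet_reflect]
  exact hμ n

theorem z_leadExp_mem (n : ℕ) : z (leadExp n) ∈ LPlus n := by
  refine Submodule.subset_span ⟨_, ?_, rfl⟩
  obtain ⟨m, rfl | rfl⟩ := n.even_or_odd'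
  · rw [leadExp_even]
    constructor <;> push_cast <;> omega
  · rw [leadExp_odd]
    constructor <;> push_cast <;> omega

/-- `g_n` and its leading monomial differ by an element of the previous level, which `f_n`
annihilates. -/
theorem h_eq {μ : Moments} (n : ℕ) (hn : toeplitzDet μ n ≠ 0) :
    h μ n = (toeplitzDet μ n)⁻¹ * toeplitzDet μ (n + 1) := by
  rw [h, ← toeplitz_f_leadExp, ← sub_eq_zero, ← map_sub]
  refine toeplitz_f_of_mem _ (mem_LPlus_pred (Submodule.sub_mem _ (g_mem μ n) (z_leadExp_mem n)) ?_)
  simp [g_coeff_leadExp hn]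

theorem Regular.h_ne_zero {μ : Moments} (hμ : Regular μ) (n : ℕ) : h μ n ≠ 0 := by
  rw [h_eq n (hμ n)]
  exact mul_ne_zero (inv_ne_zero (hμ n)) (hμ _)

/-! ### Dual pairs of families and matrices of operators -/

/-- The functionals `c_j` are dual to the spanning family `b`. -/
structure DualPair (b : ℕ → ℂ[T;T⁻¹]) (c : ℕ → ℂ[T;T⁻¹] →ₗ[ℂ] ℂ) : Prop where
  dual : ∀ i j, c j (b i) = if i = j then 1 else 0
  span : Submodule.span ℂ (Set.range b) = ⊤

namespace DualPair

variable {b : ℕ → ℂ[T;T⁻¹]} {c : ℕ → ℂ[T;T⁻¹] →ₗ[ℂ] ℂ}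

theorem apply_sum (hb : DualPair b c) (s : Finset ℕ) (a : ℕ → ℂ) (j : ℕ) :
    c j (∑ i ∈ s, a i • b i) = if j ∈ s then a j else 0 := by
  simp [map_sum, hb.dual]

theorem isBasis (hb : DualPair b c) : IsBasis b := by
  refine ⟨linearIndependent_iff'.2 fun s a hs i hi => ?_, hb.span⟩
  simpa [hs, hi] using (hb.apply_sum s a i).symm

theorem exists_sum (hb : DualPair b c) (P : ℂ[T;T⁻¹]) : ∃ s : Finset ℕ,
    (Function.support fun j => c j P) ⊆ s ∧ P = ∑ j ∈ s, c j P • b j := by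
  have hP : P ∈ Submodule.span ℂ (Set.range b) := hb.span ▸ Submodule.mem_top
  obtain ⟨a, rfl⟩ := (Finsupp.mem_span_range_iff_exists_finsupp).1 hP
  refine ⟨a.support, fun j hj => ?_, ?_⟩
  · by_contra hc
    refine hj ?_
    dsimp only
    rw [Finsupp.sum, hb.apply_sum]
    exact if_neg fun h => hc (Finset.mem_coe.2 h)
  · rw [Finsupp.sum]
    refine Finset.sum_congr rfl fun j hj => ?_
    rw [hb.apply_sum, if_pos hj]

theorem finite_support (hb : DualPair b c) (P : ℂ[T;T⁻¹]) :
    (Function.support fun j => c j P).Finite :=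
  let ⟨s, hs, _⟩ := hb.exists_sum P
  s.finite_toSet.subset hs

theorem finsum_apply (hb : DualPair b c) {M : Type*} [AddCommGroup M] [Module ℂ M]
    (φ : ℂ[T;T⁻¹] →ₗ[ℂ] M) (P : ℂ[T;T⁻¹]) : ∑ᶠ j, c j P • φ (b j) = φ P := by
  obtain ⟨s, hs, hP⟩ := hb.exists_sum P
  rw [finsum_eq_sum_of_support_subset (s := s)]
  · conv_rhs => rw [hP, map_sum]
    simp
  · exact fun j hj => hs fun h0 => hj (by dsimp only at *; rw [h0, zero_smul])

theorem represents (hb : DualPair b c) (Φ : ℂ[T;T⁻¹] → ℂ[T;T⁻¹]) :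
    Represents (Matrix.of fun i j => c j (Φ (b i))) Φ b := fun _ =>
  ⟨hb.finite_support _, (hb.finsum_apply LinearMap.id _).symm⟩

theorem eq_of_represents (hb : DualPair b c) {M : SMatrix} {Φ : ℂ[T;T⁻¹] → ℂ[T;T⁻¹]}
    (hM : Represents M Φ b) (i j : ℕ) : M i j = c j (Φ (b i)) := by
  obtain ⟨hfin, hΦ⟩ := hM i
  rw [hΦ, finsum_eq_sum_of_support_subset (s := hfin.toFinset), hb.apply_sum]
  · split_ifs with hj
    · rfl
    · simpa using hj
  · intro l hl
    rw [Set.Finite.coe_toFinset]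
    exact fun h0 => hl (by dsimp only at *; rw [h0, zero_smul])

/-- If a row of `M` lists the coordinates of `P` and a column of `N` lists the values of `φ` on the
basis, their product is `φ P`. Every semi-infinite product below is evaluated in this way, without
handling infinite sums. -/
theorem mul_apply (hb : DualPair b c) {M N : SMatrix} {P : ℂ[T;T⁻¹]} {φ : ℂ[T;T⁻¹] →ₗ[ℂ] ℂ}
    {i j : ℕ} (hM : ∀ l, M i l = c l P) (hN : ∀ l, N l j = φ (b l)) : mul M N i j = φ P := by
  rw [mul, Matrix.of_apply, ← hb.finsum_apply φ P]
  exact finsum_congr fun l => by rw [hM, hN, smul_eq_mul]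

theorem npow_apply (hb : DualPair b c) {M : SMatrix} {k : ℤ}
    (hM : ∀ i j, M i j = c j (z k * b i)) (n : ℕ) (i j : ℕ) :
    npow M n i j = c j (z (n * k) * b i) := by
  induction n generalizing i j with
  | zero => simp [npow, Matrix.one_apply, hb.dual]
  | succ n ih =>
    rw [npow, hb.mul_apply (P := z (n * k) * b i) (φ := c j ∘ₗ mulZ k) (ih i) (fun l => hM l j),
      LinearMap.comp_apply, mulZ_apply, z_mul_z_mul]
    congr 3
    push_cast
    ring

theorem zpow_apply (hb : DualPair b c) {M M' : SMatrix} (hM : ∀ i j, M i j = c j (z 1 * b i))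
    (hM' : ∀ i j, M' i j = c j (z (-1) * b i)) (n : ℤ) (i j : ℕ) :
    zpow M M' n i j = c j (z n * b i) := by
  rcases n with n | n
  · rw [zpow, hb.npow_apply hM, mul_one]
    rfl
  · rw [zpow, hb.npow_apply hM']
    congr 3
    rw [Int.negSucc_eq]
    push_cast
    ring

end DualPair

/-- The coefficients in the basis `f`. -/
def fCoeff (μ : Moments) (j : ℕ) : ℂ[T;T⁻¹] →ₗ[ℂ] ℂ := (h μ j)⁻¹ • (toeplitz μ).flip (g μ j)

theorem fCoeff_apply (μ : Moments) (j : ℕ) (P : ℂ[T;T⁻¹]) :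
    fCoeff μ j P = toeplitz μ P (g μ j) / h μ j := by
  rw [fCoeff, LinearMap.smul_apply, LinearMap.flip_apply, smul_eq_mul, div_eq_inv_mul]

/-- Induction on the level: subtracting a multiple of the monic `f_n` removes the leading
coefficient. -/
theorem span_f {μ : Moments} (hμ : Regular μ) : Submodule.span ℂ (Set.range (f μ)) = ⊤ := by
  rw [eq_top_iff]
  suffices H : ∀ n : ℕ, LPlus ((n : ℤ) - 1) ≤ Submodule.span ℂ (Set.range (f μ)) by
    intro P _
    obtain ⟨n, hn⟩ := exists_mem_LPlus P
    exact H (n + 1) (by simpa using hn)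
  intro n
  induction n with
  | zero => simp [LPlus_neg_one]
  | succ n ih =>
    intro P hP
    have hP' : P ∈ LPlus n := by simpa using hP
    rw [← sub_add_cancel P (P.coeff (leadExp n) • f μ n)]
    refine Submodule.add_mem _ (ih (mem_LPlus_pred (Submodule.sub_mem _ hP'
      (Submodule.smul_mem _ _ (f_mem μ n))) ?_))
      (Submodule.smul_mem _ _ (Submodule.subset_span ⟨n, rfl⟩))
    simp [f_coeff_leadExp (hμ n)]

theorem dualPair_f {μ : Moments} (hμ : Regular μ) : DualPair (f μ) (fCoeff μ) where
  dual i j := by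
    rw [fCoeff_apply]
    split_ifs with hij
    · subst hij
      exact div_self (hμ.h_ne_zero i)
    · rw [toeplitz_f_g_of_ne μ hij, zero_div]
  span := span_f hμ

/-- The coefficients in the basis `gDual`. -/
def gDualCoeff (μ : Moments) (j : ℕ) : ℂ[T;T⁻¹] →ₗ[ℂ] ℂ := toeplitz μ (f μ j) ∘ₗ starₗ

theorem gDualCoeff_apply (μ : Moments) (j : ℕ) (P : ℂ[T;T⁻¹]) :
    gDualCoeff μ j P = momentFunctional μ (f μ j * P) := by
  rw [gDualCoeff, LinearMap.comp_apply, starₗ_apply, toeplitz_eq, star_star]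

theorem dualPair_gDual {μ : Moments} (hμ : Regular μ) : DualPair (gDual μ) (gDualCoeff μ) where
  dual i j := by
    rw [gDualCoeff, LinearMap.comp_apply, starₗ_apply, gDual, star_smul, star_star, map_smul,
      smul_eq_mul]
    split_ifs with hij
    · subst hij
      exact inv_mul_cancel₀ (hμ.h_ne_zero i)
    · rw [toeplitz_f_g_of_ne μ (Ne.symm hij), mul_zero]
  span := by
    rw [eq_top_iff]
    intro P _
    have hP : star P ∈ Submodule.span ℂ (Set.range (g μ)) := by
      rw [← f_reflect, span_f hμ.reflect]
      trivial
    have hP' := Submodule.mem_map_of_mem (f := starₗ) hP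
    rw [starₗ_apply, star_star, Submodule.map_span] at hP'
    refine Submodule.span_le.2 ?_ hP'
    rintro _ ⟨_, ⟨n, rfl⟩, rfl⟩
    have : starₗ (g μ n) = h μ n • gDual μ n := by
      rw [gDual, smul_smul, mul_inv_cancel₀ (hμ.h_ne_zero n), one_smul, starₗ_apply]
    rw [SetLike.mem_coe, this]
    exact Submodule.smul_mem _ _ (Submodule.subset_span ⟨n, rfl⟩)

/-! ### The CMV matrix `A₁` as multiplication by `z` -/

theorem A1_apply (μ : Moments) (i j : ℕ) : A1 μ i j = fCoeff μ j (z 1 * f μ i) := by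
  rw [fCoeff_apply]; rfl

/-- Multiplication by `z` in the second argument of the form is multiplication by `z⁻¹` in the
first. -/
theorem A1star_apply {μ : Moments} (hμ : Regular μ) (i j : ℕ) :
    A1star μ i j = fCoeff μ j (z (-1) * f μ i) := by
  rw [fCoeff_apply, toeplitz_z_mul_left, neg_neg, A1star, A2, Matrix.of_apply, Matrix.of_apply,
    mul_div_cancel₀ _ (hμ.h_ne_zero i), div_eq_mul_inv]

theorem A1pow_apply {μ : Moments} (hμ : Regular μ) (k : ℤ) (i j : ℕ) :
    A1pow μ k i j = fCoeff μ j (z k * f μ i) :=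
  (dualPair_f hμ).zpow_apply (A1_apply μ) (A1star_apply hμ) k i j

theorem represents_A1 {μ : Moments} (hμ : Regular μ) :
    Represents (A1 μ) (fun P => z 1 * P) (f μ) := by
  have : A1 μ = Matrix.of fun i j => fCoeff μ j (z 1 * f μ i) := by
    ext i j
    exact A1_apply μ i j
  rw [this]
  exact (dualPair_f hμ).represents fun P => z 1 * P

theorem represents_A1star {μ : Moments} (hμ : Regular μ) :
    Represents (A1star μ) (fun P => z (-1) * P) (f μ) := by
  have : A1star μ = Matrix.of fun i j => fCoeff μ j (z (-1) * f μ i) := by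
    ext i j
    exact A1star_apply hμ i j
  rw [this]
  exact (dualPair_f hμ).represents fun P => z (-1) * P

/-- Multiplication by `z` or `z⁻¹` raises the level by at most two. It is applied to `f_i` above the
band and moved onto `g_j` below it. -/
theorem A1_eq_zero (μ : Moments) {i j : ℕ} (hij : i + 2 < j ∨ j + 2 < i) : A1 μ i j = 0 := by
  rw [A1_apply, fCoeff_apply]
  rcases hij with hij | hij
  · rw [toeplitz_g_of_mem, zero_div]
    exact LPlus_mono (by omega) (z_mul_mem_LPlus (Or.inl rfl) (f_mem μ i))
  · rw [toeplitz_z_mul_left, toeplitz_f_of_mem, zero_div]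
    exact LPlus_mono (by omega) (z_mul_mem_LPlus (Or.inr rfl) (g_mem μ j))

theorem mul_A1_A1star {μ : Moments} (hμ : Regular μ) : mul (A1 μ) (A1star μ) = 1 := by
  ext i j
  rw [(dualPair_f hμ).mul_apply (M := A1 μ) (N := A1star μ) (P := z 1 * f μ i)
    (φ := fCoeff μ j ∘ₗ mulZ (-1)) (A1_apply μ i)
    (fun l => by rw [A1star_apply hμ l j, LinearMap.comp_apply, mulZ_apply]), LinearMap.comp_apply, mulZ_apply, z_mul_z_mul,
    neg_add_cancel, z_zero, one_mul, (dualPair_f hμ).dual, Matrix.one_apply]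

theorem mul_A1star_A1 {μ : Moments} (hμ : Regular μ) : mul (A1star μ) (A1 μ) = 1 := by
  ext i j
  rw [(dualPair_f hμ).mul_apply (M := A1star μ) (N := A1 μ) (P := z (-1) * f μ i)
    (φ := fCoeff μ j ∘ₗ mulZ 1) (A1star_apply hμ i)
    (fun l => by rw [A1_apply μ l j, LinearMap.comp_apply, mulZ_apply]), LinearMap.comp_apply, mulZ_apply, z_mul_z_mul,
    add_neg_cancel, z_zero, one_mul, (dualPair_f hμ).dual, Matrix.one_apply]

/-- The matrix `D_1 A_1^{k+1} + A_1^{k+1} D_1^* + k A_1^k` computes the derivative along `V_k` of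
the pairing of `f` and `g`. -/
theorem masterField_pairing {μ : Moments} (hμ : Regular μ) {D Ds : SMatrix}
    (hD : Represents D ddz (f μ)) (hDs : Represents Ds.transpose ddz (gDual μ)) (k : ℤ) (i j : ℕ) :
    mul D (A1pow μ (k + 1)) i j + mul (A1pow μ (k + 1)) Ds i j + (k : ℂ) * A1pow μ k i j =
      toeplitz (masterField k μ) (f μ i) (g μ j) / h μ j := by
  have h1 : mul D (A1pow μ (k + 1)) i j = fCoeff μ j (z (k + 1) * ddzₗ (f μ i)) := by
    rw [(dualPair_f hμ).mul_apply (M := D) (N := A1pow μ (k + 1)) (P := ddzₗ (f μ i))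
      (φ := fCoeff μ j ∘ₗ mulZ (k + 1)), LinearMap.comp_apply, mulZ_apply]
    · intro l
      rw [(dualPair_f hμ).eq_of_represents hD, ddz_eq]
    · intro l
      rw [A1pow_apply hμ, LinearMap.comp_apply, mulZ_apply]
  have h2 : mul (A1pow μ (k + 1)) Ds i j =
      momentFunctional μ (ddzₗ (gDual μ j) * (z (k + 1) * f μ i)) := by
    rw [(dualPair_f hμ).mul_apply (M := A1pow μ (k + 1)) (N := Ds) (P := z (k + 1) * f μ i)
      (φ := momentFunctional μ ∘ₗ LinearMap.mulLeft ℂ (ddzₗ (gDual μ j))),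
      LinearMap.comp_apply, LinearMap.mulLeft_apply]
    · exact A1pow_apply hμ _ i
    · intro l
      have := (dualPair_gDual hμ).eq_of_represents hDs j l
      rw [Matrix.transpose_apply, gDualCoeff_apply, ddz_eq, mul_comm] at this
      rw [this, LinearMap.comp_apply, LinearMap.mulLeft_apply]
  have hc : ∀ P, fCoeff μ j P = momentFunctional μ (P * gDual μ j) := fun P => by
    rw [fCoeff_apply, toeplitz_eq, gDual, mul_smul_comm, map_smul, smul_eq_mul, div_eq_inv_mul]
  have h3 : toeplitz (masterField k μ) (f μ i) (g μ j) / h μ j =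
      momentFunctional (masterField k μ) (f μ i * gDual μ j) := by
    rw [toeplitz_eq, gDual, mul_smul_comm, map_smul, smul_eq_mul, div_eq_inv_mul]
  -- The product rule for `z (d/dz)(z^k · f_i · gDual_j)` yields three terms, one for each matrix on
  -- the left.
  rw [h1, h2, h3, A1pow_apply hμ, hc, hc, momentFunctional_masterField, ddzₗ_z_mul, ddzₗ_mul,
    map_add, map_smul, smul_eq_mul, mul_add, map_add]
  rw [show ddzₗ (gDual μ j) * (z (k + 1) * f μ i) = z (k + 1) * (f μ i * ddzₗ (gDual μ j)) by ring,
    mul_assoc (z (k + 1)) _ (gDual μ j), mul_assoc (z k)]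
  ring

/-! ### Uniqueness of the monic bi-orthogonal sequences -/

theorem isRightBiorthogonal_f_g {μ : Moments} (hμ : Regular μ) :
    IsRightBiorthogonal (toeplitz μ) (f μ) (g μ) := by
  refine ⟨fun n => ⟨f_mem μ n, fun hc => ?_, g_mem μ n, fun hc => ?_⟩,
    fun n m => toeplitz_f_g_of_ne μ, hμ.h_ne_zero⟩
  · simpa [f_coeff_leadExp (hμ n)] using coeff_leadExp_of_mem hc
  · simpa [g_coeff_leadExp (hμ n)] using coeff_leadExp_of_mem hc

theorem LPlus_le_span {g' : ℕ → ℂ[T;T⁻¹]} (hg : ∀ n : ℕ, g' n ∈ LPlus n) (hm : IsMonic g') (n : ℕ) :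
    LPlus ((n : ℤ) - 1) ≤ Submodule.span ℂ (g' '' {i | i < n}) := by
  induction n with
  | zero => simp [LPlus_neg_one]
  | succ n ih =>
    intro P hP
    have hP' : P ∈ LPlus n := by simpa using hP
    rw [← sub_add_cancel P (P.coeff (leadExp n) • g' n)]
    refine Submodule.add_mem _ (Submodule.span_mono (Set.image_mono fun _ hi => Nat.lt_succ_of_lt hi)
      (ih (mem_LPlus_pred (Submodule.sub_mem _ hP' (Submodule.smul_mem _ _ (hg n))) ?_)))
      (Submodule.smul_mem _ _ (Submodule.subset_span ⟨n, Nat.lt_succ_self n, rfl⟩))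
    simp [hm n]

/-- Nondegeneracy on each level: the low coefficients in the basis `f` vanish by hypothesis, the
high ones by orthogonality of `g`. -/
theorem eq_zero_of_mem_LPlus {μ : Moments} (hμ : Regular μ) {n : ℕ} {P : ℂ[T;T⁻¹]}
    (hP : P ∈ LPlus ((n : ℤ) - 1)) (h0 : ∀ Q ∈ LPlus ((n : ℤ) - 1), toeplitz μ P Q = 0) : P = 0 := by
  rw [← LinearMap.id_apply (R := ℂ) P, ← (dualPair_f hμ).finsum_apply LinearMap.id P]
  refine finsum_eq_zero_of_forall_eq_zero fun j => ?_
  rw [fCoeff_apply]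
  rcases lt_or_ge j n with hj | hj
  · rw [h0 _ (LPlus_mono (by omega) (g_mem μ j)), zero_div, zero_smul]
  · rw [toeplitz_g_of_mem μ (LPlus_mono (by omega) hP), zero_div, zero_smul]

/-- The difference of two monic candidates lies one level lower and is orthogonal to that whole
level. -/
theorem eq_f_of_biorthogonal {μ : Moments} (hμ : Regular μ) {f' g' : ℕ → ℂ[T;T⁻¹]}
    (hfg : IsRightBiorthogonal (toeplitz μ) f' g') (hf : IsMonic f') (hg : IsMonic g') :
    f' = f μ := by
  ext1 n
  rw [← sub_eq_zero]
  refine eq_zero_of_mem_LPlus hμ (n := n) (mem_LPlus_pred (Submodule.sub_mem _ (hfg.1 n).1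
    (f_mem μ n)) (by simp [hf n, f_coeff_leadExp (hμ n)])) fun Q hQ => ?_
  rw [map_sub, LinearMap.sub_apply, toeplitz_f_of_mem μ hQ, sub_zero]
  have hle : Submodule.span ℂ (g' '' {i | i < n}) ≤ LinearMap.ker (toeplitz μ (f' n)) := by
    rw [Submodule.span_le]
    rintro _ ⟨i, hi, rfl⟩
    exact hfg.2.1 n i (ne_of_gt hi)
  exact hle (LPlus_le_span (fun n => (hfg.1 n).2.2.1) hg n hQ)


/-! ### Derivatives along curves of bi-moments -/

/-- `P` is a curve in a finite dimensional space of Laurent polynomials, with derivative `P'`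
at `0`. -/
def HasLaurentDeriv (P : ℝ → ℂ[T;T⁻¹]) (P' : ℂ[T;T⁻¹]) : Prop :=
  ∃ (n : ℕ) (a : Fin n → ℝ → ℂ) (a' : Fin n → ℂ) (v : Fin n → ℂ[T;T⁻¹]),
    (∀ i, HasDerivAt (a i) (a' i) 0) ∧ (∀ u, P u = ∑ i, a i u • v i) ∧ P' = ∑ i, a' i • v i

theorem HasLaurentDeriv.map {P : ℝ → ℂ[T;T⁻¹]} {P' : ℂ[T;T⁻¹]} (hP : HasLaurentDeriv P P')
    (φ : ℂ[T;T⁻¹] →ₗ[ℂ] ℂ[T;T⁻¹]) : HasLaurentDeriv (fun u => φ (P u)) (φ P') := by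
  obtain ⟨n, a, a', v, ha, hPu, hP'⟩ := hP
  exact ⟨n, a, a', fun i => φ (v i), ha, fun u => by simp [hPu], by simp [hP']⟩

theorem HasLaurentDeriv.hasDerivAt {P : ℝ → ℂ[T;T⁻¹]} {P' : ℂ[T;T⁻¹]} (hP : HasLaurentDeriv P P')
    (φ : ℂ[T;T⁻¹] →ₗ[ℂ] ℂ) : HasDerivAt (fun u => φ (P u)) (φ P') 0 := by
  obtain ⟨n, a, a', v, ha, hPu, hP'⟩ := hP
  simp only [hPu, hP', map_sum, map_smul, smul_eq_mul]
  exact HasDerivAt.fun_sum fun i _ => (ha i).mul_const _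

theorem hasDerivAt_toeplitz_const {γ : ℝ → Moments} {ν : Moments}
    (hγ : ∀ j, HasDerivAt (fun u => γ u j) (ν j) 0) (P Q : ℂ[T;T⁻¹]) :
    HasDerivAt (fun u => toeplitz (γ u) P Q) (toeplitz ν P Q) 0 := by
  simp only [toeplitz_eq]
  generalize P * star Q = R
  induction R using LaurentPolynomial.induction_on' with
  | add P Q hP hQ => simpa only [map_add] using hP.fun_add hQ
  | C_mul_T n a =>
    rw [← LaurentPolynomial.smul_eq_C_mul]
    simpa only [map_smul, momentFunctional_z, smul_eq_mul] using (hγ n).const_mul a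

theorem hasDerivAt_toeplitz {γ : ℝ → Moments} {ν : Moments}
    (hγ : ∀ j, HasDerivAt (fun u => γ u j) (ν j) 0) {P Q : ℝ → ℂ[T;T⁻¹]} {P' Q' : ℂ[T;T⁻¹]}
    (hP : HasLaurentDeriv P P') (hQ : HasLaurentDeriv Q Q') :
    HasDerivAt (fun u => toeplitz (γ u) (P u) (Q u))
      (toeplitz ν (P 0) (Q 0) + toeplitz (γ 0) P' (Q 0) + toeplitz (γ 0) (P 0) Q') 0 := by
  obtain ⟨m, a, a', v, ha, hPu, hP'⟩ := hP
  obtain ⟨n, b, b', w, hb, hQu, hQ'⟩ := hQ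
  simp only [hPu, hQu, hP', hQ', map_sum, map_smul, LinearMap.sum_apply, LinearMap.smul_apply,
    smul_eq_mul, Finset.mul_sum, ← Finset.sum_add_distrib]
  refine HasDerivAt.fun_sum fun j _ => HasDerivAt.fun_sum fun i _ => ?_
  refine ((hb j).fun_mul ((ha i).fun_mul (hasDerivAt_toeplitz_const hγ (v i) (w j)))).congr_deriv ?_
  ring

theorem hasDerivAt_det {R : Type*} [Fintype R] [DecidableEq R] {M : ℝ → Matrix R R ℂ}
    (hM : ∀ i j, DifferentiableAt ℝ (fun u => M u i j) 0) :
    DifferentiableAt ℝ (fun u => (M u).det) 0 := by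
  simp only [Matrix.det_apply]
  refine DifferentiableAt.fun_sum fun σ _ => DifferentiableAt.const_smul ?_ _
  exact DifferentiableAt.fun_finsetProd fun i _ => hM _ _

theorem differentiableAt_toeplitzDet {γ : ℝ → Moments} {ν : Moments}
    (hγ : ∀ j, HasDerivAt (fun u => γ u j) (ν j) 0) (n : ℕ) :
    DifferentiableAt ℝ (fun u => toeplitzDet (γ u) n) 0 :=
  hasDerivAt_det fun _ _ => (hγ _).differentiableAt

/-- The coefficients are quotients of determinants in the moments. Only existence of the derivative
is needed; its value comes later from orthogonality. -/
theorem exists_hasLaurentDeriv_p1 {γ : ℝ → Moments} {ν : Moments}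
    (hγ : ∀ j, HasDerivAt (fun u => γ u j) (ν j) 0) {n : ℕ} (hn : toeplitzDet (γ 0) n ≠ 0) :
    ∃ P', HasLaurentDeriv (fun u => p1 (γ u) n) P' := by
  have ha : ∀ i, DifferentiableAt ℝ (fun u => p1Coeff (γ u) n i) 0 := fun i =>
    ((differentiableAt_toeplitzDet hγ n).fun_inv hn).fun_mul
      ((hasDerivAt_det fun _ _ => (hγ _).differentiableAt).const_mul _)
  exact ⟨_, n + 1, fun i u => p1Coeff (γ u) n i, _, fun i => z (i : ℕ),
    fun i => (ha i).hasDerivAt, fun u => p1_eq_sum _ _, rfl⟩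

theorem hasDerivAt_reflect {γ : ℝ → Moments} {ν : Moments}
    (hγ : ∀ j, HasDerivAt (fun u => γ u j) (ν j) 0) (j : ℤ) :
    HasDerivAt (fun u => reflect (γ u) j) (reflect ν j) 0 := hγ (-j)

theorem exists_hasLaurentDeriv_f {γ : ℝ → Moments} {ν : Moments}
    (hγ : ∀ j, HasDerivAt (fun u => γ u j) (ν j) 0) {n : ℕ} (hn : toeplitzDet (γ 0) n ≠ 0) :
    ∃ P', HasLaurentDeriv (fun u => f (γ u) n) P' := by
  obtain ⟨m, rfl | rfl⟩ := n.even_or_odd'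
  · simp only [f_of_even]
    obtain ⟨P', hP'⟩ := exists_hasLaurentDeriv_p1 (hasDerivAt_reflect hγ) (n := 2 * m)
      (by rwa [toeplitzDet_reflect])
    exact ⟨_, hP'.map (mulZ m ∘ₗ starₗ)⟩
  · simp only [f_of_odd]
    obtain ⟨P', hP'⟩ := exists_hasLaurentDeriv_p1 hγ hn
    exact ⟨_, hP'.map (mulZ (-m))⟩

/-- The coefficient of `z ^ j`, as a linear functional. -/
def coeffₗ (j : ℤ) : ℂ[T;T⁻¹] →ₗ[ℂ] ℂ := (AddMonoidAlgebra.basis ℤ ℂ).coord j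

/-- Coefficients outside level `n` are constantly `0` and the leading one is constantly `1` near the
base point, so the derivative drops one level. -/
theorem exists_hasLaurentDeriv_f_mem {γ : ℝ → Moments} {ν : Moments}
    (hγ : ∀ j, HasDerivAt (fun u => γ u j) (ν j) 0) {n : ℕ} (hn : toeplitzDet (γ 0) n ≠ 0) :
    ∃ P' ∈ LPlus ((n : ℤ) - 1), HasLaurentDeriv (fun u => f (γ u) n) P' := by
  obtain ⟨P', hP'⟩ := exists_hasLaurentDeriv_f hγ hn
  refine ⟨P', mem_LPlus_pred (mem_LPlus_iff.2 fun j hj => ?_) ?_, hP'⟩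
  · refine (hP'.hasDerivAt (coeffₗ j)).unique ((hasDerivAt_const (0 : ℝ) (0 : ℂ)).congr_of_eventuallyEq
      (Filter.Eventually.of_forall fun u => ?_))
    exact mem_LPlus_iff.1 (f_mem (γ u) n) j hj
  · refine (hP'.hasDerivAt (coeffₗ (leadExp n))).unique
      ((hasDerivAt_const (0 : ℝ) (1 : ℂ)).congr_of_eventuallyEq ?_)
    -- The curve is regular only at `0`; continuity keeps the one determinant that matters nonzero
    -- nearby.
    filter_upwards [(differentiableAt_toeplitzDet hγ n).continuousAt.eventually_ne hn] with u hu
    exact f_coeff_leadExp hu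

theorem exists_hasLaurentDeriv_g_mem {γ : ℝ → Moments} {ν : Moments}
    (hγ : ∀ j, HasDerivAt (fun u => γ u j) (ν j) 0) {n : ℕ} (hn : toeplitzDet (γ 0) n ≠ 0) :
    ∃ P' ∈ LPlus ((n : ℤ) - 1), HasLaurentDeriv (fun u => g (γ u) n) P' := by
  obtain ⟨P', hm, hP'⟩ := exists_hasLaurentDeriv_f_mem (hasDerivAt_reflect hγ) (n := n)
    (by rwa [toeplitzDet_reflect])
  exact ⟨P', hm, by simpa only [f_reflect] using hP'⟩

/-- The variation of `A₁` along a curve of bi-moments. -/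
theorem hasDerivAt_A1 {γ : ℝ → Moments} {ν : Moments} (hμ : Regular (γ 0))
    (hγ : ∀ j, HasDerivAt (fun u => γ u j) (ν j) 0) (i j : ℕ) :
    HasDerivAt (fun u => A1 (γ u) i j) (commutator (A1 (γ 0)) (strictLower
      (Matrix.of fun i j => toeplitz ν (f (γ 0) i) (g (γ 0) j) / h (γ 0) j)) i j) 0 := by
  choose F hFm hF using fun n => exists_hasLaurentDeriv_f_mem hγ (hμ n)
  choose G hGm hG using fun n => exists_hasLaurentDeriv_g_mem hγ (hμ n)
  set μ := γ 0 with hμ0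
  have hb := dualPair_f hμ
  -- Differentiated orthogonality. By triangularity at most one of the two terms with `F` and `G`
  -- survives for given `i, j`.
  have hpair : ∀ i j, i ≠ j →
      toeplitz ν (f μ i) (g μ j) + toeplitz μ (F i) (g μ j) + toeplitz μ (f μ i) (G j) = 0 :=
    fun i j hij => (hasDerivAt_toeplitz hγ (hF i) (hG j)).unique
      ((hasDerivAt_const (0 : ℝ) (0 : ℂ)).congr_of_eventuallyEq
        (Filter.Eventually.of_forall fun u => toeplitz_f_g_of_ne _ hij))
  have hFg : ∀ i j, i ≤ j → toeplitz μ (F i) (g μ j) = 0 := fun i j hij =>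
    toeplitz_g_of_mem _ (LPlus_mono (by omega) (hFm i))
  have hfG : ∀ i j, j ≤ i → toeplitz μ (f μ i) (G j) = 0 := fun i j hij =>
    toeplitz_f_of_mem _ (LPlus_mono (by omega) (hGm j))
  set N : SMatrix := Matrix.of fun i j => toeplitz ν (f μ i) (g μ j) / h μ j with hN
  have hhj := hμ.h_ne_zero j
  -- On the diagonal both `F_j` and `G_j` drop out, so `h_j` varies only through the functional.
  have hh : HasDerivAt (fun u => h (γ u) j) (toeplitz ν (f μ j) (g μ j)) 0 := by
    refine (hasDerivAt_toeplitz hγ (hF j) (hG j)).congr_deriv ?_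
    rw [hFg j j le_rfl, hfG j j le_rfl, add_zero, add_zero]
  have hnum := hasDerivAt_toeplitz hγ ((hF i).map (mulZ 1)) (hG j)
  have key := hnum.fun_div hh hhj
  refine key.congr_deriv ?_
  -- Row `i` of `N₋₋` lists the coordinates of `-F_i`: below the diagonal by `hpair`, elsewhere
  -- because both vanish.
  have hlow : mul (strictLower N) (A1 μ) i j = -(toeplitz μ (z 1 * F i) (g μ j) / h μ j) := by
    have := hb.mul_apply (M := strictLower N) (N := A1 μ) (P := -F i) (φ := fCoeff μ j ∘ₗ mulZ 1)
      (i := i) (j := j) (fun l => ?_)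
      (fun l => by rw [A1_apply μ l j, LinearMap.comp_apply, mulZ_apply])
    · rw [this, LinearMap.comp_apply, mulZ_apply, mul_neg, map_neg, fCoeff_apply]
    · rw [map_neg, fCoeff_apply, strictLower, Matrix.of_apply]
      split_ifs with hl
      · have := hpair i l (ne_of_gt hl)
        rw [hfG i l hl.le, add_zero, add_eq_zero_iff_eq_neg] at this
        rw [hN, Matrix.of_apply, this, neg_div]
      · rw [hFg i l (not_lt.1 hl), zero_div, neg_zero]
  -- Column `j` of `N₋₋` lists the values on `f_l` of the derivative of the functional pairing with
  -- `g_j`, divided by `h_j`, minus a multiple of the `j`-th coordinate. This correction cancels the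
  -- diagonal value `l = j` and accounts for the derivative of `1 / h_j`.
  have hup : mul (A1 μ) (strictLower N) i j =
      (toeplitz ν (z 1 * f μ i) (g μ j) + toeplitz μ (z 1 * f μ i) (G j)) / h μ j
        - A1 μ i j * (toeplitz ν (f μ j) (g μ j) / h μ j) := by
    have := hb.mul_apply (M := A1 μ) (N := strictLower N) (P := z 1 * f μ i)
      (φ := (h μ j)⁻¹ • ((toeplitz ν).flip (g μ j) + (toeplitz μ).flip (G j)) -
        (toeplitz ν (f μ j) (g μ j) / h μ j) • fCoeff μ j)
      (i := i) (j := j) (A1_apply μ i) (fun l => ?_)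
    · rw [this, A1_apply]
      simp only [LinearMap.sub_apply, LinearMap.smul_apply, LinearMap.add_apply,
        LinearMap.flip_apply, smul_eq_mul]
      ring
    · simp only [LinearMap.sub_apply, LinearMap.smul_apply, LinearMap.add_apply,
        LinearMap.flip_apply, smul_eq_mul]
      rw [hb.dual, strictLower, Matrix.of_apply]
      rcases lt_trichotomy l j with hl | hl | hl
      · have := hpair l j (ne_of_lt hl)
        rw [hFg l j hl.le, add_zero] at this
        rw [if_neg (by omega), if_neg (by omega), this]
        ring
      · subst hl
        rw [if_neg (by omega), if_pos rfl, hfG l l le_rfl]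
        ring
      · rw [if_pos hl, if_neg (by omega), hfG l j hl.le, hN, Matrix.of_apply]
        ring
  rw [commutator, Matrix.sub_apply, hlow, hup, A1, Matrix.of_apply]
  simp only [mulZ_apply, ← hμ0]
  have : h μ j = toeplitz μ (f μ j) (g μ j) := rfl
  field_simp
  ring

theorem hasLieDerivAt_A1 {μ : Moments} (hμ : Regular μ) {D Ds : SMatrix}
    (hD : Represents D ddz (f μ)) (hDs : Represents Ds.transpose ddz (gDual μ)) (k : ℤ) (i j : ℕ) :
    HasLieDerivAt (masterField k) (fun ν => A1 ν i j) μ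
      (commutator (A1 μ) (strictLower (mul D (A1pow μ (k + 1)))
        + strictLower (mul (A1pow μ (k + 1)) Ds) + (k : ℂ) • strictLower (A1pow μ k)) i j) := by
  rintro γ rfl hγ
  refine (hasDerivAt_A1 hμ hγ i j).congr_deriv ?_
  congr 2
  ext l m
  simp only [Matrix.add_apply, Matrix.smul_apply, strictLower, Matrix.of_apply, smul_eq_mul]
  split_ifs with hl
  · exact (masterField_pairing hμ hD hDs k l m).symm
  · simp

/-! ### The Lax equation for `A₂` by reflection -/

theorem toeplitz_neg (ν : Moments) (P Q : ℂ[T;T⁻¹]) : toeplitz (-ν) P Q = -toeplitz ν P Q := by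
  have key : toeplitz (-ν) = -toeplitz ν := by
    refine linearMap_ext_z fun m => linearMap_ext_z fun n => ?_
    simp only [LinearMap.neg_apply, toeplitz_z, Pi.neg_apply]
  rw [key, LinearMap.neg_apply, LinearMap.neg_apply]

/-- The sign here reverses the commutator for `A₂`, and `k ↦ -k` explains its exponents `1 - k` and
`-k`. -/
theorem reflect_masterField (k : ℤ) (μ : Moments) :
    masterField (-k) (reflect μ) = -reflect (masterField k μ) := by
  ext j
  simp only [masterField, reflect, Pi.neg_apply]
  rw [show -(j + -k) = -j + k by ring]
  push_cast
  ring

theorem mul_neg_right (A B : SMatrix) : mul A (-B) = -mul A B := by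
  ext i j
  simp [mul, finsum_neg_distrib]

theorem mul_neg_left (A B : SMatrix) : mul (-A) B = -mul A B := by
  ext i j
  simp [mul, finsum_neg_distrib]

theorem commutator_neg_right (A B : SMatrix) : commutator A (-B) = commutator B A := by
  rw [commutator, commutator, mul_neg_right, mul_neg_left]
  abel

theorem hasLieDerivAt_A2 {μ : Moments} (hμ : Regular μ) {D Ds : SMatrix}
    (hD : Represents D ddz (g μ)) (hDs : Represents Ds.transpose ddz (fDual μ)) (k : ℤ) (i j : ℕ) :
    HasLieDerivAt (masterField k) (fun ν => A2 ν i j) μ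
      (commutator (strictLower (mul D (A2pow μ (1 - k)))
        + strictLower (mul (A2pow μ (1 - k)) Ds) - (k : ℂ) • strictLower (A2pow μ (-k)))
        (A2 μ) i j) := by
  rintro γ rfl hγ
  have key := hasDerivAt_A1 (γ := fun u => reflect (γ u)) hμ.reflect (hasDerivAt_reflect hγ) i j
  simp only [A1_reflect] at key
  refine key.congr_deriv ?_
  rw [← commutator_neg_right (A2 (γ 0))]
  congr 2
  ext l m
  rw [← f_reflect] at hD
  rw [← gDual_reflect] at hDs
  have hp : ∀ n, A1pow (reflect (γ 0)) n = A2pow (γ 0) n := fun n => by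
    rw [A1pow, A2pow, A1_reflect, A1star_reflect]
  have := masterField_pairing hμ.reflect hD hDs (-k) l m
  rw [reflect_masterField, neg_add_eq_sub, hp, hp] at this
  rw [toeplitz_neg, neg_div, eq_neg_iff_add_eq_zero, ← eq_neg_iff_add_eq_zero] at this
  simp only [Matrix.add_apply, Matrix.sub_apply, Matrix.neg_apply, Matrix.smul_apply, strictLower,
    Matrix.of_apply, smul_eq_mul]
  split_ifs with hl
  · rw [eq_neg_iff_add_eq_zero] at this
    rw [← sub_eq_zero, ← this]
    push_cast
    ring
  · simp


/-! ### Elementary Schur polynomials -/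

/-- The times `t_j` and `s_j`. -/
abbrev Time := ℕ+ ⊕ ℕ+

theorem elemSchur_of_neg (x : ℕ+ → Series) {m : ℤ} (hm : m < 0) : elemSchur x m = 0 := by
  obtain ⟨n, rfl⟩ := Int.eq_negSucc_of_lt_zero hm
  rfl

/-- Moves the exponential to the coefficient ring `Series`, where the chain rule for substitution is
applied. -/
theorem exp_subst_eq (a : PowerSeries Series) (ha : PowerSeries.HasSubst a) :
    (PowerSeries.exp ℂ).subst a = (PowerSeries.exp Series).subst a := by
  ext1 n
  rw [PowerSeries.coeff_subst' ha, PowerSeries.coeff_subst' ha]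
  refine finsum_congr fun d => ?_
  rw [← PowerSeries.map_exp (algebraMap ℂ Series), PowerSeries.coeff_map, algebraMap_smul]

theorem elemSchur_zero (x : ℕ+ → Series) : elemSchur x 0 = 1 := by
  change PowerSeries.coeff 0 ((PowerSeries.exp ℂ).subst (timeSeries x) : PowerSeries Series) = 1
  rw [exp_subst_eq _ (hasSubst_timeSeries x), PowerSeries.coeff_subst' (hasSubst_timeSeries x),
    finsum_eq_single _ 0]
  · simp
  · intro n hn
    have : PowerSeries.constantCoeff (timeSeries x) = 0 := by
      simp [timeSeries, ← PowerSeries.coeff_zero_eq_constantCoeff_apply]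
    rw [PowerSeries.coeff_zero_eq_constantCoeff_apply, map_pow, this, zero_pow hn, smul_zero]

theorem elemSchur_natCast (x : ℕ+ → Series) (n : ℕ) : elemSchur x n =
    PowerSeries.coeff n ((PowerSeries.exp Series).subst (timeSeries x) : PowerSeries Series) := by
  rw [← exp_subst_eq _ (hasSubst_timeSeries x)]
  rfl

/-- Compare coefficients in `(exp X)' = X' exp X`, with `X` the series of the times. -/
theorem elemSchur_succ_rec (x : ℕ+ → Series) (n : ℕ) : ((n : Series) + 1) * elemSchur x (n + 1) =
    ∑ k ∈ Finset.range (n + 1), ((k : Series) + 1) * (x k.succPNat * elemSchur x (n - k)) := by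
  have hd := PowerSeries.derivative_subst (f := PowerSeries.exp Series) (hasSubst_timeSeries x)
  rw [PowerSeries.derivative_exp] at hd
  have hc := congrArg (PowerSeries.coeff n) hd
  rw [PowerSeries.coeff_derivative, PowerSeries.coeff_mul, ← elemSchur_natCast,
    ← Finset.Nat.sum_antidiagonal_swap, Finset.Nat.sum_antidiagonal_eq_sum_range_succ_mk] at hc
  push_cast at hc
  rw [mul_comm, hc]
  refine Finset.sum_congr rfl fun k hk => ?_
  have hk' : k ≤ n := by simpa [Nat.lt_succ_iff] using hk
  simp only [Prod.swap]
  rw [← elemSchur_natCast, Nat.cast_sub hk', PowerSeries.coeff_derivative, timeSeries,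
    PowerSeries.coeff_mk, dif_pos (Nat.succ_pos k)]
  have : (⟨k + 1, Nat.succ_pos k⟩ : ℕ+) = k.succPNat := rfl
  rw [this]
  ring

/-- The recursion `m S_m = ∑_{k ≥ 1} k x_k S_{m-k}`. -/
theorem elemSchur_rec (x : ℕ+ → Series) (m : ℤ) (N : ℕ) (hN : m ≤ N) :
    (m : Series) * elemSchur x m =
    ∑ k ∈ Finset.range N, ((k : Series) + 1) * (x k.succPNat * elemSchur x (m - (k + 1))) := by
  rcases lt_trichotomy m 0 with hm | rfl | hm
  · rw [elemSchur_of_neg x hm, mul_zero, Finset.sum_eq_zero]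
    intro k _
    rw [elemSchur_of_neg x (by omega), mul_zero, mul_zero]
  · rw [Int.cast_zero, zero_mul, Finset.sum_eq_zero]
    intro k _
    rw [elemSchur_of_neg x (by omega), mul_zero, mul_zero]
  · obtain ⟨n, rfl⟩ : ∃ n : ℕ, m = n + 1 := ⟨(m - 1).toNat, by omega⟩
    have := elemSchur_succ_rec x n
    push_cast
    rw [this]
    rw [← Finset.sum_subset (Finset.range_subset_range.2 (by omega : n + 1 ≤ N))]
    · refine Finset.sum_congr rfl fun k _ => ?_
      congr 3
      ring
    · intro k _ hk
      rw [elemSchur_of_neg x (by simp at hk; omega), mul_zero, mul_zero]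

theorem natCast_mul_cancel {m : ℕ} (hm : m ≠ 0) {F G : Series}
    (hFG : (m : Series) * F = (m : Series) * G) : F = G := by
  ext1 d
  have := congrArg (MvPowerSeries.coeff d) hFG
  rw [← nsmul_eq_mul, ← nsmul_eq_mul, map_nsmul, map_nsmul] at this
  exact (smul_right_injective ℂ hm) this

/-- A derivation with `δ x_k = δ_{kl}` sends `S_m` to `S_{m-l}`. -/
theorem derivation_elemSchur (x : ℕ+ → Series) (δ : Derivation ℂ Series Series) (l : ℕ+)
    (hδ : ∀ k, δ (x k) = if k = l then 1 else 0) (m : ℤ) :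
    δ (elemSchur x m) = elemSchur x (m - l) := by
  have hl := l.pos
  rcases lt_trichotomy m 0 with hm | rfl | hm
  · rw [elemSchur_of_neg x hm, elemSchur_of_neg x (by omega), map_zero]
  · rw [elemSchur_zero, elemSchur_of_neg x (by omega), Derivation.map_one_eq_zero]
  · lift m to ℕ using hm.le
    induction m using Nat.strong_induction_on with
    | _ m ih =>
    have hδS : ∀ k : ℕ, δ (elemSchur x (m - (k + 1))) = elemSchur x (m - l - (k + 1)) := by
      intro k
      rcases lt_trichotomy ((m : ℤ) - (k + 1)) 0 with h0 | h0 | h0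
      · rw [elemSchur_of_neg x h0, elemSchur_of_neg x (by omega), map_zero]
      · rw [h0, elemSchur_zero, elemSchur_of_neg x (by omega), Derivation.map_one_eq_zero]
      · have := ih (m - (k + 1)) (by omega) (by omega)
        rw [Nat.cast_sub (by omega)] at this
        push_cast at this
        rw [this]
        congr 1
        ring
    -- The truncation `m + l` serves both recursions and contains the index `l - 1` of `x_l` even
    -- when `l > m`. Together they give `m δS_m = l S_{m-l} + (m-l) S_{m-l}`.
    have h1 := congrArg δ (elemSchur_rec x m (m + l) (by omega))
    have h2 := elemSchur_rec x (m - l) (m + l) (by push_cast; omega)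
    apply natCast_mul_cancel (m := m) (by omega)
    have hnat : ∀ n : ℕ, δ (n : Series) = 0 := fun n => Derivation.map_natCast δ n
    rw [map_sum] at h1
    simp only [Int.cast_natCast, Derivation.leibniz, smul_eq_mul, map_add, hnat,
      Derivation.map_one_eq_zero, hδS, hδ, mul_zero, add_zero, mul_add, Finset.sum_add_distrib,
      ← h2] at h1
    rw [h1]
    rw [Finset.sum_eq_single (l.natPred)]
    · rw [PNat.succPNat_natPred, if_pos rfl]
      have : ((l.natPred : ℕ) : ℤ) + 1 = l := by
        have := PNat.natPred_add_one l
        omega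
      rw [this]
      have h3 : (l.natPred : Series) + 1 = (l : ℕ) := by
        rw [← PNat.natPred_add_one l]; push_cast; rfl
      rw [h3]
      push_cast
      ring
    · intro k _ hk
      rw [if_neg, mul_zero, mul_zero]
      rintro rfl
      exact hk (Nat.natPred_succPNat k).symm
    · intro hl'
      simp at hl'
      have := PNat.natPred_add_one l
      omega

/-- A derivation which kills the times kills the elementary Schur polynomials. -/
theorem derivation_elemSchur_eq_zero (x : ℕ+ → Series) (δ : Derivation ℂ Series Series)
    (hδ : ∀ k, δ (x k) = 0) (m : ℤ) : δ (elemSchur x m) = 0 := by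
  rcases lt_trichotomy m 0 with hm | rfl | hm
  · rw [elemSchur_of_neg x hm, map_zero]
  · rw [elemSchur_zero, Derivation.map_one_eq_zero]
  · lift m to ℕ using hm.le
    induction m using Nat.strong_induction_on with
    | _ m ih =>
    have hδS : ∀ k : ℕ, δ (elemSchur x (m - (k + 1))) = 0 := by
      intro k
      rcases lt_trichotomy ((m : ℤ) - (k + 1)) 0 with h0 | h0 | h0
      · rw [elemSchur_of_neg x h0, map_zero]
      · rw [h0, elemSchur_zero, Derivation.map_one_eq_zero]
      · have := ih (m - (k + 1)) (by omega) (by omega)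
        rw [Nat.cast_sub (by omega)] at this
        push_cast at this
        exact this
    have h1 := congrArg δ (elemSchur_rec x m m le_rfl)
    apply natCast_mul_cancel (m := m) (by omega)
    have hnat : ∀ n : ℕ, δ (n : Series) = 0 := fun n => Derivation.map_natCast δ n
    rw [map_sum] at h1
    simpa [hnat, hδS, hδ, Derivation.leibniz] using h1

/-! ### Coefficients of the moment series -/

/-- Raising one exponent by one is what a partial derivative does to coefficients, so this is the
induction suited to identities determined by constant term and derivatives. -/
theorem finsupp_induction_single {P : (Time →₀ ℕ) → Prop} (h0 : P 0)
    (hs : ∀ d i, P d → P (d + Finsupp.single i 1)) (d : Time →₀ ℕ) : P d := by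
  induction d using Finsupp.induction with
  | zero => exact h0
  | single_add i a d _ _ ih =>
    clear * - hs ih
    induction a with
    | zero => simpa using ih
    | succ a iha =>
      rw [Finsupp.single_add, add_right_comm]
      exact hs _ _ iha

/-- `∏ 1 / d_i!`. -/
def expCoeff (d : Time →₀ ℕ) : ℂ := d.prod fun _ a => ((a.factorial : ℕ) : ℂ)⁻¹

theorem expCoeff_add_single (d : Time →₀ ℕ) (i : Time) :
    expCoeff (d + Finsupp.single i 1) * (d i + 1) = expCoeff d := by
  rw [expCoeff, expCoeff, Finsupp.prod_of_support_subset (d + Finsupp.single i 1) (s := insert i d.support) ?_ _ (by simp),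
    Finsupp.prod_of_support_subset d (s := insert i d.support) (Finset.subset_insert _ _) _ (by simp),
    ← Finset.mul_prod_erase _ _ (Finset.mem_insert_self i _),
    ← Finset.mul_prod_erase (insert i d.support) _ (Finset.mem_insert_self i _)]
  · have hprod : ∏ x ∈ (insert i d.support).erase i,
        (((((d + Finsupp.single i 1 : Time →₀ ℕ)) x).factorial : ℕ) : ℂ)⁻¹ =
        ∏ x ∈ (insert i d.support).erase i, (((d x).factorial : ℕ) : ℂ)⁻¹ := by
      refine Finset.prod_congr rfl fun x hx => ?_
      rw [Finsupp.add_apply, Finsupp.single_eq_of_ne (Finset.ne_of_mem_erase hx), add_zero]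
    rw [hprod, Finsupp.add_apply, Finsupp.single_eq_same, Nat.factorial_succ]
    have : ((d i : ℂ) + 1) ≠ 0 := Nat.cast_add_one_ne_zero _
    push_cast
    field_simp
  · intro x hx
    simp only [Finsupp.mem_support_iff, Finsupp.add_apply, Finset.mem_insert] at *
    by_contra! hc
    rw [Finsupp.single_eq_of_ne hc.1, hc.2] at hx
    exact hx rfl

/-- The degree of `d` in the variables `t`. -/
def tDegree : (Time →₀ ℕ) →+ ℕ := Finsupp.weight (Sum.elim (fun j : ℕ+ => (j : ℕ)) fun _ : ℕ+ => 0)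

/-- The degree of `d` in the variables `s`. -/
def sDegree : (Time →₀ ℕ) →+ ℕ := Finsupp.weight (Sum.elim (fun _ : ℕ+ => 0) fun j : ℕ+ => (j : ℕ))

theorem tDegree_add_inl (d : Time →₀ ℕ) (k : ℕ+) :
    tDegree (d + Finsupp.single (Sum.inl k) 1) = tDegree d + k := by
  simp [tDegree, Finsupp.weight_single]

theorem tDegree_add_inr (d : Time →₀ ℕ) (k : ℕ+) :
    tDegree (d + Finsupp.single (Sum.inr k) 1) = tDegree d := by
  simp [tDegree, Finsupp.weight_single]

theorem sDegree_add_inl (d : Time →₀ ℕ) (k : ℕ+) :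
    sDegree (d + Finsupp.single (Sum.inl k) 1) = sDegree d := by
  simp [sDegree, Finsupp.weight_single]

theorem sDegree_add_inr (d : Time →₀ ℕ) (k : ℕ+) :
    sDegree (d + Finsupp.single (Sum.inr k) 1) = sDegree d + k := by
  simp [sDegree, Finsupp.weight_single]

theorem dt_elemSchur_t (k : ℕ+) (m : ℤ) : dt k (elemSchur t m) = elemSchur t (m - k) :=
  derivation_elemSchur t (MvPowerSeries.pderiv ℂ (Sum.inl k)) k (fun j => by
    rw [t, MvPowerSeries.pderiv_X]; simp [Pi.single_apply]) m

theorem ds_elemSchur_t (k : ℕ+) (m : ℤ) : ds k (elemSchur t m) = 0 :=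
  derivation_elemSchur_eq_zero t (MvPowerSeries.pderiv ℂ (Sum.inr k)) (fun j => by
    rw [t, MvPowerSeries.pderiv_X]; simp) m

theorem dt_elemSchur_s (k : ℕ+) (m : ℤ) : dt k (elemSchur s m) = 0 :=
  derivation_elemSchur_eq_zero s (MvPowerSeries.pderiv ℂ (Sum.inl k)) (fun j => by
    rw [s, MvPowerSeries.pderiv_X]; simp) m

theorem ds_elemSchur_s (k : ℕ+) (m : ℤ) : ds k (elemSchur s m) = elemSchur s (m - k) :=
  derivation_elemSchur s (MvPowerSeries.pderiv ℂ (Sum.inr k)) k (fun j => by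
    rw [s, MvPowerSeries.pderiv_X]; simp [Pi.single_apply]) m

theorem dt_mul (k : ℕ+) (F G : Series) : dt k (F * G) = dt k F * G + F * dt k G := by
  rw [dt, Derivation.leibniz, smul_eq_mul, smul_eq_mul, dt, dt]
  ring

theorem ds_mul (k : ℕ+) (F G : Series) : ds k (F * G) = ds k F * G + F * ds k G := by
  rw [ds, Derivation.leibniz, smul_eq_mul, smul_eq_mul, ds, ds]
  ring

theorem coeff_dt (k : ℕ+) (F : Series) (d : Time →₀ ℕ) : MvPowerSeries.coeff d (dt k F) =
    MvPowerSeries.coeff (d + Finsupp.single (Sum.inl k) 1) F * (d (Sum.inl k) + 1) :=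
  MvPowerSeries.coeff_pderiv ..

theorem coeff_ds (k : ℕ+) (F : Series) (d : Time →₀ ℕ) : MvPowerSeries.coeff d (ds k F) =
    MvPowerSeries.coeff (d + Finsupp.single (Sum.inr k) 1) F * (d (Sum.inr k) + 1) :=
  MvPowerSeries.coeff_pderiv ..

theorem constantCoeff_elemSchur {x : ℕ+ → Series} (hx : ∀ k, MvPowerSeries.constantCoeff (x k) = 0)
    (m : ℤ) : MvPowerSeries.constantCoeff (elemSchur x m) = if m = 0 then 1 else 0 := by
  rcases lt_trichotomy m 0 with hm | rfl | hm
  · rw [elemSchur_of_neg x hm, map_zero, if_neg hm.ne]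
  · rw [elemSchur_zero, map_one, if_pos rfl]
  · rw [if_neg hm.ne']
    lift m to ℕ using hm.le
    have h1 := congrArg MvPowerSeries.constantCoeff (elemSchur_rec x m m le_rfl)
    rw [map_sum] at h1
    simpa [hx, (show m ≠ 0 by omega)] using h1

/-- Both sides have the same constant term and transform alike under every partial derivative, which
lowers `m` or `n` by the weight of the variable. -/
theorem coeff_elemSchur_mul (m n : ℤ) (d : Time →₀ ℕ) :
    MvPowerSeries.coeff d (elemSchur t m * elemSchur s n) =
      if m = tDegree d ∧ n = sDegree d then expCoeff d else 0 := by
  induction d using finsupp_induction_single generalizing m n with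
  | h0 =>
    rw [MvPowerSeries.coeff_zero_eq_constantCoeff_apply, map_mul,
      constantCoeff_elemSchur (x := t) fun k => MvPowerSeries.constantCoeff_X _,
      constantCoeff_elemSchur (x := s) fun k => MvPowerSeries.constantCoeff_X _, map_zero, map_zero,
      expCoeff, Finsupp.prod_zero_index, Nat.cast_zero, ite_and]
    split_ifs <;> simp
  | hs d i ih =>
    have hi : ((d i : ℂ) + 1) ≠ 0 := Nat.cast_add_one_ne_zero _
    refine mul_right_cancel₀ hi ?_
    rw [ite_mul, expCoeff_add_single, zero_mul]
    rcases i with k | k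
    · rw [← coeff_dt, dt_mul, dt_elemSchur_t, dt_elemSchur_s, mul_zero, add_zero, ih,
        tDegree_add_inl, sDegree_add_inl]
      push_cast
      simp only [sub_eq_iff_eq_add]
    · rw [← coeff_ds, ds_mul, ds_elemSchur_t, ds_elemSchur_s, zero_mul, zero_add, ih,
        tDegree_add_inr, sDegree_add_inr]
      push_cast
      simp only [sub_eq_iff_eq_add]

/-- By homogeneity only the pair `(m, n)` of degrees of `d` contributes. -/
theorem coeff_momentSeries (μ : Moments) (j : ℤ) (d : Time →₀ ℕ) :
    MvPowerSeries.coeff d (momentSeries μ j) = μ (j + tDegree d - sDegree d) * expCoeff d := by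
  change ∑ᶠ p : ℕ × ℕ, MvPowerSeries.coeff d
    (μ (j + p.1 - p.2) • (elemSchur t p.1 * elemSchur s p.2)) = _
  rw [finsum_eq_single _ (tDegree d, sDegree d)]
  · rw [map_smul, coeff_elemSchur_mul, if_pos ⟨rfl, rfl⟩, smul_eq_mul]
  · rintro ⟨m, n⟩ hmn
    rw [map_smul, coeff_elemSchur_mul, if_neg, smul_zero]
    rintro ⟨h1, h2⟩
    exact hmn (Prod.ext (by exact_mod_cast h1) (by exact_mod_cast h2))

theorem constantCoeff_momentSeries (μ : Moments) (j : ℤ) :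
    MvPowerSeries.constantCoeff (momentSeries μ j) = μ j := by
  rw [← MvPowerSeries.coeff_zero_eq_constantCoeff_apply, coeff_momentSeries]
  simp [expCoeff]

theorem dt_momentSeries (μ : Moments) (j : ℤ) (k : ℕ+) :
    dt k (momentSeries μ j) = momentSeries μ (j + k) := by
  ext1 d
  rw [coeff_dt, coeff_momentSeries, coeff_momentSeries, mul_assoc, expCoeff_add_single,
    tDegree_add_inl, sDegree_add_inl]
  congr 2
  push_cast
  ring

theorem ds_momentSeries (μ : Moments) (j : ℤ) (k : ℕ+) :
    ds k (momentSeries μ j) = momentSeries μ (j - k) := by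
  ext1 d
  rw [coeff_ds, coeff_momentSeries, coeff_momentSeries, mul_assoc, expCoeff_add_single,
    tDegree_add_inr, sDegree_add_inr]
  congr 2
  push_cast
  ring


/-! ### Modes -/

/-- The exponent `k` of `t_k` and `-k` of `s_k`. -/
def exponent : Time → ℤ := Sum.elim (fun k : ℕ+ => (k : ℤ)) fun k : ℕ+ => -(k : ℤ)

theorem eq_zero_or_exponent (m : ℤ) : m = 0 ∨ ∃ i, m = exponent i := by
  rcases m with (_ | k) | k
  · exact Or.inl rfl
  · exact Or.inr ⟨Sum.inl k.succPNat, rfl⟩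
  · exact Or.inr ⟨Sum.inr k.succPNat, rfl⟩

/-- The derivative `∂/∂t_m` for `m > 0`, `∂/∂s_{-m}` for `m < 0`, and multiplication by `n` for
`m = 0`. -/
def mode (n : ℕ) : ℤ → Series →ₗ[ℂ] Series
  | Int.ofNat 0 => (n : ℂ) • LinearMap.id
  | Int.ofNat (k + 1) => (MvPowerSeries.pderiv ℂ (Sum.inl k.succPNat)).toLinearMap
  | Int.negSucc k => (MvPowerSeries.pderiv ℂ (Sum.inr k.succPNat)).toLinearMap

theorem mode_zero (n : ℕ) (F : Series) : mode n 0 F = (n : ℂ) • F := rfl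

theorem mode_exponent (n : ℕ) (i : Time) (F : Series) :
    mode n (exponent i) F = MvPowerSeries.pderiv ℂ i F := by
  rcases i with k | k <;> obtain ⟨k, rfl⟩ : ∃ j : ℕ, k = j.succPNat :=
    ⟨k.natPred, (PNat.succPNat_natPred k).symm⟩ <;> rfl

theorem mode_natCast (n : ℕ) (k : ℕ+) (F : Series) : mode n k F = dt k F :=
  mode_exponent n (Sum.inl k) F

theorem mode_neg_natCast (n : ℕ) (k : ℕ+) (F : Series) : mode n (-k) F = ds k F :=
  mode_exponent n (Sum.inr k) F

theorem pderiv_comm (i j : Time) (F : Series) : MvPowerSeries.pderiv ℂ i (MvPowerSeries.pderiv ℂ j F)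
    = MvPowerSeries.pderiv ℂ j (MvPowerSeries.pderiv ℂ i F) := by
  by_cases hij : i = j
  · rw [hij]
  ext1 d
  simp only [MvPowerSeries.coeff_pderiv, Finsupp.add_apply, Finsupp.single_eq_of_ne hij,
    Finsupp.single_eq_of_ne (Ne.symm hij), add_zero]
  rw [add_right_comm]
  ring

theorem mode_comm (n : ℕ) (a b : ℤ) (F : Series) :
    mode n a (mode n b F) = mode n b (mode n a F) := by
  rcases eq_zero_or_exponent a with rfl | ⟨i, rfl⟩
  · rw [mode_zero, mode_zero, map_smul]
  rcases eq_zero_or_exponent b with rfl | ⟨j, rfl⟩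
  · rw [mode_zero, mode_zero, map_smul]
  simp only [mode_exponent, pderiv_comm i j]

theorem coeff_X_mul_eq_zero {d : Time →₀ ℕ} {i : Time} (hi : i ∉ d.support) (G : Series) :
    MvPowerSeries.coeff d (MvPowerSeries.X i * G) = 0 := by
  rw [MvPowerSeries.X_def, MvPowerSeries.coeff_monomial_mul, if_neg]
  intro hle
  have := hle i
  simp at this hi
  omega

/-- The series `∑_{k ≥ 1} (k t_k G_k - k s_k G_{-k})`. -/
def timeSum (G : ℤ → Series) : Series := fun d => ∑ i ∈ d.support,
  (exponent i : ℂ) * MvPowerSeries.coeff d (MvPowerSeries.X i * G (exponent i))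

theorem coeff_timeSum (G : ℤ → Series) {d : Time →₀ ℕ} {A : Finset Time} (hA : d.support ⊆ A) :
    MvPowerSeries.coeff d (timeSum G) = ∑ i ∈ A,
      (exponent i : ℂ) * MvPowerSeries.coeff d (MvPowerSeries.X i * G (exponent i)) := by
  rw [← Finset.sum_subset hA]
  · rfl
  · intro i _ hi
    rw [coeff_X_mul_eq_zero hi, mul_zero]

theorem timeSum_add (G H : ℤ → Series) :
    timeSum (fun j => G j + H j) = timeSum G + timeSum H := by
  ext1 d
  simp only [map_add, coeff_timeSum _ subset_rfl, mul_add, Finset.sum_add_distrib]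

theorem timeSum_smul (c : ℂ) (G : ℤ → Series) :
    timeSum (fun j => c • G j) = c • timeSum G := by
  ext1 d
  simp only [map_smul, coeff_timeSum _ subset_rfl, mul_smul_comm, Finset.smul_sum]

theorem timeSum_sum {ι : Type*} (A : Finset ι) (G : ι → ℤ → Series) :
    timeSum (fun j => ∑ a ∈ A, G a j) = ∑ a ∈ A, timeSum (G a) := by
  ext1 d
  simp only [map_sum, coeff_timeSum _ subset_rfl, Finset.mul_sum]
  rw [Finset.sum_comm]

/-- Product rule: the derivative hits either the time of index `m`, which carries the weight `m`, or
the series. For `m = 0` the first term vanishes, consistently with a scalar mode. -/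
theorem mode_timeSum (n : ℕ) (m : ℤ) (G : ℤ → Series) :
    mode n m (timeSum G) = (m : ℂ) • G m + timeSum fun j => mode n m (G j) := by
  rcases eq_zero_or_exponent m with rfl | ⟨i, rfl⟩
  · simp only [mode_zero, timeSum_smul]
    simp
  · simp only [mode_exponent]
    ext1 d
    -- The coefficient at the raised exponent may involve the variable `i` not present in `d`, so
    -- both sums are taken over the enlarged support.
    have hsub : (d + Finsupp.single i 1).support ⊆ insert i d.support := fun x hx => by
      simp only [Finsupp.mem_support_iff, Finsupp.add_apply, Finset.mem_insert] at *
      by_contra! hc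
      rw [Finsupp.single_eq_of_ne hc.1, hc.2] at hx
      exact hx rfl
    rw [MvPowerSeries.coeff_pderiv, coeff_timeSum _ hsub, map_add,
      coeff_timeSum _ (Finset.subset_insert i d.support), Finset.sum_mul]
    have : ∀ j, (exponent j : ℂ) * MvPowerSeries.coeff (d + Finsupp.single i 1)
        (MvPowerSeries.X j * G (exponent j)) * (d i + 1) =
        (if i = j then MvPowerSeries.coeff d ((exponent j : ℂ) • G (exponent j)) else 0) +
        (exponent j : ℂ) * MvPowerSeries.coeff d (MvPowerSeries.X j *
          MvPowerSeries.pderiv ℂ i (G (exponent j))) := by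
      intro j
      rw [mul_assoc, ← MvPowerSeries.coeff_pderiv, Derivation.leibniz, MvPowerSeries.pderiv_X,
        map_add, mul_add, add_comm]
      congr 1
      rw [Pi.single_apply]
      by_cases hij : i = j
      · subst hij
        simp
      · rw [if_neg (Ne.symm hij), if_neg hij, smul_zero, map_zero, mul_zero]
    simp only [this, Finset.sum_add_distrib]
    rw [Finset.sum_ite_eq, if_pos (Finset.mem_insert_self _ _)]

theorem X_mul_timeSum (i : Time) (G : ℤ → Series) :
    MvPowerSeries.X i * timeSum G = timeSum fun j => MvPowerSeries.X i * G j := by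
  ext1 d
  rw [MvPowerSeries.X_def, MvPowerSeries.coeff_monomial_mul,
    coeff_timeSum _ (d := d) (A := d.support) subset_rfl]
  split_ifs with hd
  · rw [coeff_timeSum (A := d.support) _ Finsupp.support_tsub, one_mul]
    · refine Finset.sum_congr rfl fun j _ => ?_
      rw [mul_left_comm, MvPowerSeries.coeff_monomial_mul, if_pos hd, one_mul]
  · refine (Finset.sum_eq_zero fun j _ => ?_).symm
    rw [mul_left_comm, MvPowerSeries.coeff_monomial_mul, if_neg hd, mul_zero]

/-- For a fixed monomial both summations run over its finite support, and may be exchanged. -/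
theorem timeSum_comm (G : ℤ → ℤ → Series) :
    timeSum (fun i => timeSum fun j => G i j) = timeSum fun j => timeSum fun i => G i j := by
  ext1 d
  simp only [coeff_timeSum _ subset_rfl, X_mul_timeSum, Finset.mul_sum]
  rw [Finset.sum_comm]
  refine Finset.sum_congr rfl fun i _ => Finset.sum_congr rfl fun j _ => ?_
  rw [mul_left_comm, mul_left_comm (MvPowerSeries.X i)]

/-! ### Oriented sums over intervals of integers -/

/-- The oriented sum of `w` over `(0, m]`. -/
def orientedSum {M : Type*} [AddCommGroup M] (w : ℤ → M) (m : ℤ) : M :=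
  ∑ j ∈ Finset.Ioc 0 m, w j - ∑ j ∈ Finset.Ioc m 0, w j

section OrientedSum

variable {M : Type*} [AddCommGroup M]

@[simp] theorem orientedSum_zero (w : ℤ → M) : orientedSum w 0 = 0 := by simp [orientedSum]

theorem orientedSum_add_one (w : ℤ → M) (m : ℤ) :
    orientedSum w (m + 1) = orientedSum w m + w (m + 1) := by
  rw [orientedSum, orientedSum]
  rcases le_or_gt 0 m with hm | hm
  · have h1 : Finset.Ioc 0 (m + 1) = insert (m + 1) (Finset.Ioc 0 m) := by
      ext x; simp only [Finset.mem_Ioc, Finset.mem_insert]; omega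
    rw [h1, Finset.sum_insert (by simp), Finset.Ioc_eq_empty (show ¬m + 1 < 0 by omega),
      Finset.Ioc_eq_empty (show ¬m < 0 by omega)]
    simp [add_comm]
  · have h1 : Finset.Ioc m 0 = insert (m + 1) (Finset.Ioc (m + 1) 0) := by
      ext x; simp only [Finset.mem_Ioc, Finset.mem_insert]; omega
    rw [h1, Finset.sum_insert (by simp), Finset.Ioc_eq_empty (show ¬0 < m + 1 by omega),
      Finset.Ioc_eq_empty (show ¬0 < m by omega)]
    simp

/-- Chasles' relation for `(0, c]` followed by `(c, m + c]`, valid for all signs. It spares a case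
distinction on the signs of `k` and `l` in the commutators. -/
theorem orientedSum_shift (w : ℤ → M) (c m : ℤ) :
    orientedSum w (m + c) = orientedSum w c + orientedSum (fun j => w (j + c)) m := by
  induction m using Int.induction_on with
  | zero => simp
  | succ m ih => rw [add_right_comm, orientedSum_add_one, ih, orientedSum_add_one, add_assoc,
      add_right_comm (m : ℤ) c 1]
  | pred m ih =>
    have h1 := orientedSum_add_one w (-m - 1 + c)
    have h2 := orientedSum_add_one (fun j => w (j + c)) (-m - 1)
    rw [show -(m : ℤ) - 1 + c + 1 = -m + c by ring] at h1
    rw [show -(m : ℤ) - 1 + 1 = -m by ring] at h2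
    rw [ih, h2, ← add_assoc] at h1
    exact (add_right_cancel h1).symm

theorem orientedSum_add (v w : ℤ → M) (m : ℤ) :
    orientedSum (fun j => v j + w j) m = orientedSum v m + orientedSum w m := by
  simp only [orientedSum, Finset.sum_add_distrib]
  abel

theorem map_orientedSum {N : Type*} [AddCommGroup N] (φ : M →+ N) (w : ℤ → M) (m : ℤ) :
    φ (orientedSum w m) = orientedSum (fun j => φ (w j)) m := by
  simp only [orientedSum, map_sub, map_sum]

end OrientedSum

/-! ### The Virasoro operators -/

/-- The first order part of `L_k^{(n)}`. -/
def virLinear (n : ℕ) (k : ℤ) (F : Series) : Series := timeSum fun j => mode n (j + k) F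

/-- The quadratic part of `L_k^{(n)}`. -/
def virQuad (n : ℕ) (k : ℤ) (F : Series) : Series :=
  orientedSum (fun j => mode n j (mode n (k - j) F)) k

theorem virLinear_add (n : ℕ) (k : ℤ) (F G : Series) :
    virLinear n k (F + G) = virLinear n k F + virLinear n k G := by
  simp only [virLinear, map_add, timeSum_add]

theorem virLinear_smul (n : ℕ) (k : ℤ) (c : ℂ) (F : Series) :
    virLinear n k (c • F) = c • virLinear n k F := by
  simp only [virLinear, map_smul, timeSum_smul]

/-- The first order part of `L_k^{(n)}` as a linear map. -/
def virLinearₗ (n : ℕ) (k : ℤ) : Series →ₗ[ℂ] Series where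
  toFun := virLinear n k
  map_add' := virLinear_add n k
  map_smul' := virLinear_smul n k

theorem mode_virLinear (n : ℕ) (m k : ℤ) (F : Series) :
    mode n m (virLinear n k F) = (m : ℂ) • mode n (m + k) F + virLinear n k (mode n m F) := by
  rw [virLinear, mode_timeSum, virLinear]
  simp only [mode_comm n m]

theorem virLinear_virLinear (n : ℕ) (k l : ℤ) (F : Series) : virLinear n k (virLinear n l F) =
    timeSum (fun i => ((i + k : ℤ) : ℂ) • mode n (i + k + l) F) +
      timeSum fun i => timeSum fun j => mode n (i + k) (mode n (j + l) F) := by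
  rw [virLinear, ← timeSum_add]
  congr 1
  ext1 i
  rw [mode_virLinear, virLinear]
  simp only [mode_comm n (i + k)]

/-- The double sums agree by `timeSum_comm` and commutation of modes; the single sums leave the
weight `(i+k) - (i+l)`. -/
theorem virLinear_commutator (n : ℕ) (k l : ℤ) (F : Series) :
    virLinear n k (virLinear n l F) - virLinear n l (virLinear n k F) =
      ((k - l : ℤ) : ℂ) • virLinear n (k + l) F := by
  rw [virLinear_virLinear, virLinear_virLinear, timeSum_comm]
  simp only [mode_comm n (_ + l)]
  rw [add_sub_add_right_eq_sub, virLinear, ← timeSum_smul, sub_eq_iff_eq_add, ← timeSum_add]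
  congr 1
  ext1 i
  rw [add_right_comm i l k, add_assoc i k l, ← add_smul]
  congr 1
  push_cast
  ring

/-- The first order part is moved through the two modes in turn, each passage costing one commutator
term. -/
theorem virLinear_virQuad (n : ℕ) (k l : ℤ) (F : Series) :
    virLinear n k (virQuad n l F) = virQuad n l (virLinear n k F) -
      orientedSum (fun j => (j : ℂ) • mode n (j + k) (mode n (l - j) F)) l -
      orientedSum (fun j => ((l - j : ℤ) : ℂ) • mode n j (mode n (l + k - j) F)) l := by
  rw [eq_sub_iff_add_eq, eq_sub_iff_add_eq]
  have : virLinear n k (virQuad n l F) =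
      orientedSum (fun j => virLinear n k (mode n j (mode n (l - j) F))) l :=
    map_orientedSum (virLinearₗ n k).toAddMonoidHom _ _
  rw [this, virQuad, ← orientedSum_add, ← orientedSum_add]
  congr 1
  ext1 j
  rw [mode_virLinear, map_add, mode_virLinear, map_smul, show l - j + k = l + k - j by ring]
  abel

/-- The quadratic parts are polynomials in commuting modes. -/
theorem virQuad_virQuad_comm (n : ℕ) (k l : ℤ) (F : Series) :
    virQuad n k (virQuad n l F) = virQuad n l (virQuad n k F) := by
  have hm : ∀ a (w : ℤ → Series) m, mode n a (orientedSum w m) =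
      orientedSum (fun j => mode n a (w j)) m := fun a w m =>
    map_orientedSum (mode n a).toAddMonoidHom w m
  have hq : ∀ (w : ℤ → Series) k m, virQuad n k (orientedSum w m) =
      orientedSum (fun j => virQuad n k (w j)) m := by
    intro w k m
    simp only [virQuad, hm]
    simp only [orientedSum, Finset.sum_sub_distrib]
    rw [Finset.sum_comm, Finset.sum_comm (s := Finset.Ioc k 0), Finset.sum_comm (s := Finset.Ioc 0 k),
      Finset.sum_comm (s := Finset.Ioc k 0) (t := Finset.Ioc m 0)]
    abel
  conv_lhs => rw [virQuad.eq_1 n l, hq]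
  conv_rhs => rw [virQuad.eq_1 n l]
  congr 1
  ext1 j
  rw [virQuad, virQuad, hm, hm]
  congr 1
  ext1 i
  conv_rhs => rw [mode_comm n (l - j) i, mode_comm n j i, mode_comm n (l - j) (k - i),
    mode_comm n j (k - i)]

/-- The operator `L_k^{(n)}` in terms of modes. -/
def vir (n : ℕ) (k : ℤ) (F : Series) : Series := virLinear n k F + virQuad n k F

/-- Every term is an oriented sum of `u_j = a_j a_{k+l-j}` with weight `j - k` or `j - l`. Chasles'
relation joins them into two sums over `(0, k+l]`, whose weights differ by the constant `k - l`. -/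
theorem virLinear_virQuad_commutator (n : ℕ) (k l : ℤ) (F : Series) :
    (virLinear n k (virQuad n l F) - virQuad n l (virLinear n k F)) -
      (virLinear n l (virQuad n k F) - virQuad n k (virLinear n l F)) =
      ((k - l : ℤ) : ℂ) • virQuad n (k + l) F := by
  rw [virLinear_virQuad, virLinear_virQuad]
  set u : ℤ → Series := fun j => mode n j (mode n (k + l - j) F) with hu
  have h1 := orientedSum_shift (fun j => ((j - k : ℤ) : ℂ) • u j) k l
  have h2 := orientedSum_shift (fun j => ((j - l : ℤ) : ℂ) • u j) l k
  have hs : ∀ (c : ℂ) (w : ℤ → Series) m, orientedSum (fun j => c • w j) m = c • orientedSum w m :=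
    fun c w m => by simp only [orientedSum, smul_sub, Finset.smul_sum]
  have e1 : (fun j : ℤ => ((j + k - k : ℤ) : ℂ) • u (j + k)) =
      fun j : ℤ => (j : ℂ) • mode n (j + k) (mode n (l - j) F) := by
    ext1 j
    simp only [hu, add_sub_cancel_right, show k + l - (j + k) = l - j by ring]
  have e2 : (fun j : ℤ => ((j + l - l : ℤ) : ℂ) • u (j + l)) =
      fun j : ℤ => (j : ℂ) • mode n (j + l) (mode n (k - j) F) := by
    ext1 j
    simp only [hu, add_sub_cancel_right, show k + l - (j + l) = k - j by ring]
  have e3 : (fun j : ℤ => ((l - j : ℤ) : ℂ) • mode n j (mode n (l + k - j) F)) =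
      fun j : ℤ => (-1 : ℂ) • ((j - l : ℤ) : ℂ) • u j := by
    ext1 j
    rw [hu, smul_smul, add_comm l k]
    congr 1
    push_cast
    ring
  have e4 : (fun j : ℤ => ((k - j : ℤ) : ℂ) • mode n j (mode n (k + l - j) F)) =
      fun j : ℤ => (-1 : ℂ) • ((j - k : ℤ) : ℂ) • u j := by
    ext1 j
    rw [hu, smul_smul]
    congr 1
    push_cast
    ring
  simp only [e1] at h1
  simp only [e2] at h2
  rw [e3, e4, hs, hs]
  have h3 : orientedSum (fun j => ((j - l : ℤ) : ℂ) • u j) (k + l) =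
      orientedSum (fun j => ((j - k : ℤ) : ℂ) • u j) (l + k) + ((k - l : ℤ) : ℂ) • orientedSum u (k + l) := by
    rw [add_comm l k, ← hs, ← orientedSum_add]
    congr 1
    ext1 j
    rw [← add_smul]
    congr 1
    push_cast
    ring
  rw [h1, h2] at h3
  have h4 : virQuad n (k + l) F = orientedSum u (k + l) := rfl
  rw [h4]
  rw [← sub_eq_zero] at h3 ⊢
  rw [← h3]
  module

theorem vir_commutator (n : ℕ) (k l : ℤ) (F : Series) :
    vir n k (vir n l F) - vir n l (vir n k F) = ((k - l : ℤ) : ℂ) • vir n (k + l) F := by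
  have hq : ∀ k F G, virQuad n k (F + G) = virQuad n k F + virQuad n k G := fun k F G => by
    simp only [virQuad, map_add, orientedSum_add]
  simp only [vir, virLinear_add, hq, smul_add, ← virLinear_commutator,
    ← virLinear_virQuad_commutator, virQuad_virQuad_comm n k l]
  abel


/-! ### The operators `L_k^{(n)}` in terms of modes -/

theorem coeff_formalSum {ι : Type} (G : ι → Series) (d : Time →₀ ℕ) :
    MvPowerSeries.coeff d (formalSum G) = ∑ᶠ i, MvPowerSeries.coeff d (G i) := rfl

theorem support_coeff_t_mul (G : ℕ+ → Series) (d : Time →₀ ℕ) :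
    (Function.support fun j : ℕ+ => MvPowerSeries.coeff d ((j : ℂ) • (t j * G j))) ⊆
      (d.support.toLeft : Set ℕ+) := by
  intro j hj
  by_contra hc
  refine hj ?_
  dsimp only
  rw [map_smul, t, coeff_X_mul_eq_zero (fun h => hc (by simpa using h)), smul_zero]

theorem support_coeff_s_mul (G : ℕ+ → Series) (d : Time →₀ ℕ) :
    (Function.support fun j : ℕ+ => MvPowerSeries.coeff d ((j : ℂ) • (s j * G j))) ⊆
      (d.support.toRight : Set ℕ+) := by
  intro j hj
  by_contra hc
  refine hj ?_
  dsimp only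
  rw [map_smul, s, coeff_X_mul_eq_zero (fun h => hc (by simpa using h)), smul_zero]

theorem timeSum_eq_formalSum (G : ℤ → Series) : timeSum G =
    formalSum (fun j : ℕ+ => (j : ℂ) • (t j * G j)) -
      formalSum (fun j : ℕ+ => (j : ℂ) • (s j * G (-j))) := by
  ext1 d
  rw [map_sub, coeff_formalSum, coeff_formalSum,
    finsum_eq_sum_of_support_subset _ (support_coeff_t_mul (fun j => G j) d),
    finsum_eq_sum_of_support_subset _ (support_coeff_s_mul (fun j => G (-j)) d),
    coeff_timeSum _ (Finset.toLeft_disjSum_toRight (u := d.support)).ge, Finset.sum_disjSum,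
    sub_eq_add_neg, ← Finset.sum_neg_distrib]
  congr 1
  refine Finset.sum_congr rfl fun j _ => ?_
  rw [map_smul, exponent, Sum.elim_inr, smul_eq_mul, ← neg_mul]
  push_cast
  rfl

/-- The mode index `k - j` changes sign at `j = k`. The ranges `j > k` and `j < k` give derivatives
of the two kinds, and `j = k` the zero mode, hence the multiplication term of `L_k`. -/
theorem formalSum_split (k : ℕ+) (H : ℕ+ → Series)
    (hH : ∀ d, (Function.support fun j => MvPowerSeries.coeff d (H j)).Finite) :
    formalSum H = formalSum (fun j => if k < j then H j else 0) + ∑ j ∈ Finset.Ico 1 k, H j + H k := by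
  ext1 d
  have hA : (Function.support fun j => MvPowerSeries.coeff d (H j)) ⊆
      ((hH d).toFinset ∪ Finset.Icc 1 k : Finset ℕ+) := fun j hj => by
    rw [Finset.coe_union, Set.Finite.coe_toFinset]
    exact Or.inl hj
  have hA' : (Function.support fun j => MvPowerSeries.coeff d (if k < j then H j else 0)) ⊆
      ((hH d).toFinset ∪ Finset.Icc 1 k : Finset ℕ+) := fun j hj => by
    refine hA ?_
    by_contra hc
    refine hj ?_
    simp only [Function.mem_support, not_not] at hc
    dsimp only
    split_ifs <;> simp [hc]
  rw [map_add, map_add, coeff_formalSum, coeff_formalSum, finsum_eq_sum_of_support_subset _ hA,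
    finsum_eq_sum_of_support_subset _ hA', map_sum, add_assoc,
    add_comm (∑ j ∈ Finset.Ico 1 k, _),
    ← Finset.sum_insert (f := fun j => MvPowerSeries.coeff d (H j)) (by simp : k ∉ Finset.Ico 1 k)]
  have hins : insert k (Finset.Ico 1 k) =
      ((hH d).toFinset ∪ Finset.Icc 1 k).filter (fun j => ¬k < j) := by
    ext j
    simp only [Finset.mem_insert, Finset.mem_Ico, Finset.mem_filter, Finset.mem_union,
      Finset.mem_Icc, not_lt, one_le, true_and]
    rw [← le_iff_eq_or_lt]
    tauto
  rw [hins, Finset.sum_filter, ← Finset.sum_add_distrib]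
  refine Finset.sum_congr rfl fun j _ => ?_
  by_cases hj : k < j <;> simp [hj]

theorem finite_support_coeff_t_mul (G : ℕ+ → Series) (d : Time →₀ ℕ) :
    (Function.support fun j : ℕ+ => MvPowerSeries.coeff d ((j : ℂ) • (t j * G j))).Finite :=
  (Finset.finite_toSet _).subset (support_coeff_t_mul G d)

theorem finite_support_coeff_s_mul (G : ℕ+ → Series) (d : Time →₀ ℕ) :
    (Function.support fun j : ℕ+ => MvPowerSeries.coeff d ((j : ℂ) • (s j * G j))).Finite :=
  (Finset.finite_toSet _).subset (support_coeff_s_mul G d)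

theorem pnat_sub_cast {j k : ℕ+} (hjk : j < k) : ((k - j : ℕ+) : ℤ) = k - j := by
  rw [PNat.sub_coe, if_pos hjk]
  have : (j : ℕ) < k := hjk
  omega

/-- The endpoint `j = k` is singled out because there a zero mode occurs, producing the term `n
∂_k`. -/
theorem sum_Ioc_eq_sum_Ico (k : ℕ+) (w : ℤ → Series) :
    ∑ j ∈ Finset.Ioc (0 : ℤ) k, w j = ∑ j ∈ Finset.Ico 1 k, w j + w k := by
  rw [add_comm, ← Finset.sum_insert (f := fun j : ℕ+ => w j) (by simp : k ∉ Finset.Ico 1 k)]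
  symm
  refine Finset.sum_nbij (fun j : ℕ+ => (j : ℤ)) ?_ ?_ ?_ fun _ _ => rfl
  · intro j hj
    have hj' : j ≤ k := by
      rcases Finset.mem_insert.1 hj with rfl | h
      · exact le_rfl
      · exact (Finset.mem_Ico.1 h).2.le
    have : (j : ℕ) ≤ k := hj'
    have := j.pos
    exact Finset.mem_Ioc.2 ⟨by omega, by omega⟩
  · intro a _ b _ hab
    have : (a : ℤ) = b := hab
    exact PNat.eq (by exact_mod_cast this)
  · intro j hj
    obtain ⟨h0, hk⟩ := Finset.mem_Ioc.1 hj
    lift j to ℕ using h0.le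
    have h1 : 0 < j := by exact_mod_cast h0
    obtain ⟨i, rfl⟩ : ∃ i : ℕ+, (i : ℕ) = j := ⟨⟨j, h1⟩, rfl⟩
    have h2 : i ≤ k := by
      rw [← PNat.coe_le_coe]
      exact_mod_cast hk
    refine ⟨i, ?_, rfl⟩
    rcases h2.eq_or_lt with h | h
    · exact Finset.mem_insert.2 (Or.inl h)
    · exact Finset.mem_insert.2 (Or.inr (Finset.mem_Ico.2 ⟨one_le, h⟩))

theorem virQuad_natCast (n : ℕ) (k : ℕ+) (F : Series) :
    virQuad n k F = ∑ j ∈ Finset.Ico 1 k, dt j (dt (k - j) F) + (n : ℂ) • dt k F := by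
  rw [virQuad, orientedSum, Finset.Ioc_eq_empty (show ¬(k : ℤ) < 0 by omega), Finset.sum_empty,
    sub_zero, sum_Ioc_eq_sum_Ico]
  congr 1
  · refine Finset.sum_congr rfl fun j hj => ?_
    rw [← pnat_sub_cast (Finset.mem_Ico.1 hj).2, mode_natCast, mode_natCast]
  · rw [sub_self, mode_zero, map_smul, mode_natCast]

theorem virQuad_neg_natCast (n : ℕ) (k : ℕ+) (F : Series) :
    virQuad n (-k) F = -∑ j ∈ Finset.Ico 1 k, ds j (ds (k - j) F) - (n : ℂ) • ds k F := by
  have hre : ∑ j ∈ Finset.Ioc (-(k : ℤ)) 0, mode n j (mode n (-k - j) F) =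
      ∑ j ∈ Finset.Ioc (0 : ℤ) k, mode n (j - k) (mode n (-j) F) := by
    refine (Finset.sum_nbij (fun j : ℤ => j - k) ?_ ?_ ?_ ?_).symm
    · intro j hj
      simp only [Finset.mem_Ioc] at *
      omega
    · intro a _ b _ hab
      simpa using hab
    · intro j hj
      refine ⟨j + k, ?_, by simp⟩
      simp only [Finset.coe_Ioc, Set.mem_Ioc] at *
      omega
    · intro j _
      congr 3
      ring
  rw [virQuad, orientedSum, Finset.Ioc_eq_empty (show ¬0 < -(k : ℤ) by omega), Finset.sum_empty,
    zero_sub, hre, sum_Ioc_eq_sum_Ico, neg_add, ← sub_eq_add_neg]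
  congr 2
  · refine Finset.sum_congr rfl fun j hj => ?_
    rw [mode_comm, show (j : ℤ) - k = -((k - j : ℕ+) : ℤ) by
      rw [pnat_sub_cast (Finset.mem_Ico.1 hj).2]; ring, mode_neg_natCast, mode_neg_natCast]
  · rw [sub_self, mode_zero, mode_neg_natCast]

theorem Lpos_eq_vir (n : ℕ) (k : ℕ+) (F : Series) : Lpos n k F = vir n k F := by
  rw [vir, virQuad_natCast, virLinear, timeSum_eq_formalSum,
    formalSum_split k _ (finite_support_coeff_s_mul (fun j => mode n (-j + k) F)), Lpos]
  have h1 : (fun j : ℕ+ => (j : ℂ) • (t j * mode n (j + k) F)) =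
      fun j : ℕ+ => (j : ℂ) • (t j * dt (j + k) F) := by
    ext1 j
    rw [← mode_natCast n, PNat.add_coe, Nat.cast_add]
  have h2 : (fun j : ℕ+ => if k < j then (j : ℂ) • (s j * mode n (-j + k) F) else 0) =
      fun j : ℕ+ => if k < j then (j : ℂ) • (s j * ds (j - k) F) else 0 := by
    ext1 j
    split_ifs with hj
    · rw [← mode_neg_natCast n, pnat_sub_cast hj, neg_sub, neg_add_eq_sub]
    · rfl
  have h3 : ∑ j ∈ Finset.Ico 1 k, (j : ℂ) • (s j * mode n (-j + k) F) =
      ∑ j ∈ Finset.Ico 1 k, (j : ℂ) • (s j * dt (k - j) F) := by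
    refine Finset.sum_congr rfl fun j hj => ?_
    rw [← mode_natCast n, pnat_sub_cast (Finset.mem_Ico.1 hj).2, neg_add_eq_sub]
  rw [h1, h2, h3, neg_add_cancel, mode_zero, mul_smul_comm, smul_smul, mul_comm (k : ℂ)]
  abel

theorem Lneg_eq_vir (n : ℕ) (k : ℕ+) (F : Series) : Lneg n k F = vir n (-k) F := by
  rw [vir, virQuad_neg_natCast, virLinear, timeSum_eq_formalSum,
    formalSum_split k _ (finite_support_coeff_t_mul (fun j => mode n (j + -k) F)), Lneg]
  have h1 : (fun j : ℕ+ => (j : ℂ) • (s j * mode n (-j + -k) F)) =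
      fun j : ℕ+ => (j : ℂ) • (s j * ds (j + k) F) := by
    ext1 j
    rw [← mode_neg_natCast n, PNat.add_coe, Nat.cast_add, neg_add]
  have h2 : (fun j : ℕ+ => if k < j then (j : ℂ) • (t j * mode n (j + -k) F) else 0) =
      fun j : ℕ+ => if k < j then (j : ℂ) • (t j * dt (j - k) F) else 0 := by
    ext1 j
    split_ifs with hj
    · rw [← mode_natCast n, pnat_sub_cast hj, sub_eq_add_neg]
    · rfl
  have h3 : ∑ j ∈ Finset.Ico 1 k, (j : ℂ) • (t j * mode n (j + -k) F) =
      ∑ j ∈ Finset.Ico 1 k, (j : ℂ) • (t j * ds (k - j) F) := by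
    refine Finset.sum_congr rfl fun j hj => ?_
    rw [← mode_neg_natCast n, pnat_sub_cast (Finset.mem_Ico.1 hj).2, neg_sub, sub_eq_add_neg]
  rw [h1, h2, h3, add_neg_cancel, mode_zero, mul_smul_comm, smul_smul, mul_comm (k : ℂ)]
  abel

theorem Lzero_eq_vir (n : ℕ) (F : Series) : Lzero F = vir n 0 F := by
  rw [vir, virQuad, orientedSum_zero, add_zero, virLinear, timeSum_eq_formalSum, Lzero]
  simp only [add_zero, mode_natCast, mode_neg_natCast]

theorem L_eq_vir (n : ℕ) (k : ℤ) (F : Series) : L n k F = vir n k F := by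
  rcases k with (_ | k) | k
  · exact Lzero_eq_vir n F
  · exact Lpos_eq_vir n k.succPNat F
  · exact Lneg_eq_vir n k.succPNat F

theorem L_commutator (n : ℕ) (k l : ℤ) (F : Series) :
    L n k (L n l F) - L n l (L n k F) = ((k - l : ℤ) : ℂ) • L n (k + l) F := by
  simp only [L_eq_vir, vir_commutator]


/-! ### Derivatives of determinants -/

section DetRule

variable {ι : Type*} [Fintype ι] [DecidableEq ι]

theorem det_updateRow_eq_sum {R : Type*} [CommRing R] (M : Matrix ι ι R) (r : ι) (v : ι → R) :
    (M.updateRow r v).det = ∑ c, v c * M.adjugate c r := by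
  rw [← Matrix.cramer_transpose_apply, Matrix.cramer_eq_adjugate_mulVec, Matrix.mulVec,
    dotProduct]
  refine Finset.sum_congr rfl fun c _ => ?_
  rw [← Matrix.adjugate_transpose, Matrix.transpose_apply, mul_comm]

theorem det_updateCol_eq_sum {R : Type*} [CommRing R] (M : Matrix ι ι R) (c : ι) (v : ι → R) :
    (M.updateCol c v).det = ∑ r, v r * M.adjugate c r := by
  rw [← Matrix.cramer_apply, Matrix.cramer_eq_adjugate_mulVec, Matrix.mulVec, dotProduct]
  exact Finset.sum_congr rfl fun r _ => mul_comm _ _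

/-- Both sides are the trace of `N` times the adjugate of `M`: the differential of a determinant can
be taken by rows or by columns. -/
theorem sum_det_updateRow_eq_sum_det_updateCol {R : Type*} [CommRing R] (M N : Matrix ι ι R) :
    ∑ r, (M.updateRow r (N r)).det = ∑ c, (M.updateCol c fun r => N r c).det := by
  simp only [det_updateRow_eq_sum, det_updateCol_eq_sum]
  exact Finset.sum_comm

theorem sum_det_updateRow {R : Type*} [CommRing R] (M N : Matrix ι ι R) :
    ∑ r, (M.updateRow r (N r)).det =
      ∑ σ : Equiv.Perm ι, Equiv.Perm.sign σ •
        ∑ i, N i (σ i) * ∏ j ∈ Finset.univ.erase i, M j (σ j) := by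
  simp only [Finset.smul_sum]
  rw [Finset.sum_comm]
  refine Finset.sum_congr rfl fun r _ => ?_
  rw [← Matrix.det_transpose, Matrix.det_apply]
  refine Finset.sum_congr rfl fun σ _ => ?_
  rw [← Finset.mul_prod_erase _ _ (Finset.mem_univ r)]
  congr 2
  · simp
  · refine Finset.prod_congr rfl fun j hj => ?_
    simp [Matrix.updateRow_ne (Finset.ne_of_mem_erase hj)]

/-- The Leibniz rule for determinants, for a relation `HD a a'` which expresses that `a'` is the
derivative of `a`. -/
theorem det_leibniz {A B : Type*} [CommRing A] [CommRing B] (ev : A →+* B) (HD : A → B → Prop)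
    (hone : HD 1 0) (hzero : HD 0 0) (hadd : ∀ {a a' b b'}, HD a a' → HD b b' → HD (a + b) (a' + b'))
    (hneg : ∀ {a a'}, HD a a' → HD (-a) (-a'))
    (hmul : ∀ {a a' b b'}, HD a a' → HD b b' → HD (a * b) (a' * ev b + ev a * b'))
    {M : Matrix ι ι A} {M' : Matrix ι ι B} (hM : ∀ i j, HD (M i j) (M' i j)) :
    HD M.det (∑ r, ((M.map ev).updateRow r (M' r)).det) := by
  have hprod : ∀ (σ : Equiv.Perm ι) (s : Finset ι), HD (∏ i ∈ s, M i (σ i))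
      (∑ i ∈ s, M' i (σ i) * ∏ j ∈ s.erase i, ev (M j (σ j))) := by
    intro σ s
    induction s using Finset.induction_on with
    | empty => simpa using hone
    | insert a s ha ih =>
      rw [Finset.prod_insert ha, Finset.sum_insert ha, Finset.erase_insert ha]
      have := hmul (hM a (σ a)) ih
      rw [map_prod, Finset.mul_sum] at this
      convert this using 2
      refine Finset.sum_congr rfl fun i hi => ?_
      have hia : a ≠ i := fun h => ha (h ▸ hi)
      rw [Finset.erase_insert_of_ne hia, Finset.prod_insert fun h => ha (Finset.mem_of_mem_erase h)]
      ring
  have hsum : ∀ (s : Finset (Equiv.Perm ι)), HD (∑ σ ∈ s, Equiv.Perm.sign σ • ∏ i, M i (σ i))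
      (∑ σ ∈ s, Equiv.Perm.sign σ •
        ∑ i, M' i (σ i) * ∏ j ∈ Finset.univ.erase i, ev (M j (σ j))) := by
    intro s
    induction s using Finset.induction_on with
    | empty => simpa using hzero
    | insert σ s hσ ih =>
      rw [Finset.sum_insert hσ, Finset.sum_insert hσ]
      refine hadd ?_ ih
      rcases Int.units_eq_one_or (Equiv.Perm.sign σ) with h | h <;> rw [h]
      · simpa using hprod σ Finset.univ
      · simpa using hneg (hprod σ Finset.univ)
  rw [sum_det_updateRow, ← Matrix.det_transpose, Matrix.det_apply]
  exact hsum Finset.univ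

theorem derivation_det {R : Type*} [CommRing R] [Algebra ℂ R] (δ : Derivation ℂ R R)
    (M : Matrix ι ι R) : δ M.det = ∑ r, (M.updateRow r fun c => δ (M r c)).det := by
  refine det_leibniz (RingHom.id R) (fun a a' => δ a = a') (by simp) (by simp) ?_ ?_ ?_
    (M' := Matrix.of fun r c => δ (M r c)) fun i j => rfl
  · rintro a _ b _ rfl rfl
    exact map_add δ a b
  · rintro a _ rfl
    exact map_neg δ a
  · rintro a _ b _ rfl rfl
    rw [Derivation.leibniz, smul_eq_mul, smul_eq_mul, RingHom.id_apply, RingHom.id_apply]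
    ring

end DetRule

/-! ### Shifted Toeplitz determinants -/

section Shift

variable {R : Type*} [CommRing R] {n : ℕ}

/-- The determinant with rows `m_{e_r - l}`. -/
def rowDet (m : ℤ → R) (e : Fin n → ℤ) : R :=
  (Matrix.of fun r l : Fin n => m (e r - ((l : ℕ) : ℤ))).det

/-- The indices `0, …, n - 1`. -/
def rowIdx (n : ℕ) (r : Fin n) : ℤ := ((r : ℕ) : ℤ)

theorem rowDet_eq_zero (m : ℤ → R) (e : Fin n → ℤ) {r r' : Fin n} (hne : r ≠ r')
    (he : e r = e r') : rowDet m e = 0 :=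
  Matrix.det_zero_of_row_eq hne (by ext l; simp [he])

theorem rowDet_swap (m : ℤ → R) (e : Fin n → ℤ) {r r' : Fin n} (hne : r ≠ r') :
    rowDet m (e ∘ Equiv.swap r r') = -rowDet m e := by
  have := Matrix.det_permute (Equiv.swap r r') (Matrix.of fun r l : Fin n => m (e r - ((l : ℕ) : ℤ)))
  rw [Equiv.Perm.sign_swap hne] at this
  simpa [rowDet, Matrix.submatrix] using this

theorem det_updateRow_toeplitz (m : ℤ → R) (e : Fin n → ℤ) (r : Fin n) (a : ℤ) :
    ((Matrix.of fun r l : Fin n => m (e r - ((l : ℕ) : ℤ))).updateRow r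
      fun l => m (a - ((l : ℕ) : ℤ))).det = rowDet m (Function.update e r a) := by
  rw [rowDet]
  congr 1
  ext i l
  by_cases hi : i = r
  · subst hi; simp
  · simp [hi]

theorem derivation_rowDet [Algebra ℂ R] (m : ℤ → R) (δ : Derivation ℂ R R) (a : ℤ)
    (hδ : ∀ i, δ (m i) = m (i + a)) (e : Fin n → ℤ) :
    δ (rowDet m e) = ∑ r, rowDet m (Function.update e r (e r + a)) := by
  rw [rowDet, derivation_det]
  refine Finset.sum_congr rfl fun r _ => ?_
  rw [← det_updateRow_toeplitz]
  congr 2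
  ext l
  rw [Matrix.of_apply, hδ]
  congr 1
  ring

/-- The Toeplitz determinant with the index of the row `r` raised by `k`. -/
def shiftDet (m : ℤ → R) (k : ℤ) (r : Fin n) : R :=
  rowDet m (Function.update (rowIdx n) r (rowIdx n r + k))

/-- A Toeplitz matrix is invariant under reflection in its antidiagonal, which turns column `c` into
row `n - 1 - c`. -/
theorem det_updateCol_eq_shiftDet (m : ℤ → R) (k : ℤ) (c : Fin n) :
    ((Matrix.of fun r l : Fin n => m (rowIdx n r - ((l : ℕ) : ℤ))).updateCol c
      fun r => m (rowIdx n r - ((c : ℕ) : ℤ) + k)).det = shiftDet m k c.rev := by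
  rw [← Matrix.det_transpose, ← Matrix.det_submatrix_equiv_self Fin.revPerm, shiftDet, rowDet]
  congr 1
  ext i l
  simp only [Matrix.submatrix_apply, Matrix.transpose_apply, Fin.revPerm_apply, Matrix.of_apply]
  by_cases hi : i = c.rev
  · subst hi
    rw [Fin.rev_rev, Matrix.updateCol_self, Function.update_self, rowIdx, rowIdx, Fin.val_rev,
      Fin.val_rev]
    congr 1
    omega
  · rw [Matrix.updateCol_ne fun h => hi (by rw [← h, Fin.rev_rev]), Function.update_of_ne hi,
      Matrix.of_apply, rowIdx, rowIdx, Fin.val_rev, Fin.val_rev]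
    congr 1
    omega

/-- The part `r + k` of the weight is constant on rows. The part `-l` is constant on columns; the
antidiagonal symmetry makes it `-(n - 1 - r)` on rows. -/
theorem sum_weighted_shift (m : ℤ → R) (k : ℤ) :
    ∑ r : Fin n, ((Matrix.of fun r l : Fin n => m (rowIdx n r - ((l : ℕ) : ℤ))).updateRow r
      fun l => ((rowIdx n r - ((l : ℕ) : ℤ) + k : ℤ) : R) * m (rowIdx n r - ((l : ℕ) : ℤ) + k)).det =
    ∑ r : Fin n, ((2 * rowIdx n r + k + 1 - n : ℤ) : R) * shiftDet m k r := by
  set M := Matrix.of fun r l : Fin n => m (rowIdx n r - ((l : ℕ) : ℤ)) with hM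
  have h1 : ∀ r : Fin n, (M.updateRow r fun l =>
      ((rowIdx n r - ((l : ℕ) : ℤ) + k : ℤ) : R) * m (rowIdx n r - ((l : ℕ) : ℤ) + k)).det =
      ((rowIdx n r + k : ℤ) : R) * shiftDet m k r - (M.updateRow r
        fun l => ((l : ℕ) : R) * m (rowIdx n r - ((l : ℕ) : ℤ) + k)).det := by
    intro r
    rw [shiftDet, ← det_updateRow_toeplitz, ← hM, det_updateRow_eq_sum, det_updateRow_eq_sum,
      det_updateRow_eq_sum, Finset.mul_sum, ← Finset.sum_sub_distrib]
    refine Finset.sum_congr rfl fun l _ => ?_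
    rw [show rowIdx n r + k - ((l : ℕ) : ℤ) = rowIdx n r - ((l : ℕ) : ℤ) + k by ring]
    push_cast
    ring
  have h2 : ∑ r : Fin n, (M.updateRow r
      fun l => ((l : ℕ) : R) * m (rowIdx n r - ((l : ℕ) : ℤ) + k)).det =
      ∑ r : Fin n, ((n - 1 - rowIdx n r : ℤ) : R) * shiftDet m k r := by
    refine (sum_det_updateRow_eq_sum_det_updateCol M (Matrix.of fun r l : Fin n =>
      ((l : ℕ) : R) * m (rowIdx n r - ((l : ℕ) : ℤ) + k))).trans ?_
    rw [← Equiv.sum_comp Fin.revPerm fun r : Fin n => ((n - 1 - rowIdx n r : ℤ) : R) * shiftDet m k r]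
    refine Finset.sum_congr rfl fun c _ => ?_
    rw [Fin.revPerm_apply, ← det_updateCol_eq_shiftDet, ← hM, det_updateCol_eq_sum,
      det_updateCol_eq_sum, Finset.mul_sum]
    refine Finset.sum_congr rfl fun r _ => ?_
    have : (n - 1 - rowIdx n c.rev : ℤ) = (c : ℕ) := by
      rw [rowIdx, Fin.val_rev]
      omega
    rw [this, Matrix.of_apply]
    push_cast
    ring
  simp only [h1, Finset.sum_sub_distrib, h2]
  rw [← Finset.sum_sub_distrib]
  refine Finset.sum_congr rfl fun r _ => ?_
  push_cast
  ring

/-- The interval `(b, a + k)` is symmetric under the antisymmetry of `F`, so its sum vanishes, and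
`F` is zero on `(a, b)`. Only `x = b` can survive. -/
theorem sum_antisymm_eq [Algebra ℂ R] {F : ℤ → R} {a b k : ℤ} (hab : a < b)
    (hanti : ∀ x, F (a + b + k - x) = -F x) (h0 : ∀ x, a < x → x < b → F x = 0) :
    ∑ x ∈ Finset.Ioo a (a + k), F x = if b < a + k then F b else 0 := by
  split_ifs with hb
  · have hU : Finset.Ioo a (a + k) =
        (Finset.Ioo a b ∪ {b}) ∪ Finset.Ioo b (a + k) := by
      ext x
      simp only [Finset.mem_Ioo, Finset.mem_union, Finset.mem_singleton]
      omega
    have hz : ∑ x ∈ Finset.Ioo b (a + k), F x = 0 := by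
      have hneg : ∑ x ∈ Finset.Ioo b (a + k), F x = -∑ x ∈ Finset.Ioo b (a + k), F x := by
        rw [← Finset.sum_neg_distrib]
        refine Finset.sum_nbij' (fun x => a + b + k - x) (fun x => a + b + k - x) ?_ ?_ ?_ ?_ ?_
        · intro x hx; simp only [Finset.mem_Ioo] at *; omega
        · intro x hx; simp only [Finset.mem_Ioo] at *; omega
        · intro x _; ring
        · intro x _; ring
        · intro x _; rw [hanti, neg_neg]
      have h2 : (2 : ℂ) • ∑ x ∈ Finset.Ioo b (a + k), F x = 0 := by
        rw [two_smul]
        nth_rewrite 1 [hneg]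
        exact neg_add_cancel _
      have := congrArg (fun y => (2 : ℂ)⁻¹ • y) h2
      simpa [smul_smul] using this
    rw [hU, Finset.sum_union, Finset.sum_union, hz, add_zero, Finset.sum_singleton,
      Finset.sum_eq_zero, zero_add]
    · intro x hx
      exact h0 x (Finset.mem_Ioo.1 hx).1 (Finset.mem_Ioo.1 hx).2
    · simp
    · rw [Finset.disjoint_left]
      intro x hx
      simp only [Finset.mem_Ioo, Finset.mem_union, Finset.mem_singleton] at *
      omega
  · refine Finset.sum_eq_zero fun x hx => ?_
    simp only [Finset.mem_Ioo] at hx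
    exact h0 x hx.1 (by omega)

/-- The Toeplitz determinant with two rows moved to the indices `a` and `b`. -/
def doubleDet (m : ℤ → R) (r r' : Fin n) (a b : ℤ) : R :=
  rowDet m (Function.update (Function.update (rowIdx n) r a) r' b)

theorem doubleDet_comm (m : ℤ → R) {r r' : Fin n} (hne : r ≠ r') (a b : ℤ) :
    doubleDet m r r' a b = doubleDet m r' r b a := by
  rw [doubleDet, doubleDet, Function.update_comm hne]

theorem doubleDet_swap (m : ℤ → R) {r r' : Fin n} (hne : r ≠ r') (a b : ℤ) :
    doubleDet m r r' a b = -doubleDet m r r' b a := by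
  rw [doubleDet, doubleDet, ← rowDet_swap _ _ hne]
  congr 1
  ext x
  rw [Function.comp_apply]
  by_cases hx : x = r
  · subst hx
    rw [Equiv.swap_apply_left, Function.update_self, Function.update_of_ne hne, Function.update_self]
  · by_cases hx' : x = r'
    · subst hx'
      rw [Equiv.swap_apply_right, Function.update_self, Function.update_of_ne hne,
        Function.update_self]
    · rw [Equiv.swap_apply_of_ne_of_ne hx hx', Function.update_of_ne hx', Function.update_of_ne hx,
        Function.update_of_ne hx', Function.update_of_ne hx]

/-- Exchanging the two moved rows changes the sign, and a row index strictly between `r` and `r'`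
repeats an existing row. The surviving position has row `r` at index `r'` and row `r'` at `r + k`,
an exchange of the singly shifted determinant. -/
theorem sum_doubleDet_of_lt [Algebra ℂ R] (m : ℤ → R) {k : ℤ} (hk : 0 < k) {r r' : Fin n}
    (hlt : r < r') : ∑ j ∈ Finset.Ioo 0 k,
      doubleDet m r r' (rowIdx n r + j) (rowIdx n r' + (k - j)) = -shiftDet m k r := by
  have hlt' : rowIdx n r < rowIdx n r' := by simpa [rowIdx] using hlt
  have hsum := sum_antisymm_eq (F := fun x => doubleDet m r r' x (rowIdx n r + rowIdx n r' + k - x))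
    (k := k) hlt' (fun x => by
      rw [sub_sub_cancel, doubleDet_swap m hlt.ne]) (fun x hx hx' => by
      have hn : x < n := hx'.trans (by simp [rowIdx])
      have h0 : 0 ≤ x := le_trans (by simp [rowIdx]) hx.le
      lift x to ℕ using h0
      have h1 : (⟨x, by exact_mod_cast hn⟩ : Fin n) ≠ r := by
        rintro rfl; simp [rowIdx] at hx
      have h2 : (⟨x, by exact_mod_cast hn⟩ : Fin n) ≠ r' := by
        rintro rfl; simp [rowIdx] at hx'
      refine rowDet_eq_zero m _ h1 ?_
      rw [Function.update_of_ne h2, Function.update_of_ne h1, Function.update_of_ne hlt.ne,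
        Function.update_self, rowIdx])
  have hre : ∑ j ∈ Finset.Ioo 0 k, doubleDet m r r' (rowIdx n r + j) (rowIdx n r' + (k - j)) =
      ∑ x ∈ Finset.Ioo (rowIdx n r) (rowIdx n r + k),
        doubleDet m r r' x (rowIdx n r + rowIdx n r' + k - x) := by
    refine Finset.sum_nbij' (fun j => rowIdx n r + j) (fun x => x - rowIdx n r) ?_ ?_ ?_ ?_ ?_
    · intro x hx; simp only [Finset.mem_Ioo] at *; omega
    · intro x hx; simp only [Finset.mem_Ioo] at *; omega
    · intro x _; ring
    · intro x _; ring
    · intro x _; congr 1; ring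
  rw [hre, hsum]
  split_ifs with hb
  · rw [doubleDet_swap m hlt.ne, doubleDet, shiftDet]
    congr 2
    rw [show rowIdx n r + rowIdx n r' + k - rowIdx n r' = rowIdx n r + k by ring]
    refine Function.update_eq_self_iff.2 ?_
    rw [Function.update_of_ne hlt.ne']
  -- If `r + k ≤ r'`, the shifted row coincides with another row, so the right side is zero as well.
  · have hn : rowIdx n r + k < n := lt_of_le_of_lt (not_lt.1 hb) (by simp [rowIdx])
    have h0 : 0 ≤ rowIdx n r + k := by simp only [rowIdx]; omega
    obtain ⟨x, hx⟩ := Int.eq_ofNat_of_zero_le h0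
    have hxn : x < n := by omega
    have h1 : (⟨x, hxn⟩ : Fin n) ≠ r := by
      rintro rfl
      simp only [rowIdx] at hx
      omega
    rw [shiftDet, rowDet_eq_zero m _ h1, neg_zero]
    rw [Function.update_of_ne h1, Function.update_self, hx, rowIdx]

theorem sum_doubleDet_of_gt [Algebra ℂ R] (m : ℤ → R) {k : ℤ} (hk : 0 < k) {r r' : Fin n}
    (hlt : r' < r) : ∑ j ∈ Finset.Ioo 0 k,
      doubleDet m r r' (rowIdx n r + j) (rowIdx n r' + (k - j)) = -shiftDet m k r' := by
  rw [← sum_doubleDet_of_lt m hk hlt]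
  refine Finset.sum_nbij' (fun j => k - j) (fun j => k - j) ?_ ?_ ?_ ?_ ?_
  · intro x hx; simp only [Finset.mem_Ioo] at *; omega
  · intro x hx; simp only [Finset.mem_Ioo] at *; omega
  · intro x _; ring
  · intro x _; ring
  · intro x _; rw [doubleDet_comm m hlt.ne', sub_sub_cancel]

/-- Equal rows occur `k - 1` times. Each of the `n - 1 - r` pairs of `r` with a larger row
contributes `-1` in either order, so the weight is `k - 1 - 2(n - 1 - r)`. -/
theorem sum_doubleDet [Algebra ℂ R] (m : ℤ → R) {k : ℤ} (hk : 0 < k) :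
    ∑ j ∈ Finset.Ioo 0 k, ∑ r : Fin n, ∑ r' : Fin n, rowDet m (Function.update
      (Function.update (rowIdx n) r (rowIdx n r + j)) r'
        (Function.update (rowIdx n) r (rowIdx n r + j) r' + (k - j))) =
    ∑ r : Fin n, ((2 * rowIdx n r + k + 1 - 2 * n : ℤ) : R) * shiftDet m k r := by
  have hterm : ∀ r r' : Fin n, ∑ j ∈ Finset.Ioo 0 k, rowDet m (Function.update
      (Function.update (rowIdx n) r (rowIdx n r + j)) r'
        (Function.update (rowIdx n) r (rowIdx n r + j) r' + (k - j))) =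
      (if r = r' then ((k - 1 : ℤ) : R) * shiftDet m k r else 0) +
      ((if r < r' then -shiftDet m k r else 0) + if r' < r then -shiftDet m k r' else 0) := by
    intro r r'
    rcases lt_trichotomy r r' with h | h | h
    · rw [if_neg h.ne, if_pos h, if_neg h.not_gt, zero_add, add_zero, ← sum_doubleDet_of_lt m hk h]
      refine Finset.sum_congr rfl fun j _ => ?_
      rw [doubleDet, Function.update_of_ne h.ne']
    · subst h
      rw [if_pos rfl, if_neg (lt_irrefl _), add_zero, add_zero]
      have : ∀ j, rowDet m (Function.update
          (Function.update (rowIdx n) r (rowIdx n r + j)) r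
          (Function.update (rowIdx n) r (rowIdx n r + j) r + (k - j))) = shiftDet m k r := by
        intro j
        rw [shiftDet, Function.update_idem, Function.update_self]
        congr 2
        ring
      simp only [this, Finset.sum_const, Int.card_Ioo, sub_zero, nsmul_eq_mul]
      congr 1
      have : (((k - 1).toNat : ℤ) : R) = ((k - 1 : ℤ) : R) := by rw [Int.toNat_of_nonneg (by omega)]
      simpa using this
    · rw [if_neg h.ne', if_neg h.not_gt, if_pos h, zero_add, zero_add, ← sum_doubleDet_of_gt m hk h]
      refine Finset.sum_congr rfl fun j _ => ?_
      rw [doubleDet, Function.update_of_ne h.ne]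
  rw [Finset.sum_comm]
  have hcomm : ∀ r : Fin n, ∑ j ∈ Finset.Ioo 0 k, ∑ r' : Fin n, rowDet m (Function.update
      (Function.update (rowIdx n) r (rowIdx n r + j)) r'
        (Function.update (rowIdx n) r (rowIdx n r + j) r' + (k - j))) =
      ∑ r' : Fin n, ∑ j ∈ Finset.Ioo 0 k, rowDet m (Function.update
      (Function.update (rowIdx n) r (rowIdx n r + j)) r'
        (Function.update (rowIdx n) r (rowIdx n r + j) r' + (k - j))) := fun r => Finset.sum_comm
  simp only [hcomm, hterm, Finset.sum_add_distrib]
  have hA : ∑ r : Fin n, ∑ r' : Fin n, (if r < r' then -shiftDet m k r else 0) =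
      ∑ r : Fin n, ((rowIdx n r + 1 - n : ℤ) : R) * shiftDet m k r := by
    refine Finset.sum_congr rfl fun r _ => ?_
    rw [← Finset.sum_filter, Finset.sum_const, nsmul_eq_mul]
    have : (Finset.univ.filter fun r' => r < r') = Finset.Ioi r := by ext; simp
    rw [this, Fin.card_Ioi, rowIdx]
    have hr := r.isLt
    have : (((n - 1 - (r : ℕ) : ℕ) : ℤ) : R) = ((n - 1 - ((r : ℕ) : ℤ) : ℤ) : R) := by
      congr 1
      omega
    rw [Int.cast_natCast] at this
    rw [this]
    push_cast
    ring
  have hB : ∑ r : Fin n, ∑ r' : Fin n, (if r' < r then -shiftDet m k r' else 0) =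
      ∑ r : Fin n, ((rowIdx n r + 1 - n : ℤ) : R) * shiftDet m k r := by
    rw [Finset.sum_comm, ← hA]
  rw [hA, hB]
  simp only [Finset.sum_ite_eq, Finset.mem_univ, if_true, ← Finset.sum_add_distrib]
  refine Finset.sum_congr rfl fun r _ => ?_
  push_cast
  ring

/-- The quadratic identity for derivations which shift the entries of a Toeplitz determinant. -/
theorem sum_weighted_shift_eq_derivation [Algebra ℂ R] (m : ℤ → R) (δ : ℕ+ → Derivation ℂ R R)
    (hδ : ∀ a i, δ a (m i) = m (i + a)) (k : ℕ+) :
    ∑ r : Fin n, ((Matrix.of fun r l : Fin n => m (rowIdx n r - ((l : ℕ) : ℤ))).updateRow r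
      fun l => ((rowIdx n r - ((l : ℕ) : ℤ) + k : ℤ) : R) *
        m (rowIdx n r - ((l : ℕ) : ℤ) + k)).det =
    ∑ j ∈ Finset.Ico 1 k, δ j (δ (k - j) (rowDet m (rowIdx n))) +
      (n : ℂ) • δ k (rowDet m (rowIdx n)) := by
  have hpos := k.pos
  have h1 : ∑ j ∈ Finset.Ico 1 k, δ j (δ (k - j) (rowDet m (rowIdx n))) =
      ∑ j ∈ Finset.Ioo (0 : ℤ) k, ∑ r : Fin n, ∑ r' : Fin n, rowDet m (Function.update
      (Function.update (rowIdx n) r (rowIdx n r + j)) r'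
        (Function.update (rowIdx n) r (rowIdx n r + j) r' + (k - j))) := by
    have hin : ∀ j ∈ Finset.Ico 1 k, ((k - j : ℕ+) : ℤ) ∈ Finset.Ioo (0 : ℤ) k := by
      intro j hj
      have h := pnat_sub_cast (Finset.mem_Ico.1 hj).2
      have h' := j.pos
      have h'' := (k - j).pos
      rw [Finset.mem_Ioo]
      omega
    -- The inner derivation, of index `k - j`, is the one that shifts the first row.
    refine Finset.sum_nbij (fun j : ℕ+ => ((k - j : ℕ+) : ℤ)) hin ?_ ?_ ?_
    · intro a ha b hb hab
      dsimp only at hab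
      rw [pnat_sub_cast (Finset.mem_Ico.1 ha).2, pnat_sub_cast (Finset.mem_Ico.1 hb).2] at hab
      exact PNat.eq (by omega)
    · intro x hx
      rw [Finset.coe_Ioo, Set.mem_Ioo] at hx
      obtain ⟨y, hy⟩ : ∃ y : ℕ+, (y : ℤ) = k - x :=
        ⟨⟨(k - x).toNat, by omega⟩, by simp only [PNat.mk_coe]; omega⟩
      have hyk : y < k := by
        rw [← PNat.coe_lt_coe]
        omega
      refine ⟨y, Finset.mem_coe.2 (Finset.mem_Ico.2 ⟨one_le, hyk⟩), ?_⟩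
      dsimp only
      rw [pnat_sub_cast hyk]
      omega
    · intro j hj
      rw [derivation_rowDet m (δ (k - j)) _ (hδ _), map_sum]
      refine Finset.sum_congr rfl fun r _ => ?_
      rw [derivation_rowDet m (δ j) _ (hδ _)]
      refine Finset.sum_congr rfl fun r' _ => ?_
      rw [show (k : ℤ) - ((k - j : ℕ+) : ℤ) = j by
        rw [pnat_sub_cast (Finset.mem_Ico.1 hj).2]; ring]
  -- The term `n δ_k` raises the weight `2r + k + 1 - 2n` to `2r + k + 1 - n`.
  rw [sum_weighted_shift, h1, sum_doubleDet m (by omega), derivation_rowDet m (δ k) _ (hδ k),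
    Finset.smul_sum, ← Finset.sum_add_distrib]
  refine Finset.sum_congr rfl fun r _ => ?_
  have : rowDet m (Function.update (rowIdx n) r (rowIdx n r + k)) = shiftDet m k r := rfl
  rw [this, Algebra.smul_def, map_natCast]
  push_cast
  ring

end Shift


/-! ### The action of the master symmetries on the tau-functions -/

theorem mul_timeSum (H : Series) (G : ℤ → Series) :
    H * timeSum G = timeSum fun j => H * G j := by
  ext1 d
  rw [MvPowerSeries.coeff_mul, coeff_timeSum _ subset_rfl]
  have h1 : ∀ p ∈ Finset.HasAntidiagonal.antidiagonal d, MvPowerSeries.coeff p.1 H *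
      MvPowerSeries.coeff p.2 (timeSum G) = ∑ i ∈ d.support, (exponent i : ℂ) *
      (MvPowerSeries.coeff p.1 H *
        MvPowerSeries.coeff p.2 (MvPowerSeries.X i * G (exponent i))) := by
    intro p hp
    have hle : p.2 ≤ d := (Finset.HasAntidiagonal.mem_antidiagonal.1 hp) ▸ le_add_self
    rw [coeff_timeSum G (Finsupp.support_mono hle), Finset.mul_sum]
    exact Finset.sum_congr rfl fun i _ => mul_left_comm _ _ _
  rw [Finset.sum_congr rfl h1, Finset.sum_comm]
  refine Finset.sum_congr rfl fun i _ => ?_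
  rw [mul_left_comm, MvPowerSeries.coeff_mul, Finset.mul_sum]

theorem det_updateRow_timeSum {n : ℕ} (M : Matrix (Fin n) (Fin n) Series) (r : Fin n)
    (G : Fin n → ℤ → Series) : (M.updateRow r fun l => timeSum (G l)).det =
      timeSum fun i => (M.updateRow r fun l => G l i).det := by
  simp only [det_updateRow_eq_sum]
  rw [timeSum_sum]
  refine Finset.sum_congr rfl fun l _ => ?_
  rw [mul_comm, mul_timeSum]
  simp only [mul_comm]

theorem det_updateRow_add_smul {n : ℕ} (M : Matrix (Fin n) (Fin n) Series) (r : Fin n)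
    (u v : Fin n → Series) : (M.updateRow r fun l => u l + v l).det =
      (M.updateRow r u).det + (M.updateRow r v).det :=
  Matrix.det_updateRow_add M r u v

theorem tau_eq_rowDet (n : ℕ) (μ : Moments) : tau n μ = rowDet (momentSeries μ) (rowIdx n) := rfl

theorem pderiv_momentSeries (μ : Moments) (j : ℤ) (i : Time) :
    MvPowerSeries.pderiv ℂ i (momentSeries μ j) = momentSeries μ (j + exponent i) := by
  rcases i with k | k
  · exact dt_momentSeries μ j k
  · exact (ds_momentSeries μ j k).trans (by rw [sub_eq_add_neg]; rfl)

/-- For `a = 0` the right side is `n` copies of the tau-function, which is why the zero mode must be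
the scalar `n`. -/
theorem mode_tau (n : ℕ) (μ : Moments) (a : ℤ) :
    mode n a (tau n μ) = ∑ r : Fin n, shiftDet (momentSeries μ) a r := by
  rcases eq_zero_or_exponent a with rfl | ⟨i, rfl⟩
  · rw [mode_zero]
    have : ∀ r : Fin n, shiftDet (momentSeries μ) 0 r = tau n μ := fun r => by
      rw [shiftDet, add_zero, Function.update_eq_self, tau_eq_rowDet]
    simp only [this, Finset.sum_const, Finset.card_univ, Fintype.card_fin]
    rw [Nat.cast_smul_eq_nsmul]
  · rw [mode_exponent, tau_eq_rowDet,
      derivation_rowDet _ _ (exponent i) fun j => pderiv_momentSeries μ j i]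
    rfl

/-- The matrix of the tau-function. -/
abbrev tauMatrix (n : ℕ) (μ : Moments) : Matrix (Fin n) (Fin n) Series :=
  Matrix.of fun r l : Fin n => momentSeries μ (rowIdx n r - ((l : ℕ) : ℤ))

/-- This is the nontrivial half of the tau-function identity: the part of `V_k` without explicit
times is the quadratic part of `L_k`. -/
theorem virQuad_tau (n : ℕ) (μ : Moments) (k : ℤ) :
    ∑ r : Fin n, ((tauMatrix n μ).updateRow r fun l =>
      ((rowIdx n r - ((l : ℕ) : ℤ) + k : ℤ) : Series) *
        momentSeries μ (rowIdx n r - ((l : ℕ) : ℤ) + k)).det = virQuad n k (tau n μ) := by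
  have hcases : k = 0 ∨ (∃ K : ℕ+, k = K) ∨ ∃ K : ℕ+, k = -(K : ℤ) := by
    rcases eq_zero_or_exponent k with h | ⟨i | i, h⟩
    exacts [Or.inl h, Or.inr (Or.inl ⟨i, h⟩), Or.inr (Or.inr ⟨i, h⟩)]
  rcases hcases with rfl | ⟨K, rfl⟩ | ⟨K, rfl⟩
  · rw [sum_weighted_shift, virQuad, orientedSum_zero]
    have h0 : ∀ r : Fin n, shiftDet (momentSeries μ) 0 r = tau n μ := fun r => by
      rw [shiftDet, add_zero, Function.update_eq_self, tau_eq_rowDet]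
    simp only [h0, ← Finset.sum_mul]
    -- For `k = 0` the weights `2r + 1 - n` are odd under `r ↦ n - 1 - r`, so they sum to zero.
    have hrev : ∑ r : Fin n, ((2 * rowIdx n r + 0 + 1 - n : ℤ) : Series) =
        -∑ r : Fin n, ((2 * rowIdx n r + 0 + 1 - n : ℤ) : Series) := by
      refine (Equiv.sum_comp Fin.revPerm _).symm.trans ?_
      rw [← Finset.sum_neg_distrib]
      refine Finset.sum_congr rfl fun r _ => ?_
      rw [← Int.cast_neg]
      congr 1
      have := r.isLt
      simp only [Fin.revPerm_apply, rowIdx, Fin.val_rev]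
      omega
    have hz := congrArg (fun y => (2 : ℂ)⁻¹ • y)
      ((two_smul ℂ _).trans (eq_neg_iff_add_eq_zero.1 hrev))
    rw [smul_smul, inv_mul_cancel₀ (two_ne_zero), one_smul, smul_zero] at hz
    rw [hz, zero_mul]
  · rw [virQuad_natCast, tau_eq_rowDet]
    exact sum_weighted_shift_eq_derivation (momentSeries μ)
      (fun a => MvPowerSeries.pderiv ℂ (Sum.inl a)) (fun a i => dt_momentSeries μ i a) K
  · rw [virQuad_neg_natCast, ← neg_add']
    -- Negative `k` reduces to positive `k` for the entries of index `-j`, that is, for the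
    -- transposed matrix. Rows become columns and the weight changes sign.
    have key := sum_weighted_shift_eq_derivation (n := n) (fun j => momentSeries μ (-j))
      (fun a => MvPowerSeries.pderiv ℂ (Sum.inr a)) (fun a i =>
        (ds_momentSeries μ (-i) a).trans (by rw [neg_add, sub_eq_add_neg])) K
    have htr : (Matrix.of fun r l : Fin n => momentSeries μ (-(rowIdx n r - ((l : ℕ) : ℤ)))) =
        (tauMatrix n μ).transpose := by
      ext1 r l
      rw [Matrix.transpose_apply, Matrix.of_apply, neg_sub]
      rfl
    have hdet : rowDet (fun j => momentSeries μ (-j)) (rowIdx n) = tau n μ := by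
      rw [rowDet, htr, Matrix.det_transpose]
      rfl
    rw [htr, hdet] at key
    change _ = -(∑ j ∈ Finset.Ico 1 K, MvPowerSeries.pderiv ℂ (Sum.inr j)
      (MvPowerSeries.pderiv ℂ (Sum.inr (K - j)) (tau n μ)) +
      (n : ℂ) • MvPowerSeries.pderiv ℂ (Sum.inr K) (tau n μ))
    rw [← key]
    refine (sum_det_updateRow_eq_sum_det_updateCol _ (Matrix.of fun r l : Fin n =>
      ((rowIdx n r - ((l : ℕ) : ℤ) + -K : ℤ) : Series) *
        momentSeries μ (rowIdx n r - ((l : ℕ) : ℤ) + -K))).trans ?_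
    rw [← Finset.sum_neg_distrib]
    refine Finset.sum_congr rfl fun c _ => ?_
    rw [Matrix.updateRow_transpose, Matrix.det_transpose, det_updateCol_eq_sum,
      det_updateCol_eq_sum, ← Finset.sum_neg_distrib]
    refine Finset.sum_congr rfl fun r _ => ?_
    rw [Matrix.of_apply, ← neg_mul, ← neg_mul, ← Int.cast_neg]
    have h1 : -(rowIdx n c - ((r : ℕ) : ℤ) + K) = rowIdx n r - ((c : ℕ) : ℤ) + -K := by
      rw [rowIdx, rowIdx]
      ring
    rw [h1]

/-- At the monomial `d` the moment index exceeds `j` by the `t`-degree minus the `s`-degree. This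
excess is the sum of `exponent i * d i`, which is the eigenvalue produced by the time-weighted sum.
-/
theorem momentSeries_masterField (k : ℤ) (μ : Moments) (j : ℤ) :
    momentSeries (masterField k μ) j = ((j + k : ℤ) : Series) * momentSeries μ (j + k) +
      timeSum fun i => momentSeries μ (j + (i + k)) := by
  ext1 d
  rw [map_add, ← zsmul_eq_mul, map_zsmul, coeff_timeSum _ subset_rfl, coeff_momentSeries,
    coeff_momentSeries]
  have h1 : ∀ i ∈ d.support, (exponent i : ℂ) * MvPowerSeries.coeff d
      (MvPowerSeries.X i * momentSeries μ (j + (exponent i + k))) =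
      ((exponent i * d i : ℤ) : ℂ) * MvPowerSeries.coeff d (momentSeries μ (j + k)) := by
    intro i hi
    have hi' : Finsupp.single i 1 ≤ d := by
      rw [Finsupp.single_le_iff]
      exact Nat.one_le_iff_ne_zero.2 (Finsupp.mem_support_iff.1 hi)
    rw [MvPowerSeries.X_def, MvPowerSeries.coeff_monomial_mul, if_pos hi', one_mul,
      show j + (exponent i + k) = (j + k) + exponent i by ring, ← pderiv_momentSeries,
      MvPowerSeries.coeff_pderiv, tsub_add_cancel_of_le hi', Finsupp.tsub_apply,
      Finsupp.single_eq_same, Nat.cast_sub (Nat.one_le_iff_ne_zero.2 (Finsupp.mem_support_iff.1 hi))]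
    push_cast
    ring
  rw [Finset.sum_congr rfl h1, ← Finset.sum_mul, ← Int.cast_sum, coeff_momentSeries]
  have h2 : ∑ i ∈ d.support, exponent i * (d i : ℤ) = tDegree d - sDegree d := by
    rw [tDegree, sDegree, Finsupp.weight_apply, Finsupp.weight_apply, Finsupp.sum, Finsupp.sum]
    push_cast
    rw [← Finset.sum_sub_distrib]
    refine Finset.sum_congr rfl fun i _ => ?_
    rcases i with i | i <;> simp [exponent, mul_comm]
  rw [h2, masterField, zsmul_eq_mul,
    show j + (tDegree d : ℤ) - (sDegree d : ℤ) + k = j + k + tDegree d - sDegree d by ring]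
  push_cast
  ring

theorem sum_det_masterField (n : ℕ) (k : ℤ) (μ : Moments) :
    ∑ r : Fin n, ((tauMatrix n μ).updateRow r fun l =>
      momentSeries (masterField k μ) (rowIdx n r - ((l : ℕ) : ℤ))).det = L n k (tau n μ) := by
  simp only [momentSeries_masterField, det_updateRow_add_smul, Finset.sum_add_distrib]
  rw [virQuad_tau, L_eq_vir, vir, add_comm]
  congr 1
  rw [virLinear]
  simp only [mode_tau, det_updateRow_timeSum]
  rw [timeSum_sum]
  refine Finset.sum_congr rfl fun r _ => ?_
  congr 1
  ext1 i
  rw [shiftDet, ← det_updateRow_toeplitz]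
  congr 2
  ext1 l
  congr 1
  ring

/-- A coefficient of a product is a finite sum of products of coefficients, so coefficientwise
differentiation obeys the Leibniz rule required by `det_leibniz`. -/
theorem hasDerivAt_coeff_tau {γ : ℝ → Moments} {ν : Moments}
    (hγ : ∀ j, HasDerivAt (fun u => γ u j) (ν j) 0) (n : ℕ) (d : Time →₀ ℕ) :
    HasDerivAt (fun u => MvPowerSeries.coeff d (tau n (γ u))) (MvPowerSeries.coeff d
      (∑ r : Fin n, ((tauMatrix n (γ 0)).updateRow r fun l =>
        momentSeries ν (rowIdx n r - ((l : ℕ) : ℤ))).det)) 0 := by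
  have key := det_leibniz (A := ℝ → Series) (B := Series) (Pi.evalRingHom _ 0)
    (fun a a' => ∀ d, HasDerivAt (fun u => MvPowerSeries.coeff d (a u))
      (MvPowerSeries.coeff d a') 0)
    (fun d => by simpa using hasDerivAt_const (0 : ℝ) (MvPowerSeries.coeff d (1 : Series)))
    (fun d => by simpa using hasDerivAt_const (0 : ℝ) (0 : ℂ))
    (fun ha hb d => by simpa only [Pi.add_apply, map_add] using (ha d).fun_add (hb d))
    (fun ha d => by simpa only [Pi.neg_apply, map_neg] using (ha d).fun_neg)
    (fun {a a' b b'} ha hb d => by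
      simp only [Pi.mul_apply, map_add, MvPowerSeries.coeff_mul, Pi.evalRingHom_apply,
        ← Finset.sum_add_distrib]
      exact HasDerivAt.fun_sum fun p _ => (ha p.1).fun_mul (hb p.2))
    (M := Matrix.of fun r l : Fin n => fun u => momentSeries (γ u) (rowIdx n r - ((l : ℕ) : ℤ)))
    (M' := Matrix.of fun r l : Fin n => momentSeries ν (rowIdx n r - ((l : ℕ) : ℤ)))
    (fun r l d => by
      simp only [Matrix.of_apply, coeff_momentSeries]
      exact (hγ _).mul_const _) d
  have hu : ∀ u, tau n (γ u) = (Matrix.of fun r l : Fin n => fun u =>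
      momentSeries (γ u) (rowIdx n r - ((l : ℕ) : ℤ))).det u := fun u => by
    have := RingHom.map_det (Pi.evalRingHom (fun _ : ℝ => Series) u) (Matrix.of fun r l : Fin n =>
      fun u => momentSeries (γ u) (rowIdx n r - ((l : ℕ) : ℤ)))
    exact this.symm
  simp only [hu]
  exact key

theorem hasLieDerivAt_coeff_tau (n : ℕ) (k : ℤ) (μ : Moments) (d : Time →₀ ℕ) :
    HasLieDerivAt (masterField k) (fun ν => MvPowerSeries.coeff d (tau n ν)) μ
      (MvPowerSeries.coeff d (L n k (tau n μ))) := by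
  rintro γ rfl hγ
  rw [← sum_det_masterField]
  exact hasDerivAt_coeff_tau hγ n d

/-- The derivative of a Plücker coordinate in the direction `X`. -/
def pluckerDeriv (X : VField) {n : ℕ} (i j : Fin n ↪o ℕ) (μ : Moments) : ℂ :=
  ∑ r : Fin n, ((Matrix.of fun k l : Fin n => μ (((i k : ℕ) : ℤ) - ((j l : ℕ) : ℤ))).updateRow r
    fun l => X μ (((i r : ℕ) : ℤ) - ((j l : ℕ) : ℤ))).det

theorem hasLieDerivAt_plucker (X : VField) {n : ℕ} (i j : Fin n ↪o ℕ) (μ : Moments) :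
    HasLieDerivAt X (plucker i j) μ (pluckerDeriv X i j μ) := by
  rintro γ rfl hγ
  have key := det_leibniz (A := ℝ → ℂ) (B := ℂ) (Pi.evalRingHom _ 0)
    (fun a a' => HasDerivAt a a' 0)
    (hasDerivAt_const (0 : ℝ) (1 : ℂ)) (hasDerivAt_const (0 : ℝ) (0 : ℂ))
    (fun ha hb => ha.add hb) (fun ha => ha.neg) (fun ha hb => ha.mul hb)
    (M := Matrix.of fun r l : Fin n => fun u => γ u (((i r : ℕ) : ℤ) - ((j l : ℕ) : ℤ)))
    (M' := Matrix.of fun r l : Fin n => X (γ 0) (((i r : ℕ) : ℤ) - ((j l : ℕ) : ℤ)))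
    (fun r l => hγ _)
  have hu : (fun u => plucker i j (γ u)) = (Matrix.of fun r l : Fin n => fun u =>
      γ u (((i r : ℕ) : ℤ) - ((j l : ℕ) : ℤ))).det := by
    ext1 u
    exact (RingHom.map_det (Pi.evalRingHom (fun _ : ℝ => ℂ) u) (Matrix.of fun r l : Fin n =>
      fun u => γ u (((i r : ℕ) : ℤ) - ((j l : ℕ) : ℤ)))).symm
  rw [hu]
  exact key


/-! ### The Cauchy–Binet formula -/

theorem orderEmb_perm_injective {n : ℕ} {α : Type*} [LinearOrder α] :
    Function.Injective fun p : (Fin n ↪o α) × Equiv.Perm (Fin n) => fun a => p.1 (p.2 a) := by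
  rintro ⟨i, σ⟩ ⟨j, τ⟩ h
  have hij : i = j := by
    have hr : Set.range i = Set.range j := by
      have h1 : Set.range (i ∘ σ) = Set.range (j ∘ τ) := congrArg Set.range h
      rwa [σ.surjective.range_comp, τ.surjective.range_comp] at h1
    exact DFunLike.coe_injective ((i.strictMono.range_inj j.strictMono).1 hr)
  subst hij
  have : σ = τ := Equiv.ext fun a => i.injective (congrFun h a)
  rw [this]

theorem exists_orderEmb_perm {n : ℕ} {α : Type*} [LinearOrder α] {φ : Fin n → α}
    (hφ : Function.Injective φ) :
    ∃ p : (Fin n ↪o α) × Equiv.Perm (Fin n), (fun a => p.1 (p.2 a)) = φ := by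
  have hs : StrictMono (φ ∘ Tuple.sort φ) :=
    (Tuple.monotone_sort φ).strictMono_of_injective (hφ.comp (Tuple.sort φ).injective)
  refine ⟨(OrderEmbedding.ofStrictMono _ hs, (Tuple.sort φ).symm), ?_⟩
  ext1 a
  simp

/-- Expand over all maps of column indices. Non-injective maps give a repeated row; injective ones
factor uniquely as a permutation followed by an increasing map. -/
theorem det_mul_eq_sum {R : Type*} [CommRing R] {n N : ℕ} (A : Matrix (Fin n) (Fin N) R)
    (B : Matrix (Fin N) (Fin n) R) : (A * B).det =
      ∑ i : Fin n ↪o Fin N, (A.submatrix id i).det * (B.submatrix i id).det := by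
  have h1 : (A * B).det = ∑ φ : Fin n → Fin N, (∏ a, A a (φ a)) * (B.submatrix φ id).det := by
    rw [← Matrix.det_transpose, Matrix.det_apply']
    simp only [Matrix.transpose_apply, Matrix.mul_apply, Finset.prod_univ_sum,
      Fintype.piFinset_univ, Finset.mul_sum]
    rw [Finset.sum_comm]
    refine Finset.sum_congr rfl fun φ _ => ?_
    rw [← Matrix.det_transpose, Matrix.det_apply', Finset.mul_sum]
    refine Finset.sum_congr rfl fun σ _ => ?_
    rw [Finset.prod_mul_distrib]
    simp only [Matrix.transpose_apply, Matrix.submatrix_apply, id]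
    ring
  have h2 : ∀ φ : Fin n → Fin N, ¬Function.Injective φ → (B.submatrix φ id).det = 0 := by
    intro φ hφ
    obtain ⟨a, b, hab, hne⟩ := Function.not_injective_iff.1 hφ
    exact Matrix.det_zero_of_row_eq hne (by ext c; simp [hab])
  rw [h1, ← Finset.sum_of_injOn (s := (Finset.univ : Finset ((Fin n ↪o Fin N) × Equiv.Perm (Fin n))))
    (f := fun p => (∏ a, A a (p.1 (p.2 a))) * (B.submatrix (fun a => p.1 (p.2 a)) id).det)
    (fun p a => p.1 (p.2 a)) orderEmb_perm_injective.injOn (fun _ _ => Finset.mem_coe.2 (Finset.mem_univ _)) _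
    (fun _ _ => rfl)]
  · rw [Fintype.sum_prod_type]
    refine Finset.sum_congr rfl fun i _ => ?_
    rw [← Matrix.det_transpose (A.submatrix id i), Matrix.det_apply, Finset.sum_mul]
    refine Finset.sum_congr rfl fun σ _ => ?_
    have := Matrix.det_permute σ (B.submatrix i id)
    rw [Matrix.submatrix_submatrix] at this
    change _ * (B.submatrix (i ∘ σ) id).det = _
    rw [show (id ∘ id : Fin n → Fin n) = id from rfl] at this
    rw [this, mul_left_comm, ← mul_assoc]
    simp [Units.smul_def]
  · intro φ _ hφ
    rw [h2 φ fun hinj => hφ ?_, mul_zero]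
    obtain ⟨p, hp⟩ := exists_orderEmb_perm hinj
    exact ⟨p, Finset.mem_coe.2 (Finset.mem_univ _), hp⟩

/-! ### The Plücker expansion of the tau-functions -/

/-- Reversing rows and columns together absorbs the offsets of the partition. -/
theorem schur_eq {n : ℕ} (x : ℕ+ → Series) (i : Fin n ↪o ℕ) : schur x i =
    (Matrix.of fun a b : Fin n => elemSchur x (((i a : ℕ) : ℤ) - ((b : ℕ) : ℤ))).det := by
  rw [schur, ← Matrix.det_submatrix_equiv_self Fin.revPerm]
  congr 1
  ext1 a b
  simp only [Matrix.submatrix_apply, Matrix.of_apply, Fin.revPerm_apply, Fin.rev_rev]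
  congr 1
  have := a.isLt
  have := b.isLt
  rw [Fin.val_rev, Fin.val_rev]
  omega

theorem coeff_elemSchur_t_mul {m : ℤ} {d : Time →₀ ℕ} (hm : (tDegree d : ℤ) < m) (F : Series) :
    MvPowerSeries.coeff d (elemSchur t m * F) = 0 := by
  rw [MvPowerSeries.coeff_mul]
  refine Finset.sum_eq_zero fun p hp => ?_
  have hle : tDegree p.1 ≤ tDegree d := by
    rw [← Finset.HasAntidiagonal.mem_antidiagonal.1 hp, map_add]
    exact le_self_add
  have := coeff_elemSchur_mul m 0 p.1
  rw [elemSchur_zero, mul_one, if_neg (by omega)] at this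
  rw [this, zero_mul]

theorem coeff_elemSchur_s_mul {m : ℤ} {d : Time →₀ ℕ} (hm : (sDegree d : ℤ) < m) (F : Series) :
    MvPowerSeries.coeff d (elemSchur s m * F) = 0 := by
  rw [MvPowerSeries.coeff_mul]
  refine Finset.sum_eq_zero fun p hp => ?_
  have hle : sDegree p.1 ≤ sDegree d := by
    rw [← Finset.HasAntidiagonal.mem_antidiagonal.1 hp, map_add]
    exact le_self_add
  have := coeff_elemSchur_mul 0 m p.1
  rw [elemSchur_zero, one_mul, if_neg (by omega)] at this
  rw [this, zero_mul]

/-- All Schur indices in row `a` exceed `D`; expanding along that row, every term vanishes at `d`.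
-/
theorem coeff_schur_mul {n : ℕ} {x : ℕ+ → Series} {D : ℕ} {d : Time →₀ ℕ}
    (hx : ∀ (m : ℤ) F, (D : ℤ) < m → MvPowerSeries.coeff d (elemSchur x m * F) = 0)
    {i : Fin n ↪o ℕ} {a : Fin n} (ha : D + n ≤ i a) (F : Series) :
    MvPowerSeries.coeff d (schur x i * F) = 0 := by
  rw [schur_eq]
  set M := Matrix.of fun a b : Fin n => elemSchur x (((i a : ℕ) : ℤ) - ((b : ℕ) : ℤ)) with hM
  rw [← Matrix.updateRow_eq_self M a, det_updateRow_eq_sum, Finset.sum_mul, map_sum]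
  refine Finset.sum_eq_zero fun b _ => ?_
  rw [mul_assoc, hM, Matrix.of_apply]
  refine hx _ _ ?_
  have := b.isLt
  omega

/-- A bound for the indices which contribute to the coefficient `d`. -/
def indexBound (n : ℕ) (d : Time →₀ ℕ) : ℕ := tDegree d + sDegree d + n

theorem lt_indexBound {n : ℕ} {d : Time →₀ ℕ} {i j : Fin n ↪o ℕ}
    (hij : MvPowerSeries.coeff d (schur t i * schur s j) ≠ 0) (a : Fin n) :
    i a < indexBound n d ∧ j a < indexBound n d := by
  constructor
  · by_contra hc
    refine hij (coeff_schur_mul (D := tDegree d) (fun m F hm => coeff_elemSchur_t_mul hm F)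
      (a := a) ?_ _)
    rw [indexBound] at hc
    omega
  · by_contra hc
    rw [mul_comm] at hij
    refine hij (coeff_schur_mul (D := sDegree d) (fun m F hm => coeff_elemSchur_s_mul hm F)
      (a := a) ?_ _)
    rw [indexBound] at hc
    omega

/-- The order embeddings into `Fin N`, as order embeddings into `ℕ`. -/
def liftEmb {n : ℕ} (N : ℕ) (q : (Fin n ↪o Fin N) × (Fin n ↪o Fin N)) :
    (Fin n ↪o ℕ) × (Fin n ↪o ℕ) :=
  (q.1.trans (Fin.valOrderEmb N), q.2.trans (Fin.valOrderEmb N))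

theorem liftEmb_injective {n : ℕ} (N : ℕ) : Function.Injective (liftEmb (n := n) N) := by
  rintro ⟨i, j⟩ ⟨i', j'⟩ h
  obtain ⟨h1, h2⟩ := Prod.ext_iff.1 h
  have e1 : i = i' := RelEmbedding.ext fun a => Fin.ext (congrArg (fun e => e a) h1)
  have e2 : j = j' := RelEmbedding.ext fun a => Fin.ext (congrArg (fun e => e a) h2)
  rw [e1, e2]

theorem exists_lift {n N : ℕ} (i : Fin n ↪o ℕ) (hi : ∀ a, i a < N) :
    ∃ i' : Fin n ↪o Fin N, i'.trans (Fin.valOrderEmb N) = i :=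
  ⟨OrderEmbedding.ofStrictMono (fun a => ⟨i a, hi a⟩) fun _ _ h => i.strictMono h,
    RelEmbedding.ext fun _ => rfl⟩

theorem mem_range_liftEmb {n N : ℕ} {d : Time →₀ ℕ} (hN : indexBound n d ≤ N)
    {q : (Fin n ↪o ℕ) × (Fin n ↪o ℕ)}
    (hq : MvPowerSeries.coeff d (schur t q.1 * schur s q.2) ≠ 0) : q ∈ Set.range (liftEmb N) := by
  obtain ⟨i, hi⟩ := exists_lift q.1 fun a => (lt_indexBound hq a).1.trans_le hN
  obtain ⟨j, hj⟩ := exists_lift q.2 fun a => (lt_indexBound hq a).2.trans_le hN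
  exact ⟨(i, j), Prod.ext hi hj⟩

theorem finite_support_schur (n : ℕ) (d : Time →₀ ℕ) :
    {q : (Fin n ↪o ℕ) × (Fin n ↪o ℕ) |
      MvPowerSeries.coeff d (schur t q.1 * schur s q.2) ≠ 0}.Finite :=
  (Set.finite_range (liftEmb (indexBound n d))).subset fun _ hq => mem_range_liftEmb le_rfl hq

/-- The truncation of the matrix of the tau-function. -/
def tauTrunc (n : ℕ) (μ : Moments) (N : ℕ) : Matrix (Fin n) (Fin n) Series :=
  (Matrix.of fun (k : Fin n) (a : Fin N) => elemSchur t (((a : ℕ) : ℤ) - ((k : ℕ) : ℤ))) *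
    ((Matrix.of fun a b : Fin N =>
      algebraMap ℂ Series (μ (((a : ℕ) : ℤ) - ((b : ℕ) : ℤ)))) *
      Matrix.of fun (b : Fin N) (l : Fin n) => elemSchur s (((b : ℕ) : ℤ) - ((l : ℕ) : ℤ)))

theorem det_tauTrunc (n : ℕ) (μ : Moments) (N : ℕ) : (tauTrunc n μ N).det =
    ∑ q : (Fin n ↪o Fin N) × (Fin n ↪o Fin N), plucker (liftEmb N q).1 (liftEmb N q).2 μ •
      (schur t (liftEmb N q).1 * schur s (liftEmb N q).2) := by
  rw [tauTrunc, det_mul_eq_sum, Fintype.sum_prod_type]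
  refine Finset.sum_congr rfl fun i _ => ?_
  rw [← Matrix.submatrix_mul_equiv _ _ i (Equiv.refl (Fin N)) id]
  rw [det_mul_eq_sum, Finset.mul_sum]
  refine Finset.sum_congr rfl fun j _ => ?_
  have h1 : (Matrix.submatrix (Matrix.of fun (k : Fin n) (a : Fin N) =>
      elemSchur t (((a : ℕ) : ℤ) - ((k : ℕ) : ℤ))) id i).det = schur t (liftEmb N (i, j)).1 := by
    rw [schur_eq, ← Matrix.det_transpose]
    rfl
  have h2 : (Matrix.submatrix (Matrix.of fun (b : Fin N) (l : Fin n) =>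
      elemSchur s (((b : ℕ) : ℤ) - ((l : ℕ) : ℤ))) j id).det = schur s (liftEmb N (i, j)).2 := by
    rw [schur_eq]
    rfl
  have h3 : (Matrix.submatrix (Matrix.of fun a b : Fin N =>
      algebraMap ℂ Series (μ (((a : ℕ) : ℤ) - ((b : ℕ) : ℤ)))) i j).det =
      algebraMap ℂ Series (plucker (liftEmb N (i, j)).1 (liftEmb N (i, j)).2 μ) := by
    rw [plucker, RingHom.map_det]
    rfl
  rw [Algebra.smul_def, ← h1, ← h2, ← h3]
  simp only [Matrix.submatrix_submatrix, Equiv.coe_refl, Function.comp_id, Function.id_comp]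
  ring

theorem coeff_tauTrunc (n : ℕ) (μ : Moments) {N : ℕ} {d : Time →₀ ℕ} (hN : indexBound n d ≤ N)
    (k l : Fin n) : MvPowerSeries.coeff d (tauTrunc n μ N k l) =
      MvPowerSeries.coeff d (momentSeries μ (((k : ℕ) : ℤ) - ((l : ℕ) : ℤ))) := by
  have hk := k.isLt
  have hl := l.isLt
  rw [indexBound] at hN
  rw [coeff_momentSeries, tauTrunc, Matrix.mul_apply, map_sum,
    -- Homogeneity in `t` fixes the first summation index, and then homogeneity in `s` fixes the
    -- second.
    Finset.sum_eq_single (⟨tDegree d + k, by omega⟩ : Fin N)]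
  · rw [Matrix.mul_apply, Finset.mul_sum, map_sum,
      Finset.sum_eq_single (⟨sDegree d + l, by omega⟩ : Fin N)]
    · simp only [Matrix.of_apply]
      rw [mul_left_comm, ← Algebra.smul_def, map_smul, coeff_elemSchur_mul, if_pos, smul_eq_mul]
      · congr 2
        push_cast
        ring
      · constructor <;> push_cast <;> ring
    · intro b _ hb
      simp only [Matrix.of_apply]
      rw [mul_left_comm, ← Algebra.smul_def, map_smul, coeff_elemSchur_mul, if_neg, smul_zero]
      rintro ⟨_, h2⟩
      exact hb (Fin.ext (by simp only; omega))
    · simp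
  · intro a _ ha
    rw [Matrix.mul_apply, Finset.mul_sum, map_sum]
    refine Finset.sum_eq_zero fun b _ => ?_
    simp only [Matrix.of_apply]
    rw [mul_left_comm, ← Algebra.smul_def, map_smul, coeff_elemSchur_mul, if_neg, smul_zero]
    rintro ⟨h1, _⟩
    exact ha (Fin.ext (by simp only; omega))
  · simp

open scoped MvPowerSeries.WithPiTopology in
-- The coefficients of each entry are eventually constant, and the determinant is continuous in the
-- topology of coefficientwise convergence. This avoids bounding degrees inside the determinant.
theorem tendsto_coeff_det_tauTrunc (n : ℕ) (μ : Moments) (d : Time →₀ ℕ) :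
    Filter.Tendsto (fun N => MvPowerSeries.coeff d (tauTrunc n μ N).det) Filter.atTop
      (nhds (MvPowerSeries.coeff d (tau n μ))) := by
  refine ((MvPowerSeries.WithPiTopology.continuous_coeff ℂ d).tendsto _).comp ?_
  refine ((Continuous.matrix_det continuous_id).tendsto _).comp ?_
  refine tendsto_pi_nhds.2 fun k => tendsto_pi_nhds.2 fun l => ?_
  rw [MvPowerSeries.WithPiTopology.tendsto_iff_coeff_tendsto]
  intro e
  refine tendsto_const_nhds.congr' ?_
  filter_upwards [Filter.eventually_ge_atTop (indexBound n e)] with N hN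
  exact (coeff_tauTrunc n μ hN k l).symm

theorem coeff_tau_eq_finsum (n : ℕ) (μ : Moments) (d : Time →₀ ℕ) :
    MvPowerSeries.coeff d (tau n μ) = ∑ᶠ q : (Fin n ↪o ℕ) × (Fin n ↪o ℕ),
      MvPowerSeries.coeff d (plucker q.1 q.2 μ • (schur t q.1 * schur s q.2)) := by
  refine tendsto_nhds_unique (tendsto_coeff_det_tauTrunc n μ d) (tendsto_const_nhds.congr' ?_)
  filter_upwards [Filter.eventually_ge_atTop (indexBound n d)] with N hN
  rw [det_tauTrunc, map_sum, finsum_eq_sum_of_support_subset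
    (s := Finset.univ.image (liftEmb (n := n) N)), Finset.sum_image]
  · exact (liftEmb_injective N).injOn
  · intro q hq
    rw [Finset.coe_image, Finset.coe_univ, Set.image_univ]
    refine mem_range_liftEmb hN fun h0 => hq ?_
    dsimp only
    rw [map_smul, h0, smul_zero]

theorem finite_support_smul_schur {n : ℕ} (c : (Fin n ↪o ℕ) × (Fin n ↪o ℕ) → ℂ) (d : Time →₀ ℕ) :
    {q : (Fin n ↪o ℕ) × (Fin n ↪o ℕ) |
      MvPowerSeries.coeff d (c q • (schur t q.1 * schur s q.2)) ≠ 0}.Finite :=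
  (finite_support_schur n d).subset fun q hq h0 => hq (by rw [map_smul, h0, smul_zero])

theorem hasFormalSum_tau (n : ℕ) (μ : Moments) :
    HasFormalSum (fun q : (Fin n ↪o ℕ) × (Fin n ↪o ℕ) =>
      plucker q.1 q.2 μ • (schur t q.1 * schur s q.2)) (tau n μ) := fun d =>
  ⟨finite_support_smul_schur (fun q => plucker q.1 q.2 μ) d, coeff_tau_eq_finsum n μ d⟩

/-- For a fixed monomial the contributing index pairs do not depend on the moments, so the Plücker
expansion is differentiated as a finite sum. Uniqueness of Lie derivatives identifies the result. -/
theorem hasFormalSum_L_tau (n : ℕ) (k : ℤ) (μ : Moments) :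
    HasFormalSum (fun q : (Fin n ↪o ℕ) × (Fin n ↪o ℕ) =>
      pluckerDeriv (masterField k) q.1 q.2 μ • (schur t q.1 * schur s q.2)) (L n k (tau n μ)) := by
  intro d
  refine ⟨finite_support_smul_schur _ d, (hasLieDerivAt_coeff_tau n k μ d).unique ?_⟩
  have hsub : ∀ c : (Fin n ↪o ℕ) × (Fin n ↪o ℕ) → ℂ,
      ∑ᶠ q, MvPowerSeries.coeff d (c q • (schur t q.1 * schur s q.2)) =
        ∑ q ∈ (finite_support_schur n d).toFinset,
          c q * MvPowerSeries.coeff d (schur t q.1 * schur s q.2) := by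
    intro c
    rw [finsum_eq_sum_of_support_subset (s := (finite_support_schur n d).toFinset)]
    · exact Finset.sum_congr rfl fun q _ => by rw [map_smul, smul_eq_mul]
    · intro q hq
      rw [Set.Finite.coe_toFinset]
      intro h0
      exact hq (by dsimp only; rw [map_smul, h0, smul_zero])
  simp only [coeff_tau_eq_finsum]
  rw [hsub fun q => pluckerDeriv (masterField k) q.1 q.2 μ]
  intro γ h0 hγ
  simp only [fun u => hsub fun q => plucker q.1 q.2 (γ u)]
  exact HasDerivAt.fun_sum fun q _ =>
    (hasLieDerivAt_plucker (masterField k) q.1 q.2 μ γ h0 hγ).mul_const _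


/-! ### Quasi-definite functionals and the reflected data -/

theorem IsQuasiDefinite.regular {μ : Moments} (hμ : IsQuasiDefinite (toeplitz μ)) : Regular μ := by
  intro n
  rcases n.eq_zero_or_pos with rfl | hn
  · simp [toeplitzDet]
  · simpa only [toeplitz_z, toeplitzDet] using hμ n hn

theorem IsRightBiorthogonal.reflect {μ : Moments} {f' g' : ℕ → ℂ[T;T⁻¹]}
    (hfg : IsRightBiorthogonal (toeplitz μ) f' g') :
    IsRightBiorthogonal (toeplitz (reflect μ)) g' f' := by
  refine ⟨fun n => ⟨(hfg.1 n).2.2.1, (hfg.1 n).2.2.2, (hfg.1 n).1, (hfg.1 n).2.1⟩, ?_, ?_⟩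
  · intro n m hnm
    rw [toeplitz_reflect]
    exact hfg.2.1 m n hnm.symm
  · intro n
    rw [toeplitz_reflect]
    exact hfg.2.2 n

theorem eq_g_of_biorthogonal {μ : Moments} (hμ : Regular μ) {f' g' : ℕ → ℂ[T;T⁻¹]}
    (hfg : IsRightBiorthogonal (toeplitz μ) f' g') (hf : IsMonic f') (hg : IsMonic g') :
    g' = g μ := by
  rw [← f_reflect]
  exact eq_f_of_biorthogonal hμ.reflect hfg.reflect hg hf

theorem dualPair_g {μ : Moments} (hμ : Regular μ) : DualPair (g μ) (fCoeff (reflect μ)) :=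
  f_reflect μ ▸ dualPair_f hμ.reflect

theorem dualPair_fDual {μ : Moments} (hμ : Regular μ) :
    DualPair (fDual μ) (gDualCoeff (reflect μ)) :=
  gDual_reflect μ ▸ dualPair_gDual hμ.reflect

theorem represents_A2 {μ : Moments} (hμ : Regular μ) :
    Represents (A2 μ) (fun P => z 1 * P) (g μ) := by
  rw [← A1_reflect, ← f_reflect]
  exact represents_A1 hμ.reflect

theorem represents_A2star {μ : Moments} (hμ : Regular μ) :
    Represents (A2star μ) (fun P => z (-1) * P) (g μ) := by
  rw [← A1star_reflect, ← f_reflect]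
  exact represents_A1star hμ.reflect

theorem A2_eq_zero (μ : Moments) {i j : ℕ} (hij : i + 2 < j ∨ j + 2 < i) : A2 μ i j = 0 := by
  rw [← A1_reflect]
  exact A1_eq_zero _ hij

theorem mul_A2_A2star {μ : Moments} (hμ : Regular μ) : mul (A2 μ) (A2star μ) = 1 := by
  rw [← A1_reflect, ← A1star_reflect]
  exact mul_A1_A1star hμ.reflect

theorem mul_A2star_A2 {μ : Moments} (hμ : Regular μ) : mul (A2star μ) (A2 μ) = 1 := by
  rw [← A1_reflect, ← A1star_reflect]
  exact mul_A1star_A1 hμ.reflect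

end AblowitzLadik

end

/-! ### The theorem assembled -/

theorem mainTheorem1 :
    -- the master symmetries form a centerless Virasoro algebra and are master symmetries
    (∀ k l : ℤ,
      IsLieBracket (alField k) (alField l) 0 ∧
      IsLieBracket (masterField k) (masterField l) (((l - k : ℤ) : ℂ) • masterField (k + l)) ∧
      IsLieBracket (masterField k) (alField l) ((l : ℂ) • alField (k + l)) ∧
      ∀ Z : VField, IsLieBracket (masterField k) (alField l) Z → IsLieBracket Z (alField l) 0) ∧
    -- the Lax pair on the CMV matrices
    (∀ 𝓛 : BiMomentFunctional, IsToeplitz 𝓛 → IsQuasiDefinite 𝓛 →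
      ∀ μ : Moments, μ = moments 𝓛 →
      (IsRightBiorthogonal 𝓛 (f μ) (g μ) ∧ IsMonic (f μ) ∧ IsMonic (g μ) ∧
        ∀ f' g' : ℕ → ℂ[T;T⁻¹], IsRightBiorthogonal 𝓛 f' g' → IsMonic f' → IsMonic g' →
          f' = f μ ∧ g' = g μ) ∧
      (∀ n, h μ n = 𝓛 (f μ n) (g μ n)) ∧
      (IsBasis (f μ) ∧ IsBasis (g μ) ∧ IsBasis (gDual μ) ∧ IsBasis (fDual μ)) ∧
      (Represents (A1 μ) (fun P => z 1 * P) (f μ) ∧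
        Represents (A2 μ) (fun P => z 1 * P) (g μ) ∧
        Represents (A1star μ) (fun P => z (-1) * P) (f μ) ∧
        Represents (A2star μ) (fun P => z (-1) * P) (g μ)) ∧
      (∀ i j : ℕ, i + 2 < j ∨ j + 2 < i → A1 μ i j = 0 ∧ A2 μ i j = 0) ∧
      (mul (A1 μ) (A1star μ) = 1 ∧ mul (A1star μ) (A1 μ) = 1 ∧
        mul (A2 μ) (A2star μ) = 1 ∧ mul (A2star μ) (A2 μ) = 1) ∧
      (∃ D1 D1s D2 D2s : SMatrix,
        Represents D1 ddz (f μ) ∧ Represents D1s.transpose ddz (gDual μ) ∧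
        Represents D2 ddz (g μ) ∧ Represents D2s.transpose ddz (fDual μ)) ∧
      ∀ D1 D1s D2 D2s : SMatrix,
        Represents D1 ddz (f μ) → Represents D1s.transpose ddz (gDual μ) →
        Represents D2 ddz (g μ) → Represents D2s.transpose ddz (fDual μ) →
        ∀ (k : ℤ) (i j : ℕ),
          HasLieDerivAt (masterField k) (fun ν => A1 ν i j) μ
            (commutator (A1 μ)
              (strictLower (mul D1 (A1pow μ (k + 1)))
                + strictLower (mul (A1pow μ (k + 1)) D1s)
                + (k : ℂ) • strictLower (A1pow μ k)) i j) ∧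
          HasLieDerivAt (masterField k) (fun ν => A2 ν i j) μ
            (commutator
              (strictLower (mul D2 (A2pow μ (1 - k)))
                + strictLower (mul (A2pow μ (1 - k)) D2s)
                - (k : ℂ) • strictLower (A2pow μ (-k)))
              (A2 μ) i j)) ∧
    -- the moment series solve the hierarchy
    (∀ (μ : Moments) (j : ℤ),
      MvPowerSeries.constantCoeff (momentSeries μ j) = μ j ∧
      ∀ k : ℕ+, dt k (momentSeries μ j) = momentSeries μ (j + k) ∧
        ds k (momentSeries μ j) = momentSeries μ (j - k)) ∧
    -- the operators `L_k^{(n)}` form a centerless Virasoro algebra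
    (∀ (n : ℕ) (k l : ℤ) (F : Series),
      L n k (L n l F) - L n l (L n k F) = ((k - l : ℤ) : ℂ) • L n (k + l) F) ∧
    -- the action of the master symmetries on the tau-functions
    (∀ (n : ℕ) (μ : Moments),
      HasFormalSum (fun q : (Fin n ↪o ℕ) × (Fin n ↪o ℕ) =>
        plucker q.1 q.2 μ • (schur t q.1 * schur s q.2)) (tau n μ) ∧
      ∀ k : ℤ,
        (∀ d, HasLieDerivAt (masterField k) (fun ν => MvPowerSeries.coeff d (tau n ν)) μ
          (MvPowerSeries.coeff d (L n k (tau n μ)))) ∧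
        ∃ Vp : (Fin n ↪o ℕ) → (Fin n ↪o ℕ) → ℂ,
          (∀ i j, HasLieDerivAt (masterField k) (plucker i j) μ (Vp i j)) ∧
          HasFormalSum (fun q : (Fin n ↪o ℕ) × (Fin n ↪o ℕ) =>
            Vp q.1 q.2 • (schur t q.1 * schur s q.2)) (L n k (tau n μ))) := by
  refine ⟨fun k l => ⟨isLieBracket_alField k l, isLieBracket_masterField k l,
    isLieBracket_masterField_alField k l, isLieBracket_bracket_alField k l⟩, ?_,
    fun μ j => ⟨constantCoeff_momentSeries μ j,
      fun k => ⟨dt_momentSeries μ j k, ds_momentSeries μ j k⟩⟩,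
    L_commutator, fun n μ => ⟨hasFormalSum_tau n μ, fun k => ⟨hasLieDerivAt_coeff_tau n k μ,
      fun i j => pluckerDeriv (masterField k) i j μ,
      fun i j => hasLieDerivAt_plucker (masterField k) i j μ, hasFormalSum_L_tau n k μ⟩⟩⟩
  intro 𝓛 hT hQ μ hμ𝓛
  -- A Toeplitz form is determined by its bi-moments, so it may be replaced by `toeplitz μ`.
  obtain rfl : toeplitz μ = 𝓛 := hμ𝓛 ▸ toeplitz_moments 𝓛 hT
  have hμ : Regular μ := hQ.regular
  refine ⟨⟨isRightBiorthogonal_f_g hμ, fun n => f_coeff_leadExp (hμ n),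
      fun n => g_coeff_leadExp (hμ n), fun f' g' hfg hf hg =>
        ⟨eq_f_of_biorthogonal hμ hfg hf hg, eq_g_of_biorthogonal hμ hfg hf hg⟩⟩,
    fun _ => rfl,
    ⟨(dualPair_f hμ).isBasis, (dualPair_g hμ).isBasis, (dualPair_gDual hμ).isBasis,
      (dualPair_fDual hμ).isBasis⟩,
    ⟨represents_A1 hμ, represents_A2 hμ, represents_A1star hμ, represents_A2star hμ⟩,
    fun i j hij => ⟨A1_eq_zero μ hij, A2_eq_zero μ hij⟩,
    ⟨mul_A1_A1star hμ, mul_A1star_A1 hμ, mul_A2_A2star hμ, mul_A2star_A2 hμ⟩,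
    ⟨_, Matrix.transpose _, _, Matrix.transpose _, (dualPair_f hμ).represents ddz,
      (dualPair_gDual hμ).represents ddz, (dualPair_g hμ).represents ddz,
      (dualPair_fDual hμ).represents ddz⟩,
    fun D1 D1s D2 D2s h1 h1s h2 h2s k i j =>
      ⟨hasLieDerivAt_A1 hμ h1 h1s k i j, hasLieDerivAt_A2 hμ h2 h2s k i j⟩⟩
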